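/- Let $X$ be a measurable space that is countably separated (some countable family of measurable sets separates its points; e.g. a standard Borel space), with a probability measure $m$. Let $l^1_+(X)$ be the cone of finite discrete measures $\xi=\sum_{k=1}^\infty r_k\delta_{x_k}$, $r_k>0$, $\sum_k r_k<\infty$, with the $\sigma$-algebra generated by the maps $\xi\mapsto\xi(A)$; below we write $\xi=\{r_k,x_k\}$ with distinct atoms $x_k$. There is a unique measure $\mathcal L$ on $l^1_+(X)$ with $$\int_{l^1_+(X)}\exp\Bigl(-\sum_k r_kf(x_k)\Bigr)\,d\mathcal L(\xi)=\exp\Bigl(-\int_X\log f\,dm\Bigr)$$ for all measurable $f\ge0$ on $X$ that are $m$-almost everywhere positive and have $\log f\in L^1(m)$. Put $\operatorname{INT}H^\pm=L^2(l^1_+(X),\mathcal L)$ (complex-valued functions). Let $G=SL(2,\mathbb R)$ and let $P\subset G$ be the subgroup of matrices $(\epsilon,\gamma)=\begin{pmatrix}\epsilon^{-1}&0\\ \gamma&\epsilon\end{pmatrix}$. Let $G^X$, $P^X$ be the groups of bounded measurable maps $X\to G$, $X\to P$ with pointwise multiplication. The group $G$ acts on the upper half-plane $L$ by $gz=\frac{\delta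 z+\gamma}{\beta z+\alpha}$ for $g=\begin{pmatrix}\alpha&\beta\\ \gamma&\delta\end{pmatrix}$. Let $L^X$ be the set of measurable maps $z:X\to L$ that are bounded in the hyperbolic metric, with the pointwise action of $G^X$. For $z_1,z_2\in L$ put $c(z_1,z_2)=\log(-i(z_1-\overline{z_2}))$ (principal branch), and with $z_0=i$ put $$u^+(g,z)=\overline{u^-(g,z)}=c(gz,gz_0)-c(z,z_0)-\tfrac12\bigl(c(gz_0,gz_0)-c(z_0,z_0)\bigr).$$ For $z\in L^X$ let $F^+_z(\xi)=\exp\bigl(i\sum_k r_k^2z(x_k)\bigr)$ and $F^-_z=\overline{F^+_z}$. The integral model $\operatorname{INT}T^\pm$ of $P^X$ is the unitary representation $V^\pm$ of $P^X$ on $\operatorname{INT}H^\pm$, existing and uniquely determined by the following formulas, for bounded measurable $\gamma:X\to\mathbb R$ and measurable $r_0:X\to(0,\infty)$ with $r_0,r_0^{-1}$ bounded: $$(V^\pm(1,\gamma)F)(\xi)=e^{\pm i\sum_k r_k^2\gamma(x_k)}F(\xi),\qquad (V^\pm(r_0,0)F)(\xi)=e^{\frac12\int_X\log r_0\,dm}\,F(r_0\xi),$$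 where $r_0\xi=\{r_0(x_k)r_k,x_k\}$, and $V^\pm=\mathrm{id}$ on the centre of $P^X$. Theorem. For either choice of sign, the functionals $F^\pm_z$, $z\in L^X$, lie in $\operatorname{INT}H^\pm$ and form a total subset, the functions $x\mapsto u^\pm(g(x),z(x))$ are $m$-integrable for $g\in G^X$, $z\in L^X$, and the operators defined by $$U^\pm(g)F^\pm_z=\exp\Bigl(\tfrac12\int_Xu^\pm(g(x),z(x))\,dm(x)\Bigr)F^\pm_{gz},\qquad g\in G^X,\ z\in L^X,$$ extend to unitary operators $U^\pm(g)$ on $\operatorname{INT}H^\pm$. They define a projective unitary representation of $G^X$, i.e. $U^\pm(1)=1$ and $U^\pm(g_1g_2)=\sigma^\pm(g_1,g_2)\,U^\pm(g_1)U^\pm(g_2)$ with scalars $|\sigma^\pm(g_1,g_2)|=1$. The restriction of $U^\pm$ to $P^X$ coincides with the integral model $V^\pm=\operatorname{INT}T^\pm$. -/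

import Mathlib

open MeasureTheory

namespace CurrentRep

/-- The group `SL(2, ℝ)`. -/
abbrev SL2 : Type := Matrix.SpecialLinearGroup (Fin 2) ℝ

/-! ### The Lobachevsky plane and the action `z ↦ (δ z + γ) / (β z + α)` -/

/-- For `g = (α β; γ δ)` the matrix `(δ γ; β α)`, again of determinant one. -/
def flip (g : SL2) : SL2 :=
  ⟨!![g 1 1, g 1 0; g 0 1, g 0 0], by
    have h := g.det_coe
    rw [Matrix.det_fin_two] at h
    rw [Matrix.det_fin_two_of]
    linarith⟩

lemma flip_smul_coe (g : SL2) (z : UpperHalfPlane) :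
    ((flip g • z : UpperHalfPlane) : ℂ) =
      ((g 1 1 : ℝ) * (z : ℂ) + (g 1 0 : ℝ)) / ((g 0 1 : ℝ) * (z : ℂ) + (g 0 0 : ℝ)) := by
  rw [UpperHalfPlane.coe_specialLinearGroup_apply]
  simp [flip]

/-- The action of `g = (α β; γ δ)` on the upper half-plane, `z ↦ (δ z + γ) / (β z + α)`. -/
noncomputable def act (g : SL2) (z : UpperHalfPlane) : UpperHalfPlane :=
  ⟨((g 1 1 : ℝ) * (z : ℂ) + (g 1 0 : ℝ)) / ((g 0 1 : ℝ) * (z : ℂ) + (g 0 0 : ℝ)), by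
    rw [← flip_smul_coe]; exact (flip g • z).im_pos⟩

lemma act_eq (g : SL2) (z : UpperHalfPlane) : act g z = flip g • z :=
  UpperHalfPlane.ext (flip_smul_coe g z).symm

/-! ### Current groups -/

section Currents

variable (X : Type*) [MeasurableSpace X]

/-- The current group `SL(2, ℝ)^X`: bounded measurable maps `X → SL(2, ℝ)` under pointwise
multiplication. -/
def Currents : Subgroup (X → SL2) where
  carrier := {g | (∀ i j, Measurable fun x => g x i j) ∧ ∃ C : ℝ, ∀ x i j, |g x i j| ≤ C}
  mul_mem' := by
    rintro a b ⟨ha, Ca, hCa⟩ ⟨hb, Cb, hCb⟩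
    have key : ∀ x i j, (a * b) x i j = a x i 0 * b x 0 j + a x i 1 * b x 1 j := by
      intro x i j
      simp [Matrix.SpecialLinearGroup.coe_mul, Matrix.mul_apply, Fin.sum_univ_two]
    refine ⟨fun i j => ?_, Ca * Cb + Ca * Cb, fun x i j => ?_⟩
    · simp only [key]
      exact ((ha i 0).mul (hb 0 j)).add ((ha i 1).mul (hb 1 j))
    · rw [key]
      refine (abs_add_le _ _).trans (add_le_add ?_ ?_) <;> rw [abs_mul]
      · exact mul_le_mul (hCa _ _ _) (hCb _ _ _) (abs_nonneg _)
          ((abs_nonneg _).trans (hCa x i 0))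
      · exact mul_le_mul (hCa _ _ _) (hCb _ _ _) (abs_nonneg _)
          ((abs_nonneg _).trans (hCa x i 0))
  one_mem' := by
    refine ⟨fun i j => ?_, 1, fun x i j => ?_⟩
    · exact measurable_const
    · fin_cases i <;> fin_cases j <;> simp
  inv_mem' := by
    rintro a ⟨ha, C, hC⟩
    have key : ∀ x i j, (a⁻¹) x i j = (!![a x 1 1, -a x 0 1; -a x 1 0, a x 0 0] :
        Matrix (Fin 2) (Fin 2) ℝ) i j := by
      intro x i j
      rw [Pi.inv_apply, Matrix.SpecialLinearGroup.SL2_inv_expl]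
      rfl
    refine ⟨fun i j => ?_, C, fun x i j => ?_⟩
    · simp only [key]
      fin_cases i <;> fin_cases j
      · simpa using ha 1 1
      · exact (ha 0 1).neg
      · exact (ha 1 0).neg
      · simpa using ha 0 0
    · rw [key]
      fin_cases i <;> fin_cases j
      · simpa using hC x 1 1
      · simpa using hC x 0 1
      · simpa using hC x 1 0
      · simpa using hC x 0 0

/-- The current group `P^X` of the group `P` of lower triangular matrices
`(ε⁻¹ 0; γ ε)`, as a subgroup of `SL(2, ℝ)^X`. -/
def ParabolicCurrents : Subgroup (Currents X) where
  carrier := {g | ∀ x, g.1 x 0 1 = 0}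
  mul_mem' := by
    intro a b ha hb x
    have := ha x
    have := hb x
    simp_all [Matrix.SpecialLinearGroup.coe_mul, Matrix.mul_apply, Fin.sum_univ_two]
  one_mem' := by
    intro x
    simp
  inv_mem' := by
    intro a ha x
    have := ha x
    simp_all [Matrix.SpecialLinearGroup.SL2_inv_expl]

/-- The set `L^X` of bounded measurable maps from `X` to the Lobachevsky plane (bounded for the
hyperbolic metric, that is, with relatively compact range). -/
structure PlaneMaps where
  /-- the underlying map -/
  toFun : X → UpperHalfPlane
  measurable : Measurable toFun
  bounded : Bornology.IsBounded (Set.range toFun)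

end Currents

variable {X : Type*} [MeasurableSpace X]

/-- The entry `ε` of an element of `P^X`. -/
def eps (p : ParabolicCurrents X) (x : X) : ℝ := p.1.1 x 1 1

/-- The entry `γ` of an element of `P^X`. -/
def gam (p : ParabolicCurrents X) (x : X) : ℝ := p.1.1 x 1 0

/-- The pointwise action of `SL(2, ℝ)^X` on `L^X`. -/
noncomputable def actX (g : Currents X) (z : PlaneMaps X) : PlaneMaps X where
  toFun x := act (g.1 x) (z.toFun x)
  measurable := by
    have hz : Measurable fun x => ((z.toFun x : UpperHalfPlane) : ℂ) :=
      UpperHalfPlane.continuous_coe.measurable.comp z.measurable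
    have hg : ∀ i j, Measurable fun x => ((g.1 x i j : ℝ) : ℂ) := fun i j =>
      Complex.measurable_ofReal.comp (g.2.1 i j)
    rw [measurable_comap_iff]
    exact (((hg 1 1).mul hz).add (hg 1 0)).div (((hg 0 1).mul hz).add (hg 0 0))
  bounded := by
    obtain ⟨C, hC⟩ := g.2.2
    have hK : IsCompact {h : SL2 | ∀ i j, |h i j| ≤ C} := by
      have h1 : IsCompact (Set.pi Set.univ fun _ : Fin 2 =>
          Set.pi Set.univ fun _ : Fin 2 => Set.Icc (-C) C) :=
        isCompact_univ_pi fun _ => isCompact_univ_pi fun _ => isCompact_Icc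
      have h2 := Matrix.SpecialLinearGroup.isClosedEmbedding_val.isCompact_preimage h1
      refine h2.of_isClosed_subset ?_ fun h hh => ?_
      · simp only [Set.ofPred_forall]
        refine isClosed_iInter fun i => isClosed_iInter fun j => ?_
        have hc : Continuous fun h : SL2 => |h i j| :=
          (continuous_subtype_val.matrix_elem i j).abs
        exact isClosed_le hc continuous_const
      · exact fun i _ j _ => abs_le.1 (hh i j)
    have hL : IsCompact (closure (Set.range z.toFun)) := z.bounded.isCompact_closure
    have hI := (hK.prod hL).image (continuous_smul (M := SL2) (X := UpperHalfPlane))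
    refine hI.isBounded.subset ?_
    rintro _ ⟨x, rfl⟩
    refine ⟨(flip (g.1 x), z.toFun x), ⟨fun i j => ?_, subset_closure ⟨x, rfl⟩⟩,
      (act_eq _ _).symm⟩
    fin_cases i <;> fin_cases j
    · simpa [flip] using hC x 1 1
    · simpa [flip] using hC x 1 0
    · simpa [flip] using hC x 0 1
    · simpa [flip] using hC x 0 0

/-! ### The cone `l¹₊(X)` and its Lebesgue measure -/

/-- The predicate `ξ = ∑ₖ rₖ δ_{xₖ}` with `rₖ > 0` and `∑ₖ rₖ < ∞`. -/
def IsDiscrete (ξ : Measure X) : Prop :=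
  ∃ (r : ℕ → ℝ) (x : ℕ → X), (∀ k, 0 < r k) ∧ Summable r ∧
    ξ = Measure.sum fun k => ENNReal.ofReal (r k) • Measure.dirac (x k)

variable (X) in
/-- The cone `l¹₊(X)`, with the σ-algebra generated by the evaluations `ξ ↦ ξ(A)`. -/
def Cone : Type _ := {ξ : Measure X // IsDiscrete ξ}

instance : MeasurableSpace (Cone X) := inferInstanceAs (MeasurableSpace {ξ : Measure X // IsDiscrete ξ})

/-- `L` is the infinite-dimensional Lebesgue measure: its Laplace transform is
`∫ exp (-∑ₖ rₖ f(xₖ)) dL(ξ) = exp (-∫ log f dm)`; the sum `∑ₖ rₖ f(xₖ) = ∫ f dξ` is taken in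
`[0, ∞]` and `exp (-∞) = 0`. -/
def IsLebesgueMeasure (m : Measure X) (L : Measure (Cone X)) : Prop :=
  ∀ f : X → ℝ, Measurable f → (∀ x, 0 ≤ f x) → (∀ᵐ x ∂m, 0 < f x) →
    Integrable (fun x => Real.log (f x)) m →
    ∫⁻ ξ : Cone X, EReal.exp (-((∫⁻ x, ENNReal.ofReal (f x) ∂ξ.1 : ENNReal) : EReal)) ∂L =
      ENNReal.ofReal (Real.exp (-∫ x, Real.log (f x) ∂m))

/-- The sum `∑ₖ rₖ² w(xₖ)` over the atoms of `ξ = ∑ₖ rₖ δ_{xₖ}` (`xₖ` distinct). -/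
noncomputable def sumSq (ξ : Cone X) (w : X → ℂ) : ℂ :=
  ∑' x : X, ((ξ.1.real {x} ^ 2 : ℝ) : ℂ) * w x

/-- The multiplicator `ξ = {rₖ, xₖ} ↦ a ξ = {a(xₖ) rₖ, xₖ}`. -/
noncomputable def scale (a : X → ℝ) (ha : Measurable a) (hpos : ∀ x, 0 < a x)
    (hb : ∃ C, ∀ x, a x ≤ C) (ξ : Cone X) : Cone X :=
  ⟨ξ.1.withDensity fun x => ENNReal.ofReal (a x), by
    obtain ⟨ξ, r, x, hr, hs, rfl⟩ := ξ
    obtain ⟨C, hC⟩ := hb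
    refine ⟨fun k => a (x k) * r k, x, fun k => mul_pos (hpos _) (hr k), ?_, ?_⟩
    · exact Summable.of_nonneg_of_le (fun k => (mul_pos (hpos _) (hr k)).le)
        (fun k => mul_le_mul_of_nonneg_right (hC _) (hr k).le) (hs.mul_left C)
    · simp only [withDensity_sum]
      congr 1
      ext1 k
      rw [withDensity_smul_measure, dirac_withDensity' ha.ennreal_ofReal, smul_smul,
        ENNReal.ofReal_mul (hpos _).le, mul_comm]⟩

/-! ### The functionals and cocycles -/

/-- The choice of sign in `T^±`, `U^±`, `F^±`, `u^±`. -/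
inductive Sgn
  | plus
  | minus

/-- The identity for the sign `+`, complex conjugation for the sign `-`. -/
noncomputable def Sgn.conj : Sgn → ℂ → ℂ
  | .plus, w => w
  | .minus, w => star w

/-- `c(z₁, z₂) = log (-i (z₁ - conj z₂))`, principal branch (the argument has positive real
part). -/
noncomputable def c (z₁ z₂ : UpperHalfPlane) : ℂ :=
  Complex.log (-Complex.I * ((z₁ : ℂ) - star (z₂ : ℂ)))

/-- `u⁺(g, z) = c(gz, gz₀) - c(z, z₀) - ½ (c(gz₀, gz₀) - c(z₀, z₀))` with `z₀ = i`, and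
`u⁻ = conj u⁺`. -/
noncomputable def u (s : Sgn) (g : SL2) (z : UpperHalfPlane) : ℂ :=
  s.conj (c (act g z) (act g UpperHalfPlane.I) - c z UpperHalfPlane.I -
    (1 / 2) * (c (act g UpperHalfPlane.I) (act g UpperHalfPlane.I) -
      c UpperHalfPlane.I UpperHalfPlane.I))

/-- `F⁺_z(ξ) = exp (i ∑ₖ rₖ² z(xₖ))` and `F⁻_z = conj F⁺_z`. -/
noncomputable def F (s : Sgn) (z : PlaneMaps X) (ξ : Cone X) : ℂ :=
  s.conj (Complex.exp (Complex.I * sumSq ξ fun x => (z.toFun x : ℂ)))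

/-! ### The representations -/

/-- The Hilbert space `INT H^±`, realized as `L²(l¹₊(X), L)`. -/
abbrev INT (L : Measure (Cone X)) : Type _ := Lp ℂ 2 L

/-- `V` is the integral model `U^± = INT T^±` of the group `P^X`: a unitary representation with
* `(V(1, γ) Φ)(ξ) = exp (± i ∑ₖ rₖ² γ(xₖ)) Φ(ξ)`,
* `(V(r₀, 0) Φ)(ξ) = exp (½ ∫ log r₀ dm) Φ(r₀ ξ)` for positive `r₀`,
* `V = id` on the centre of `P^X`. -/
def IsIntegralModel (m : Measure X) (L : Measure (Cone X)) (s : Sgn)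
    (V : ParabolicCurrents X →* (INT L ≃ₗᵢ[ℂ] INT L)) : Prop :=
  (∀ p : ParabolicCurrents X, (∀ x, eps p x = 1) → ∀ Φ : INT L,
    ∀ᵐ ξ ∂L, V p Φ ξ =
      s.conj (Complex.exp (Complex.I * sumSq ξ fun x => ((gam p x : ℝ) : ℂ))) * Φ ξ) ∧
  (∀ p : ParabolicCurrents X, (∀ x, gam p x = 0) →
    ∀ (hm : Measurable (eps p)) (hpos : ∀ x, 0 < eps p x) (hb : ∃ C, ∀ x, eps p x ≤ C),
    ∀ Φ : INT L, ∀ᵐ ξ ∂L, V p Φ ξ =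
      (Real.exp (1 / 2 * ∫ x, Real.log (eps p x) ∂m) : ℝ) * Φ (scale (eps p) hm hpos hb ξ)) ∧
  (∀ p ∈ Subgroup.center (ParabolicCurrents X), V p = 1)

/-- A projective unitary representation: unitary operators with `U(1) = 1` and
`U(gh) = σ(g, h) U(g) U(h)` for scalars `σ(g, h)` of modulus one. -/
def IsProjectiveUnitaryRep {G H : Type*} [Group G] [NormedAddCommGroup H] [InnerProductSpace ℂ H]
    (U : G → (H ≃ₗᵢ[ℂ] H)) : Prop :=
  U 1 = 1 ∧ ∃ σ : G → G → ℂ, (∀ g h, ‖σ g h‖ = 1) ∧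
    ∀ g h v, U (g * h) v = σ g h • U g (U h v)

end CurrentRep

namespace CurrentRep

open Filter
open scoped Topology ENNReal NNReal InnerProductSpace

/-! Everything rests on one integral. For measurable bounded `w` with real part bounded away from
zero, `∫ exp (-∑ rₖ² w(xₖ)) dL = C exp (-½ ∫ log w dm)`, where `C` does not depend on `w`
(`IsLebesgueMeasure.integral_exp_sumSq`). It is proved by approximation. Under the probability
measure `exp (-ξ(X)) dL` the masses of the cells of a finite partition are independent Gamma
variables with shapes `m(Aⱼ)` (`IsLebesgueMeasure.map_cells`). If `w = aⱼ` on `Aⱼ`, the integral of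
`exp (-∑ aⱼ ξ(Aⱼ)²)` is therefore a product of one-dimensional integrals. In each of them the weight
`exp r` cancels the exponential of the Gamma density, which leaves a constant times `aⱼ ^
(-m(Aⱼ)/2)`. As the partitions shrink to points, `∑ aⱼ ξ(Aⱼ)²` tends to `∑ rₖ² w(xₖ)` because `ξ` is
discrete. The constants of the partitions are bounded by `exp 2`, and they converge because the case
`w = 1` does.

With `w = -i(z₂ - conj z₁)` this gives `⟪F_{z₁}, F_{z₂}⟫ = C exp (-½ ∫ c(z₂, z₁) dm)` for the sign
plus, and the conjugate for minus. The cocycle identity `u(g, z₁) + conj u(g, z₂) = c(gz₁, gz₂) -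
c(z₁, z₂)` (`u_add_star`) says that the prescribed images of the `F_z` have the same Gram matrix as
the `F_z`. Both families are total, so a unitary operator carries one to the other. Comparing Gram
matrices again shows that the scalar relating `U(gh)` to `U(g)U(h)` on `F_z` has modulus one and
does not depend on `z`.

Totality: for `z = i(1 + g)` with `g ≥ 0`, `F_z` is `exp (-∑ rₖ²)` times a member of a
multiplicative system of bounded functions. That system generates the σ-algebra, since `ξ` can be
recovered from its squared weights (`cone_measurableSpace_le_of_sq`).

On `P^X` the function `u` equals `log |ε|`, independent of `z`, and `z` goes to `ε² z + ε γ`. On the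
`F_z` the operators thus act as the multiplications and dilations of the integral model, and by
totality they do so everywhere. The behaviour of `L` under dilations follows from its uniqueness.

Existence of `L`: take `s D`, with `s` Lebesgue on the half-line and `D` a stick-breaking random
measure with uniform breaks. Integrating out `s` reduces the Laplace transform to `E[1 / D(f)] = exp
(-∫ log f dm)`. This follows from a differential equation in a shift parameter
(`integral_inv_stickMean`). Uniqueness holds because exponentials of linear functionals form a
multiplicative generating system. -/

/-! ### Multiplicative systems that determine finite measures -/

/-- Finite measures on a finite power of `[-1, 1]` with the same mixed moments agree. -/
theorem measure_cube_ext {ι : Type*} [Fintype ι] {μ ν : Measure (ι → Set.Icc (-1 : ℝ) 1)}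
    [IsFiniteMeasure μ] [IsFiniteMeasure ν]
    (h : ∀ n : ι → ℕ, ∫ y, ∏ i, ((y i : ℝ)) ^ n i ∂μ = ∫ y, ∏ i, ((y i : ℝ)) ^ n i ∂ν) :
    μ = ν := by
  classical
  let E := ι → Set.Icc (-1 : ℝ) 1
  let co : ι → BoundedContinuousFunction E ℝ := fun i =>
    BoundedContinuousFunction.mkOfCompact ⟨fun y => (y i : ℝ), by fun_prop⟩
  let A : StarSubalgebra ℝ (BoundedContinuousFunction E ℝ) :=
    { Algebra.adjoin ℝ (Set.range co) with
      star_mem' := by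
        intro a ha
        have : star a = a := by ext; simp
        rw [this]; exact ha }
  have hcoA : ∀ i, co i ∈ A := fun i => Algebra.subset_adjoin (Set.mem_range_self i)
  refine ext_of_forall_mem_subalgebra_integral_eq_of_polish (𝕜 := ℝ) (A := A) ?_ ?_
  · intro x y hxy
    obtain ⟨i, hi⟩ := Function.ne_iff.1 hxy
    refine ⟨fun z => (z i : ℝ), ⟨BoundedContinuousFunction.toContinuousMapStarₐ ℝ (co i),
      ⟨co i, hcoA i, rfl⟩, rfl⟩, fun h => hi (Subtype.ext h)⟩
  · intro g hg
    have hg' : g ∈ Subalgebra.toSubmodule (Algebra.adjoin ℝ (Set.range co)) := hg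
    -- The algebra generated by the coordinates is the linear span of the monomials, so linearity of
    -- the integral reduces everything to mixed moments.
    rw [Algebra.adjoin_eq_span] at hg'
    clear hg
    have hint : ∀ (f : BoundedContinuousFunction E ℝ) (ρ : Measure E) [IsFiniteMeasure ρ],
        Integrable f ρ := fun f ρ _ => f.integrable ρ
    have hmon : ∀ f ∈ Submonoid.closure (Set.range co),
        ∃ n : ι → ℕ, ∀ y, f y = ∏ i, ((y i : ℝ)) ^ n i := by
      intro f hf
      induction hf using Submonoid.closure_induction with
      | mem f hf =>
        obtain ⟨i, rfl⟩ := hf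
        refine ⟨Pi.single i 1, fun y => ?_⟩
        rw [Finset.prod_eq_single i]
        · simp [co]
        · intro j _ hj; simp [Pi.single_eq_of_ne hj]
        · simp
      | one => exact ⟨0, by simp⟩
      | mul f g _ _ hf hg =>
        obtain ⟨n, hn⟩ := hf
        obtain ⟨k, hk⟩ := hg
        refine ⟨n + k, fun y => ?_⟩
        simp [hn, hk, pow_add, Finset.prod_mul_distrib]
    induction hg' using Submodule.span_induction with
    | mem f hf =>
      obtain ⟨n, hn⟩ := hmon f hf
      simp only [hn]
      exact h n
    | zero => simp
    | add f g _ _ hf hg =>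
      have e : ∀ y, (f + g : BoundedContinuousFunction E ℝ) y = f y + g y := fun y => rfl
      simp only [e]
      rw [integral_add (hint f μ) (hint g μ), integral_add (hint f ν) (hint g ν), hf, hg]
    | smul a f _ hf =>
      have e : ∀ y, (a • f : BoundedContinuousFunction E ℝ) y = a * f y := fun y => rfl
      simp only [e]
      rw [integral_const_mul, integral_const_mul, hf]

/-- A multiplicative system of bounded functions that generates the σ-algebra determines finite
measures. -/
theorem measure_ext_of_submonoid {Ω : Type*} [mΩ : MeasurableSpace Ω] {μ ν : Measure Ω}
    [IsFiniteMeasure μ] [IsFiniteMeasure ν] (S : Submonoid (Ω → ℝ))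
    (hm : ∀ φ ∈ S, Measurable φ) (hb : ∀ φ ∈ S, ∀ ω, |φ ω| ≤ 1)
    (hgen : mΩ ≤ ⨆ φ : S, MeasurableSpace.comap φ.1 inferInstance)
    (h : ∀ φ ∈ S, ∫ ω, φ ω ∂μ = ∫ ω, φ ω ∂ν) : μ = ν := by
  classical
  have hgen' : mΩ = ⨆ φ : S, MeasurableSpace.comap φ.1 inferInstance :=
    le_antisymm hgen (iSup_le fun φ => (hm φ.1 φ.2).comap_le)
  let m' : S → MeasurableSpace Ω := fun φ => MeasurableSpace.comap φ.1 inferInstance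
  have hpi := isPiSystem_piiUnionInter (fun φ : S => {s | MeasurableSet[m' φ] s})
    (fun φ => @MeasurableSpace.isPiSystem_measurableSet _ (m' φ)) Set.univ
  have hgen2 : mΩ = MeasurableSpace.generateFrom
      (piiUnionInter (fun φ : S => {s | MeasurableSet[m' φ] s}) Set.univ) := by
    refine Eq.trans ?_ (generateFrom_piiUnionInter_measurableSet m' Set.univ).symm
    simpa [m'] using hgen'
  have huniv : μ Set.univ = ν Set.univ := by
    have := h 1 S.one_mem
    simp only [Pi.one_apply, integral_const, smul_eq_mul, mul_one] at this
    exact (measureReal_eq_measureReal_iff).1 this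
  refine ext_of_generate_finite _ hgen2 hpi ?_ huniv
  rintro s ⟨t, -, f, hf, rfl⟩
  let Φ : Ω → (t → Set.Icc (-1 : ℝ) 1) := fun ω φ => ⟨φ.1.1 ω, abs_le.1 (hb _ φ.1.2 ω)⟩
  have hΦ : Measurable Φ := by
    refine measurable_pi_lambda _ fun φ => (hm _ φ.1.2).subtype_mk
  -- The mixed moments of finitely many members of `S` are integrals of products of members, hence
  -- of members of `S`; so all finite-dimensional laws agree.
  have key : μ.map Φ = ν.map Φ := by
    refine measure_cube_ext fun n => ?_
    have hc : Continuous fun y : t → Set.Icc (-1 : ℝ) 1 => ∏ i, ((y i : ℝ)) ^ n i := by fun_prop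
    rw [integral_map hΦ.aemeasurable hc.aestronglyMeasurable,
      integral_map hΦ.aemeasurable hc.aestronglyMeasurable]
    have := h (∏ φ : t, φ.1.1 ^ n φ) (S.prod_mem fun φ _ => S.pow_mem φ.1.2 _)
    simpa [Φ] using this
  have : ∀ φ : t, ∃ B : Set ℝ, MeasurableSet B ∧ φ.1.1 ⁻¹' B = f φ.1 := fun φ => hf _ φ.2
  choose B hB hB' using this
  have hset : (⋂ φ ∈ t, f φ) = Φ ⁻¹' (Set.univ.pi fun φ => Subtype.val ⁻¹' B φ) := by
    ext ω
    simp only [Set.mem_iInter, Set.mem_preimage, Set.mem_univ_pi, Φ]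
    constructor
    · intro H φ
      have := H φ.1 φ.2
      rw [← hB' φ] at this
      exact this
    · intro H φ hφ
      have := H ⟨φ, hφ⟩
      rw [← hB' ⟨φ, hφ⟩]
      exact this
  have hmeas : MeasurableSet (Set.univ.pi fun φ : t => (Subtype.val ⁻¹' B φ : Set (Set.Icc (-1 : ℝ) 1))) :=
    MeasurableSet.univ_pi fun φ => measurable_subtype_coe (hB φ)
  rw [hset, ← Measure.map_apply hΦ hmeas, ← Measure.map_apply hΦ hmeas, key]

instance measurableSingletonClass_of_separated {X : Type*} [MeasurableSpace X]
    [MeasurableSpace.CountablySeparated X] : MeasurableSingletonClass X :=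
  MeasurableSpace.measurableSingletonClass_of_countablySeparated

/-! ### Nested finite partitions that shrink to points -/

section Cells

variable {X : Type*} [MeasurableSpace X] [MeasurableSpace.CountablySeparated X]

variable (X) in
/-- A measurable injection into the Cantor space. -/
noncomputable def code : X → ℕ → Bool :=
  (MeasurableSpace.measurable_injection_nat_bool_of_countablySeparated X).choose

lemma measurable_code : Measurable (code X) :=
  (MeasurableSpace.measurable_injection_nat_bool_of_countablySeparated X).choose_spec.1

lemma code_injective : Function.Injective (code X) :=
  (MeasurableSpace.measurable_injection_nat_bool_of_countablySeparated X).choose_spec.2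

/-- The finite measurable partitions given by a label and the first `n` digits of the code. -/
noncomputable def cellMap {κ : Type*} (l : X → κ) (n : ℕ) (x : X) : κ × (Fin n → Bool) :=
  (l x, fun i => code X x i)

variable {κ : Type*}

/-- The cell of the `n`-th partition that contains `x`. -/
def cell (l : X → κ) (n : ℕ) (x : X) : Set X := cellMap l n ⁻¹' {cellMap l n x}

lemma mem_cell (l : X → κ) (n : ℕ) (x y : X) :
    y ∈ cell l n x ↔ l y = l x ∧ ∀ i < n, code X y i = code X x i := by
  simp only [cell, cellMap, Set.mem_preimage, Set.mem_singleton_iff, Prod.mk.injEq, funext_iff]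
  exact and_congr_right fun _ => ⟨fun h i hi => h ⟨i, hi⟩, fun h i => h i i.2⟩

lemma antitone_cell (l : X → κ) (x : X) : Antitone fun n => cell l n x := by
  intro n k hnk y hy
  rw [mem_cell] at hy ⊢
  exact ⟨hy.1, fun i hi => hy.2 i (hi.trans_le hnk)⟩

lemma iInter_cell (l : X → κ) (x : X) : ⋂ n, cell l n x = {x} := by
  ext y
  simp only [Set.mem_iInter, mem_cell, Set.mem_singleton_iff]
  constructor
  · intro h
    exact code_injective (funext fun i => (h (i + 1)).2 i (Nat.lt_succ_self i))
  · rintro rfl n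
    exact ⟨rfl, fun _ _ => rfl⟩

variable [MeasurableSpace κ]

lemma measurable_cellMap {l : X → κ} (hl : Measurable l) (n : ℕ) : Measurable (cellMap l n) :=
  hl.prodMk (measurable_pi_lambda _ fun _ => (measurable_pi_apply _).comp measurable_code)

variable [MeasurableSingletonClass κ]

lemma measurableSet_cell {l : X → κ} (hl : Measurable l) (n : ℕ) (x : X) :
    MeasurableSet (cell l n x) :=
  measurable_cellMap hl n (measurableSet_singleton _)

lemma tendsto_measure_cell {l : X → κ} (hl : Measurable l) (μ : Measure X) [IsFiniteMeasure μ]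
    (x : X) : Tendsto (fun n => μ (cell l n x)) atTop (𝓝 (μ {x})) := by
  rw [← iInter_cell l x]
  exact tendsto_measure_iInter_atTop
    (fun n => (measurableSet_cell hl n x).nullMeasurableSet) (antitone_cell l x)
    ⟨0, measure_ne_top _ _⟩

variable [Finite κ]

lemma measurable_measure_cell {l : X → κ} (hl : Measurable l) (μ : Measure X) (n : ℕ) :
    Measurable fun x => μ (cell l n x) :=
  (measurable_of_finite fun j => μ (cellMap l n ⁻¹' {j})).comp (measurable_cellMap hl n)

/-- The masses of the cells around `x` take finitely many values at each stage and decrease to the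
mass of `x`, so the limit is measurable in `x`. A trivial label is enough. -/
lemma measurable_measure_singleton (μ : Measure X) [IsFiniteMeasure μ] :
    Measurable fun x => μ {x} := by
  have hl : Measurable fun _ : X => () := measurable_const
  refine measurable_of_tendsto_metrizable (fun n => measurable_measure_cell hl μ n) ?_
  exact tendsto_pi_nhds.2 fun x => tendsto_measure_cell hl μ x

end Cells

/-! ### Atoms and sums of squares of elements of the cone -/

section ConeBasics

variable {X : Type*} [MeasurableSpace X]

lemma lintegral_comp_finite {κ : Type*} [Fintype κ] [MeasurableSpace κ]
    [MeasurableSingletonClass κ] {p : X → κ} (hp : Measurable p) (μ : Measure X) (g : κ → ℝ≥0∞) :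
    ∫⁻ x, g (p x) ∂μ = ∑ j, g j * μ (p ⁻¹' {j}) := by
  rw [← lintegral_map (measurable_of_finite g) hp, lintegral_fintype]
  simp [Measure.map_apply hp]

lemma integrable_of_bounded {μ : Measure X} [IsFiniteMeasure μ] {E : Type*}
    [NormedAddCommGroup E] [MeasurableSpace E] [BorelSpace E] [SecondCountableTopology E]
    {w : X → E} (hw : Measurable w) {C : ℝ}
    (hC : ∀ x, ‖w x‖ ≤ C) : Integrable w μ :=
  Integrable.of_bound hw.aestronglyMeasurable C (ae_of_all _ hC)

lemma integral_comp_finite {κ : Type*} [Fintype κ] [MeasurableSpace κ]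
    [MeasurableSingletonClass κ] {E : Type*} [NormedAddCommGroup E] [NormedSpace ℝ E] [CompleteSpace E]
    {p : X → κ} (hp : Measurable p) (μ : Measure X) [IsFiniteMeasure μ] (g : κ → E) :
    ∫ x, g (p x) ∂μ = ∑ j, μ.real (p ⁻¹' {j}) • g j := by
  rw [← integral_map hp.aemeasurable
    (StronglyMeasurable.of_discrete (f := g)).aestronglyMeasurable, integral_fintype]
  · simp [measureReal_def, Measure.map_apply hp]
  · exact Integrable.of_finite

instance (ξ : Cone X) : IsFiniteMeasure ξ.1 := by
  obtain ⟨ξ, r, x, hr, hs, rfl⟩ := ξ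
  refine ⟨?_⟩
  rw [Measure.sum_apply _ MeasurableSet.univ]
  simp only [Measure.smul_apply, measure_univ, smul_eq_mul, mul_one]
  exact hs.tsum_ofReal_lt_top

lemma measurable_cone_apply {A : Set X} (hA : MeasurableSet A) :
    Measurable fun ξ : Cone X => ξ.1 A :=
  (Measure.measurable_coe hA).comp measurable_subtype_coe

/-- To be measurable on the cone, it is enough to measure all evaluations. -/
lemma cone_measurableSpace_le (m' : MeasurableSpace (Cone X))
    (h : ∀ A : Set X, MeasurableSet A → Measurable[m'] fun ξ : Cone X => ξ.1 A) :
    instMeasurableSpaceCone ≤ m' := by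
  have : Measurable[m'] (Subtype.val : Cone X → Measure X) :=
    @Measure.measurable_of_measurable_coe _ _ _ m' _ h
  exact this.comap_le

variable [MeasurableSpace.CountablySeparated X]

lemma exists_countable_support (ξ : Cone X) : ∃ S : Set X, S.Countable ∧ ξ.1 Sᶜ = 0 := by
  obtain ⟨ξ, r, x, hr, hs, rfl⟩ := ξ
  refine ⟨Set.range x, Set.countable_range x, ?_⟩
  have hS := (Set.countable_range x).measurableSet
  rw [Measure.sum_apply _ hS.compl, ENNReal.tsum_eq_zero]
  intro k
  simp [Measure.dirac_apply' _ hS.compl]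

lemma ae_singleton_ne_zero (ξ : Cone X) : ∀ᵐ x ∂ξ.1, ξ.1 {x} ≠ 0 := by
  obtain ⟨S, hS, hS0⟩ := exists_countable_support ξ
  rw [ae_iff]
  have h2 : ξ.1 (⋃ x ∈ S ∩ {x | ξ.1 {x} = 0}, {x}) = 0 :=
    (measure_biUnion_null_iff (hS.mono Set.inter_subset_left)).2 fun x hx => hx.2
  refine measure_mono_null ?_ (measure_union_null hS0 h2)
  intro x hx
  by_cases hxS : x ∈ S
  · right
    simp only [not_not, Set.mem_ofPred_eq] at hx
    simp [hxS, hx]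
  · exact Or.inl hxS

/-- The measure `∑ₖ rₖ² δ_{xₖ}` attached to `ξ = ∑ₖ rₖ δ_{xₖ}`. -/
noncomputable def sqMeasure (ξ : Cone X) : Measure X := ξ.1.withDensity fun x => ξ.1 {x}

instance (ξ : Cone X) : IsFiniteMeasure (sqMeasure ξ) := by
  refine isFiniteMeasure_withDensity (ne_of_lt ?_)
  calc ∫⁻ x, ξ.1 {x} ∂ξ.1 ≤ ∫⁻ _, ξ.1 Set.univ ∂ξ.1 :=
        lintegral_mono fun x => measure_mono (Set.subset_univ _)
    _ < ⊤ := by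
      rw [lintegral_const]
      exact ENNReal.mul_lt_top (measure_lt_top _ _) (measure_lt_top _ _)

lemma sqMeasure_singleton (ξ : Cone X) (x : X) : sqMeasure ξ {x} = ξ.1 {x} * ξ.1 {x} := by
  rw [sqMeasure, withDensity_apply _ (measurableSet_singleton x), lintegral_singleton]

/-- The sum is `∫_A ξ(cell n x) dξ(x)`, and the cell masses decrease to the atom masses. This
exhibits the sum of squares as a limit of polynomials in evaluations, hence as a measurable function
of `ξ`. -/
lemma tendsto_sqMeasure (ξ : Cone X) {A : Set X} (hA : MeasurableSet A) :
    Tendsto (fun n => ∑ j, ξ.1 (cellMap (fun _ : X => ()) n ⁻¹' {j}) *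
      ξ.1 (cellMap (fun _ : X => ()) n ⁻¹' {j} ∩ A)) atTop (𝓝 (sqMeasure ξ A)) := by
  have hl : Measurable fun _ : X => () := measurable_const
  rw [sqMeasure, withDensity_apply _ hA]
  have h := tendsto_lintegral_of_dominated_convergence (μ := ξ.1.restrict A)
    (F := fun n x => ξ.1 (cell (fun _ : X => ()) n x)) (f := fun x => ξ.1 {x})
    (fun _ => ξ.1 Set.univ) (fun n => measurable_measure_cell hl _ n)
    (fun n => ae_of_all _ fun x => measure_mono (Set.subset_univ _))
    (by
      rw [lintegral_const]
      exact (ENNReal.mul_lt_top (measure_lt_top _ _) (measure_lt_top _ _)).ne)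
    (ae_of_all _ fun x => tendsto_measure_cell hl ξ.1 x)
  refine h.congr fun n => ?_
  unfold cell
  rw [lintegral_comp_finite (measurable_cellMap hl n) _
    fun j => ξ.1 (cellMap (fun _ : X => ()) n ⁻¹' {j})]
  refine Finset.sum_congr rfl fun j _ => ?_
  rw [Measure.restrict_apply (measurable_cellMap hl n (measurableSet_singleton j))]

lemma measurable_sqMeasure : Measurable (sqMeasure : Cone X → Measure X) := by
  have hl : Measurable fun _ : X => () := measurable_const
  refine Measure.measurable_of_measurable_coe _ fun A hA => ?_
  refine measurable_of_tendsto_metrizable (fun n => ?_)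
    (tendsto_pi_nhds.2 fun ξ => tendsto_sqMeasure ξ hA)
  refine Finset.measurable_sum _ fun j _ => ?_
  have hj := measurable_cellMap hl n (measurableSet_singleton j)
  exact (measurable_cone_apply hj).mul (measurable_cone_apply (hj.inter hA))

/-- An atom of mass `r` is recovered as `(r²) ^ (-1/2) * r²`. Replacing the atom by its cell gives
an approximation that uses only values of `sqMeasure`; the negative exponent makes it increase as
the cells shrink, so monotone convergence applies. -/
lemma tendsto_of_sqMeasure (ξ : Cone X) {A : Set X} (hA : MeasurableSet A) :
    Tendsto (fun n => ∑ j, (sqMeasure ξ (cellMap (fun _ : X => ()) n ⁻¹' {j})) ^ (-(1 / 2) : ℝ) *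
      sqMeasure ξ (cellMap (fun _ : X => ()) n ⁻¹' {j} ∩ A)) atTop (𝓝 (ξ.1 A)) := by
  have hl : Measurable fun _ : X => () := measurable_const
  have hlim : ξ.1 A = ∫⁻ x in A, (sqMeasure ξ {x}) ^ (-(1 / 2) : ℝ) ∂(sqMeasure ξ) := by
    have hms := measurable_measure_singleton (sqMeasure ξ)
    have hms' := measurable_measure_singleton ξ.1
    rw [show (sqMeasure ξ).restrict A = (ξ.1.restrict A).withDensity (fun x => ξ.1 {x}) from
      restrict_withDensity hA _, lintegral_withDensity_eq_lintegral_mul _ hms'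
      (hms.pow_const _), ← setLIntegral_one]
    refine lintegral_congr_ae (ae_restrict_of_ae ?_)
    filter_upwards [ae_singleton_ne_zero ξ] with x hx
    have hx' : ξ.1 {x} ≠ ⊤ := measure_ne_top _ _
    simp only [Pi.mul_apply]
    rw [sqMeasure_singleton, ← sq, ← ENNReal.rpow_natCast, ← ENNReal.rpow_mul]
    norm_num
    rw [ENNReal.rpow_neg_one, ENNReal.mul_inv_cancel hx hx']
  rw [hlim]
  have h := lintegral_tendsto_of_tendsto_of_monotone (μ := (sqMeasure ξ).restrict A)
    (f := fun n x => (sqMeasure ξ (cell (fun _ : X => ()) n x)) ^ (-(1 / 2) : ℝ))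
    (F := fun x => (sqMeasure ξ {x}) ^ (-(1 / 2) : ℝ))
    (fun n => ((measurable_measure_cell hl _ n).pow_const _).aemeasurable)
    (ae_of_all _ fun x n k hnk => by
      have := measure_mono (μ := sqMeasure ξ) (antitone_cell (fun _ : X => ()) x hnk)
      simp only [ENNReal.rpow_neg]
      exact ENNReal.inv_le_inv.2 (ENNReal.rpow_le_rpow this (by norm_num)))
    (ae_of_all _ fun x => (ENNReal.continuous_rpow_const.tendsto _).comp
      (tendsto_measure_cell hl (sqMeasure ξ) x))
  refine h.congr fun n => ?_
  unfold cell
  rw [lintegral_comp_finite (measurable_cellMap hl n) _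
    fun j => (sqMeasure ξ (cellMap (fun _ : X => ()) n ⁻¹' {j})) ^ (-(1 / 2) : ℝ)]
  refine Finset.sum_congr rfl fun j _ => ?_
  rw [Measure.restrict_apply (measurable_cellMap hl n (measurableSet_singleton j))]

/-- The σ-algebra of the cone is generated by the functions `ξ ↦ ∑_{xₖ ∈ A} rₖ²`. -/
lemma cone_measurableSpace_le_of_sq (m' : MeasurableSpace (Cone X))
    (h : ∀ A : Set X, MeasurableSet A → Measurable[m'] fun ξ : Cone X => sqMeasure ξ A) :
    instMeasurableSpaceCone ≤ m' := by
  have hl : Measurable fun _ : X => () := measurable_const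
  refine cone_measurableSpace_le m' fun A hA => ?_
  refine measurable_of_tendsto_metrizable (fun n => ?_)
    (tendsto_pi_nhds.2 fun ξ => tendsto_of_sqMeasure ξ hA)
  refine Finset.measurable_sum _ fun j _ => ?_
  have hj := measurable_cellMap hl n (measurableSet_singleton j)
  exact ((h _ hj).pow_const _).mul (h _ (hj.inter hA))

/-- Only countably many points carry mass, so the sum over all of `X` is an integral over a
countable set. In this form the usual convergence theorems become available for `sumSq`. -/
lemma sumSq_eq_integral (ξ : Cone X) {w : X → ℂ} (hw : Measurable w) {C : ℝ}
    (hC : ∀ x, ‖w x‖ ≤ C) : sumSq ξ w = ∫ x, w x ∂(sqMeasure ξ) := by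
  obtain ⟨S, hS, hS0⟩ := exists_countable_support ξ
  have hms := measurable_measure_singleton ξ.1
  rw [sqMeasure, integral_withDensity_eq_integral_toReal_smul hms
    (ae_of_all _ fun x => measure_lt_top _ _)]
  have hint : Integrable (fun x => (ξ.1 {x}).toReal • w x) ξ.1 := by
    refine integrable_of_bounded (hms.ennreal_toReal.smul hw) (C := ξ.1.real Set.univ * C)
      fun x => ?_
    rw [norm_smul, Real.norm_of_nonneg ENNReal.toReal_nonneg]
    exact mul_le_mul (measureReal_mono (Set.subset_univ _)) (hC x) (norm_nonneg _)
      measureReal_nonneg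
  have h1 : ∫ x, (ξ.1 {x}).toReal • w x ∂ξ.1 = ∫ x in S, (ξ.1 {x}).toReal • w x ∂ξ.1 := by
    rw [Measure.restrict_eq_self_of_ae_mem]
    rw [ae_iff]; exact hS0
  rw [h1, setIntegral_countable _ hS hint.integrableOn, sumSq]
  have h2 : ∀ x ∉ S, ξ.1.real {x} = 0 := by
    intro x hx
    rw [measureReal_def, measure_mono_null (Set.singleton_subset_iff.2 hx) hS0]
    simp
  rw [← tsum_subtype_eq_of_support_subset (s := S)]
  · refine tsum_congr fun x => ?_
    rw [measureReal_def]
    simp only [Complex.real_smul]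
    push_cast
    ring
  · intro x hx
    by_contra hxS
    simp [h2 x hxS] at hx

lemma measurable_integral_sq_real {w : X → ℝ} (hw : Measurable w) {C : ℝ} (hC : ∀ x, ‖w x‖ ≤ C) :
    Measurable fun ξ : Cone X => ∫ x, w x ∂(sqMeasure ξ) := by
  have : (fun ξ : Cone X => ∫ x, w x ∂(sqMeasure ξ)) = fun ξ =>
      (∫⁻ x, ENNReal.ofReal (w x) ∂(sqMeasure ξ)).toReal -
        (∫⁻ x, ENNReal.ofReal (-w x) ∂(sqMeasure ξ)).toReal := by
    funext ξ
    exact integral_eq_lintegral_pos_part_sub_lintegral_neg_part (integrable_of_bounded hw hC)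
  rw [this]
  exact ((Measure.measurable_lintegral hw.ennreal_ofReal).comp
    measurable_sqMeasure).ennreal_toReal.sub ((Measure.measurable_lintegral
    hw.neg.ennreal_ofReal).comp measurable_sqMeasure).ennreal_toReal

lemma sumSq_re (ξ : Cone X) {w : X → ℂ} (hw : Measurable w) {C : ℝ}
    (hC : ∀ x, ‖w x‖ ≤ C) : (sumSq ξ w).re = ∫ x, (w x).re ∂(sqMeasure ξ) := by
  rw [sumSq_eq_integral ξ hw hC]
  exact (integral_re (integrable_of_bounded hw hC)).symm

lemma sumSq_im (ξ : Cone X) {w : X → ℂ} (hw : Measurable w) {C : ℝ}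
    (hC : ∀ x, ‖w x‖ ≤ C) : (sumSq ξ w).im = ∫ x, (w x).im ∂(sqMeasure ξ) := by
  rw [sumSq_eq_integral ξ hw hC]
  exact (integral_im (integrable_of_bounded hw hC)).symm

lemma measurable_sumSq {w : X → ℂ} (hw : Measurable w) {C : ℝ}
    (hC : ∀ x, ‖w x‖ ≤ C) : Measurable fun ξ : Cone X => sumSq ξ w := by
  have : (fun ξ : Cone X => sumSq ξ w) = fun ξ => ((∫ x, (w x).re ∂(sqMeasure ξ) : ℝ) : ℂ) +
      ((∫ x, (w x).im ∂(sqMeasure ξ) : ℝ) : ℂ) * Complex.I := by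
    funext ξ
    rw [← sumSq_re ξ hw hC, ← sumSq_im ξ hw hC, Complex.re_add_im]
  rw [this]
  have h1 := measurable_integral_sq_real (X := X) (Complex.measurable_re.comp hw) (C := C)
    fun x => (Complex.abs_re_le_norm _).trans (hC x)
  have h2 := measurable_integral_sq_real (X := X) (Complex.measurable_im.comp hw) (C := C)
    fun x => (Complex.abs_im_le_norm _).trans (hC x)
  exact (Complex.measurable_ofReal.comp h1).add
    ((Complex.measurable_ofReal.comp h2).mul measurable_const)

/-! ### Sums of squares over the cells of labelled partitions -/

section Labelled

variable {κ : Type*} [Fintype κ] [MeasurableSpace κ] [MeasurableSingletonClass κ]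

/-- The sum of squares of the masses of the cells of `ξ`, weighted by a function of the label. -/
noncomputable def cellSum (l : X → κ) (c : κ → ℂ) (n : ℕ) (ξ : Cone X) : ℂ :=
  ∑ j, ((ξ.1.real (cellMap l n ⁻¹' {j}) ^ 2 : ℝ) : ℂ) * c j.1

lemma cellSum_eq_integral {l : X → κ} (hl : Measurable l) (c : κ → ℂ) (n : ℕ) (ξ : Cone X) :
    cellSum l c n ξ = ∫ x, (ξ.1.real (cell l n x) : ℂ) * c (l x) ∂ξ.1 := by
  have := integral_comp_finite (measurable_cellMap hl n) ξ.1
    (fun j => (ξ.1.real (cellMap l n ⁻¹' {j}) : ℂ) * c j.1)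
  unfold cell
  refine Eq.trans ?_ this.symm
  refine Finset.sum_congr rfl fun j _ => ?_
  simp only [Complex.real_smul]
  push_cast
  ring

/-- Since the label is constant on each cell, `cellSum` integrates `ξ(cell n x) c(l x)` against `ξ`;
dominated convergence replaces the cell by the atom. -/
lemma tendsto_cellSum {l : X → κ} (hl : Measurable l) (c : κ → ℂ) (ξ : Cone X) :
    Tendsto (fun n => cellSum l c n ξ) atTop (𝓝 (sumSq ξ fun x => c (l x))) := by
  have hc : Measurable fun x => c (l x) := (measurable_of_finite c).comp hl
  have hC : ∀ x, ‖c (l x)‖ ≤ ∑ k, ‖c k‖ := fun x =>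
    Finset.single_le_sum (f := fun k => ‖c k‖) (fun k _ => norm_nonneg _) (Finset.mem_univ (l x))
  have hms := measurable_measure_singleton ξ.1
  rw [sumSq_eq_integral ξ hc hC, sqMeasure, integral_withDensity_eq_integral_toReal_smul hms
    (ae_of_all _ fun x => measure_lt_top _ _)]
  simp only [cellSum_eq_integral hl, Complex.real_smul]
  refine tendsto_integral_of_dominated_convergence
    (fun _ => ξ.1.real Set.univ * ∑ k, ‖c k‖) (fun n => ?_) (integrable_const _)
    (fun n => ae_of_all _ fun x => ?_) (ae_of_all _ fun x => ?_)
  · exact ((Complex.measurable_ofReal.comp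
      (measurable_measure_cell hl _ n).ennreal_toReal).mul hc).aestronglyMeasurable
  · rw [norm_mul, Complex.norm_real, Real.norm_of_nonneg measureReal_nonneg]
    exact mul_le_mul (measureReal_mono (Set.subset_univ _)) (hC x) (norm_nonneg _)
      measureReal_nonneg
  · refine Tendsto.mul_const _ ((Complex.continuous_ofReal.tendsto _).comp ?_)
    exact (ENNReal.tendsto_toReal (measure_ne_top _ _)).comp (tendsto_measure_cell hl ξ.1 x)

/-- Splitting a cell lowers the sum of squares. Hence every stage lies above the limit, which is
what provides a dominating function independent of `n`. -/
lemma cellSum_one_antitone {l : X → κ} (hl : Measurable l) (ξ : Cone X) :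
    Antitone fun n => (cellSum l (fun _ => 1) n ξ).re := by
  have h : ∀ n, (cellSum l (fun _ => 1) n ξ).re = ∫ x, ξ.1.real (cell l n x) ∂ξ.1 := by
    intro n
    rw [cellSum_eq_integral hl]
    simp only [mul_one]
    rw [integral_complex_ofReal, Complex.ofReal_re]
  intro n k hnk
  simp only [h]
  have hint : ∀ n, Integrable (fun x => ξ.1.real (cell l n x)) ξ.1 := fun n =>
    integrable_of_bounded (measurable_measure_cell hl _ n).ennreal_toReal
      (C := ξ.1.real Set.univ) fun x => by
        rw [Real.norm_of_nonneg measureReal_nonneg]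
        exact measureReal_mono (Set.subset_univ _)
  exact integral_mono (hint _) (hint _) fun x => measureReal_mono (antitone_cell l x hnk)

end Labelled

end ConeBasics

/-! ### One-dimensional Gamma integrals -/

/-- The Gamma law of shape `t` and rate one on the half-line, a point mass at zero for `t = 0`. -/
noncomputable def gammaLaw (t : ℝ) : Measure ℝ≥0 :=
  if t = 0 then Measure.dirac 0 else (ProbabilityTheory.gammaMeasure t 1).map Real.toNNReal

lemma isProbabilityMeasure_gammaLaw {t : ℝ} (ht : 0 ≤ t) : IsProbabilityMeasure (gammaLaw t) := by
  unfold gammaLaw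
  split_ifs with h
  · infer_instance
  · have := ProbabilityTheory.isProbabilityMeasure_gammaMeasure
      (lt_of_le_of_ne ht (Ne.symm h)) one_pos
    exact Measure.isProbabilityMeasure_map measurable_real_toNNReal.aemeasurable

lemma integral_gammaLaw {t : ℝ} (ht : 0 < t) {h : ℝ≥0 → ℝ} (hh : Measurable h) :
    ∫ r, h r ∂(gammaLaw t) =
      ∫ x in Set.Ioi (0 : ℝ), (x ^ (t - 1) * Real.exp (-x) / Real.Gamma t) * h x.toNNReal := by
  rw [gammaLaw, if_neg ht.ne', integral_map measurable_real_toNNReal.aemeasurable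
    hh.aestronglyMeasurable, ProbabilityTheory.gammaMeasure,
    integral_withDensity_eq_integral_toReal_smul (f := ProbabilityTheory.gammaPDF t 1)
      (ProbabilityTheory.measurable_gammaPDFReal t 1).ennreal_ofReal
      (ae_of_all _ fun x => ENNReal.ofReal_lt_top),
    ← integral_Ici_eq_integral_Ioi, ← setIntegral_eq_integral_of_forall_compl_eq_zero
      (s := Set.Ici (0 : ℝ))]
  · refine setIntegral_congr_fun measurableSet_Ici fun x (hx : 0 ≤ x) => ?_
    have hpos : 0 ≤ x ^ (t - 1) * Real.exp (-x) / Real.Gamma t := by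
      have := Real.Gamma_pos_of_pos ht
      positivity
    have : ProbabilityTheory.gammaPDFReal t 1 x = x ^ (t - 1) * Real.exp (-x) / Real.Gamma t := by
      rw [ProbabilityTheory.gammaPDFReal, if_pos hx, Real.one_rpow, one_mul]
      ring
    simp only [ProbabilityTheory.gammaPDF, this, smul_eq_mul]
    rw [ENNReal.toReal_ofReal hpos]
  · intro x hx
    rw [ProbabilityTheory.gammaPDF_of_neg (by simpa using hx)]
    simp

lemma integral_exp_neg_gammaLaw {t : ℝ} (ht : 0 ≤ t) (b : ℝ≥0) :
    ∫ r, Real.exp (-(b * r : ℝ)) ∂(gammaLaw t) = Real.exp (-(t * Real.log (1 + b))) := by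
  have hb : 0 < 1 + (b : ℝ) := by positivity
  rcases ht.eq_or_lt with rfl | ht
  · simp [gammaLaw]
  · rw [integral_gammaLaw ht (by fun_prop)]
    have hΓ := Real.Gamma_pos_of_pos ht
    have e : ∀ x ∈ Set.Ioi (0 : ℝ), (x ^ (t - 1) * Real.exp (-x) / Real.Gamma t) *
        Real.exp (-(b * x.toNNReal : ℝ)) =
        (Real.Gamma t)⁻¹ * (x ^ (t - 1) * Real.exp (-((1 + b) * x))) := by
      intro x (hx : 0 < x)
      rw [Real.coe_toNNReal _ hx.le, show -((1 + b : ℝ) * x) = -x + -(b * x) by ring, Real.exp_add]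
      ring
    rw [setIntegral_congr_fun measurableSet_Ioi e, integral_const_mul,
      Real.integral_rpow_mul_exp_neg_mul_Ioi ht hb, one_div, Real.inv_rpow hb.le,
      Real.rpow_def_of_pos hb, ← Real.exp_neg]
    field_simp

/-- The Laplace transform of the square of a Gamma variable, with the weight `exp r`. -/
noncomputable def gammaSq (t : ℝ) (w : ℂ) : ℂ :=
  ∫ r : ℝ≥0, Complex.exp ((r : ℝ) - w * ((r : ℝ) ^ 2 : ℝ)) ∂(gammaLaw t)

/-- The value of the weighted Laplace transform at `w = 1`. -/
noncomputable def gammaSqOne (t : ℝ) : ℝ :=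
  ∫ r : ℝ≥0, Real.exp ((r : ℝ) - (r : ℝ) ^ 2) ∂(gammaLaw t)

/-- Completing the square: `r - Re(w) r²` has its maximum `1 / (4 Re w)` at `r = 1 / (2 Re w)`. -/
lemma norm_exp_sub_sq_le {w : ℂ} (hw : 0 < w.re) (r : ℝ) :
    ‖Complex.exp (r - w * (r ^ 2 : ℝ))‖ ≤ Real.exp (1 / (4 * w.re)) := by
  rw [Complex.norm_exp]
  refine Real.exp_le_exp.2 ?_
  simp only [Complex.sub_re, Complex.ofReal_re, Complex.mul_re, Complex.ofReal_im, mul_zero,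
    sub_zero]
  rw [le_div_iff₀ (by positivity)]
  nlinarith [sq_nonneg (2 * w.re * r - 1)]

lemma integrable_exp_sub_sq {w : ℂ} (hw : 0 < w.re) (μ : Measure ℝ≥0) [IsFiniteMeasure μ] :
    Integrable (fun r : ℝ≥0 => Complex.exp ((r : ℝ) - w * ((r : ℝ) ^ 2 : ℝ))) μ :=
  integrable_of_bounded (by fun_prop) fun r => norm_exp_sub_sq_le hw r

lemma gammaSq_ofReal (t : ℝ) (w : ℝ) :
    gammaSq t w = ((∫ r : ℝ≥0, Real.exp ((r : ℝ) - w * (r : ℝ) ^ 2) ∂(gammaLaw t) : ℝ) : ℂ) := by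
  rw [gammaSq, ← integral_complex_ofReal]
  congr 1
  ext r
  push_cast
  rfl

/-- The weight `exp r` cancels the factor `exp (-r)` of the Gamma density, leaving `∫ x ^ (t-1) exp
(-w x²) dx`, which is homogeneous of degree `-t/2` in `w`. The dependence on `w` thus separates from
a constant that depends only on `t`. -/
lemma gammaSq_ofReal_eq {t w : ℝ} (ht : 0 < t) (hw : 0 < w) :
    ∫ r : ℝ≥0, Real.exp ((r : ℝ) - w * (r : ℝ) ^ 2) ∂(gammaLaw t) =
      gammaSqOne t * Real.exp (-(t / 2 * Real.log w)) := by
  have key : ∀ v : ℝ, 0 < v → ∫ r : ℝ≥0, Real.exp ((r : ℝ) - v * (r : ℝ) ^ 2) ∂(gammaLaw t) =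
      (Real.Gamma t)⁻¹ * (1 / 2 * Real.Gamma (t / 2)) * Real.exp (-(t / 2 * Real.log v)) := by
    intro v hv
    rw [integral_gammaLaw ht (by fun_prop)]
    have e : ∀ x ∈ Set.Ioi (0 : ℝ), (x ^ (t - 1) * Real.exp (-x) / Real.Gamma t) *
        Real.exp ((x.toNNReal : ℝ) - v * (x.toNNReal : ℝ) ^ 2) =
        (Real.Gamma t)⁻¹ * (x ^ (t - 1) * Real.exp (-v * x ^ (2 : ℝ))) := by
      intro x (hx : 0 < x)
      rw [Real.coe_toNNReal _ hx.le, Real.exp_sub, Real.rpow_two, neg_mul, Real.exp_neg,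
        Real.exp_neg]
      have := Real.exp_pos x
      field_simp
    rw [setIntegral_congr_fun measurableSet_Ioi e, integral_const_mul,
      integral_rpow_mul_exp_neg_mul_rpow two_pos (by linarith) hv, Real.rpow_def_of_pos hv]
    ring_nf
  have h1 := key 1 one_pos
  simp only [one_mul, Real.log_one, mul_zero, neg_zero, Real.exp_zero, mul_one] at h1
  rw [key w hw, gammaSqOne, h1]

/-- Both sides are analytic on the right half-plane, the left one as the complex moment generating
function of `-r²` under the weighted Gamma law. They agree at positive reals, so the identity
theorem extends the real formula. -/
lemma gammaSq_eq {t : ℝ} (ht : 0 ≤ t) {w : ℂ} (hw : 0 < w.re) :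
    gammaSq t w = gammaSqOne t * Complex.exp (-(t / 2 * Complex.log w)) := by
  rcases ht.eq_or_lt with rfl | ht
  · simp [gammaSq, gammaSqOne, gammaLaw]
  have := isProbabilityMeasure_gammaLaw ht.le
  let μ : Measure ℝ≥0 := (gammaLaw t).withDensity fun r => ENNReal.ofReal (Real.exp r)
  let Y : ℝ≥0 → ℝ := fun r => -(r : ℝ) ^ 2
  have hset : Set.Ioi 0 ⊆ ProbabilityTheory.integrableExpSet Y μ := by
    intro v hv
    change Integrable _ _
    rw [integrable_withDensity_iff_integrable_smul' (by fun_prop)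
      (ae_of_all _ fun _ => ENNReal.ofReal_lt_top)]
    have := (integrable_exp_sub_sq (w := v) (by simpa using hv) (gammaLaw t)).norm
    refine this.congr (ae_of_all _ fun r => ?_)
    simp only [Complex.norm_exp, Y, ENNReal.toReal_ofReal (Real.exp_pos _).le, smul_eq_mul,
      ← Real.exp_add]
    congr 1
    simp only [← Complex.ofReal_mul, ← Complex.ofReal_sub, Complex.ofReal_re]
    ring
  have hstrip : {z : ℂ | 0 < z.re} ⊆
      {z : ℂ | z.re ∈ interior (ProbabilityTheory.integrableExpSet Y μ)} :=
    fun z hz => interior_mono hset (by rwa [isOpen_Ioi.interior_eq])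
  have hmgf : ∀ z, ProbabilityTheory.complexMGF Y μ z = gammaSq t z := by
    intro z
    rw [ProbabilityTheory.complexMGF, integral_withDensity_eq_integral_toReal_smul (by fun_prop)
      (ae_of_all _ fun _ => ENNReal.ofReal_lt_top), gammaSq]
    congr 1
    ext r
    rw [ENNReal.toReal_ofReal (Real.exp_pos _).le, Complex.real_smul, Complex.ofReal_exp,
      ← Complex.exp_add]
    congr 1
    simp only [Y]
    push_cast
    ring
  have ha1 : AnalyticOnNhd ℂ (gammaSq t) {z : ℂ | 0 < z.re} := by
    have := (ProbabilityTheory.analyticOnNhd_complexMGF (X := Y) (μ := μ)).mono hstrip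
    rwa [show ProbabilityTheory.complexMGF Y μ = gammaSq t from funext hmgf] at this
  have hopen : IsOpen {z : ℂ | 0 < z.re} := isOpen_lt continuous_const Complex.continuous_re
  have ha2 : AnalyticOnNhd ℂ (fun w => gammaSqOne t * Complex.exp (-(t / 2 * Complex.log w)))
      {z : ℂ | 0 < z.re} := by
    refine DifferentiableOn.analyticOnNhd (fun z hz => ?_) hopen
    have hsl : z ∈ Complex.slitPlane := Or.inl hz
    exact (((((Complex.differentiableAt_log hsl).const_mul _).neg).cexp).const_mul _).differentiableWithinAt
  have hconv : IsPreconnected {z : ℂ | 0 < z.re} :=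
    (convex_halfSpace_re_gt 0).isPreconnected
  -- The identity theorem needs agreement at points different from 1 that accumulate at 1; `1 +
  -- 1/(n+1)` serves.
  have hlim : Tendsto (fun n : ℕ => (((1 : ℝ) + 1 / ((n : ℝ) + 1) : ℝ) : ℂ)) atTop (𝓝[≠] 1) := by
    refine tendsto_nhdsWithin_iff.2 ⟨?_, Eventually.of_forall fun n => ?_⟩
    · have h := (tendsto_const_nhds (x := (1 : ℝ))).add
        (tendsto_one_div_add_atTop_nhds_zero_nat (𝕜 := ℝ))
      rw [add_zero] at h
      have h' := (Complex.continuous_ofReal.tendsto 1).comp h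
      rwa [Complex.ofReal_one] at h'
    · have : (0 : ℝ) < 1 / ((n : ℝ) + 1) := by positivity
      intro h
      have := Complex.ofReal_eq_one.1 h
      linarith
  have hfreq : ∃ᶠ z in 𝓝[≠] (1 : ℂ),
      gammaSq t z = gammaSqOne t * Complex.exp (-(t / 2 * Complex.log z)) := by
    refine hlim.frequently (Frequently.of_forall fun n => ?_)
    have hn : (0 : ℝ) < 1 + 1 / ((n : ℝ) + 1) := by positivity
    rw [gammaSq_ofReal, gammaSq_ofReal_eq ht hn, ← Complex.ofReal_log hn.le]
    push_cast
    rfl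
  exact ha1.eqOn_of_preconnected_of_frequently_eq ha2 hconv (z₀ := 1) (by simp) hfreq hw

lemma gammaSqOne_nonneg (t : ℝ) : 0 ≤ gammaSqOne t :=
  integral_nonneg fun _ => (Real.exp_pos _).le

/-- The bound is chosen to equal 1 at `r = 0` and to have an explicit Gamma expectation. It follows
from `exp y ≤ 1/(1 - y)`, `exp (-r) ≤ 1/(1 + r)` and a cubic inequality. -/
lemma exp_sub_sq_le {r : ℝ} (hr : 0 ≤ r) :
    Real.exp (r - r ^ 2) ≤ 3 - 2 * Real.exp (-r) := by
  have h1 : 0 < 1 - (r - r ^ 2) := by nlinarith [sq_nonneg (r - 1 / 2)]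
  have h2 : Real.exp (r - r ^ 2) ≤ 1 / (1 - (r - r ^ 2)) := by
    rw [le_div_iff₀ h1]
    have := Real.add_one_le_exp (-(r - r ^ 2))
    have h3 : Real.exp (r - r ^ 2) * Real.exp (-(r - r ^ 2)) = 1 := by
      rw [← Real.exp_add]; simp
    nlinarith [Real.exp_pos (r - r ^ 2)]
  have h4 : Real.exp (-r) ≤ 1 / (1 + r) := by
    rw [Real.exp_neg, ← one_div]
    exact one_div_le_one_div_of_le (by linarith) (by linarith [Real.add_one_le_exp r])
  have h5 : 1 / (1 - (r - r ^ 2)) ≤ 3 - 2 * (1 / (1 + r)) := by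
    rw [div_le_iff₀ h1]
    have : 3 - 2 * (1 / (1 + r)) = (1 + 3 * r) / (1 + r) := by field_simp; ring
    rw [this, div_mul_eq_mul_div, le_div_iff₀ (by linarith)]
    nlinarith [sq_nonneg r, mul_nonneg hr (sq_nonneg (3 * r - 1))]
  linarith

/-- Taking expectations in `exp_sub_sq_le` gives `3 - 2 · 2^(-t) ≤ 1 + 2t`. An estimate of the form
`exp (O(t))` is needed so that products over all cells of a partition stay bounded. -/
lemma gammaSqOne_le {t : ℝ} (ht : 0 ≤ t) : gammaSqOne t ≤ Real.exp (2 * t) := by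
  have := isProbabilityMeasure_gammaLaw ht
  have hi1 : Integrable (fun r : ℝ≥0 => Real.exp (-(r : ℝ))) (gammaLaw t) :=
    integrable_of_bounded (by fun_prop) (C := 1) fun r => by
      rw [Real.norm_of_nonneg (Real.exp_pos _).le]
      exact Real.exp_le_one_iff.2 (by simp)
  have hi2 : Integrable (fun r : ℝ≥0 => Real.exp ((r : ℝ) - (r : ℝ) ^ 2)) (gammaLaw t) := by
    refine integrable_of_bounded (by fun_prop) (C := 3) fun r => ?_
    rw [Real.norm_of_nonneg (Real.exp_pos _).le]
    linarith [exp_sub_sq_le r.coe_nonneg, Real.exp_pos (-(r : ℝ))]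
  have h1 : gammaSqOne t ≤ ∫ r : ℝ≥0, (3 - 2 * Real.exp (-(r : ℝ))) ∂(gammaLaw t) :=
    integral_mono hi2 ((integrable_const _).sub (hi1.const_mul 2)) fun r => exp_sub_sq_le r.2
  have h2 := integral_exp_neg_gammaLaw ht 1
  simp only [NNReal.coe_one, one_mul] at h2
  rw [integral_sub (integrable_const _) (hi1.const_mul 2), integral_const_mul, h2] at h1
  simp only [integral_const, probReal_univ, smul_eq_mul, one_mul] at h1
  have h3 := Real.add_one_le_exp (-(t * Real.log (1 + 1)))
  have h4 := Real.add_one_le_exp (2 * t)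
  have h5 : Real.log (1 + 1) ≤ 1 := by
    have := Real.log_le_sub_one_of_pos (show (0 : ℝ) < 1 + 1 by norm_num)
    linarith
  nlinarith

/-! ### Consequences of the Laplace transform -/

lemma exp_neg_coe_ofReal {r : ℝ} (hr : 0 ≤ r) :
    EReal.exp (-((ENNReal.ofReal r : ℝ≥0∞) : EReal)) = ENNReal.ofReal (Real.exp (-r)) := by
  rw [EReal.coe_ennreal_ofReal, max_eq_left hr, ← EReal.coe_neg, EReal.exp_coe]

section Laplace

variable {X : Type*} [MeasurableSpace X]

lemma lintegral_ofReal_cone {g : X → ℝ} (hg : Measurable g) (h0 : ∀ x, 0 ≤ g x) {B : ℝ}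
    (hB : ∀ x, g x ≤ B) (ξ : Cone X) :
    ∫⁻ x, ENNReal.ofReal (g x) ∂ξ.1 = ENNReal.ofReal (∫ x, g x ∂ξ.1) := by
  rw [ofReal_integral_eq_lintegral_ofReal _ (ae_of_all _ h0)]
  exact integrable_of_bounded hg fun x => by
    rw [Real.norm_of_nonneg (h0 x)]; exact hB x

lemma measurable_integral_cone {g : X → ℝ} (hg : Measurable g) (h0 : ∀ x, 0 ≤ g x) :
    Measurable fun ξ : Cone X => ∫ x, g x ∂ξ.1 := by
  have : (fun ξ : Cone X => ∫ x, g x ∂ξ.1) = fun ξ : Cone X =>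
      (∫⁻ x, ENNReal.ofReal (g x) ∂ξ.1).toReal := by
    funext ξ
    exact integral_eq_lintegral_of_nonneg_ae (ae_of_all _ h0) hg.aestronglyMeasurable
  rw [this]
  exact ((Measure.measurable_lintegral hg.ennreal_ofReal).comp
    measurable_subtype_coe).ennreal_toReal

lemma measurable_real_cone {A : Set X} (hA : MeasurableSet A) :
    Measurable fun ξ : Cone X => ξ.1.real A :=
  (measurable_cone_apply hA).ennreal_toReal

lemma integrable_log {m : Measure X} [IsFiniteMeasure m] {f : X → ℝ} (hf : Measurable f) {δ B : ℝ}
    (hδ : 0 < δ) (hδf : ∀ x, δ ≤ f x) (hB : ∀ x, f x ≤ B) :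
    Integrable (fun x => Real.log (f x)) m := by
  refine integrable_of_bounded hf.log (C := max |Real.log δ| |Real.log B|) fun x => ?_
  exact abs_le_max_abs_abs (Real.log_le_log hδ (hδf x))
    (Real.log_le_log (hδ.trans_le (hδf x)) (hB x))

variable {m : Measure X} [IsProbabilityMeasure m] {L : Measure (Cone X)}

lemma IsLebesgueMeasure.lintegral_exp (hL : IsLebesgueMeasure m L) {f : X → ℝ}
    (hf : Measurable f) {δ B : ℝ}
    (hδ : 0 < δ) (hδf : ∀ x, δ ≤ f x) (hB : ∀ x, f x ≤ B) :
    ∫⁻ ξ : Cone X, ENNReal.ofReal (Real.exp (-∫ x, f x ∂ξ.1)) ∂L =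
      ENNReal.ofReal (Real.exp (-∫ x, Real.log (f x) ∂m)) := by
  have h0 : ∀ x, 0 ≤ f x := fun x => hδ.le.trans (hδf x)
  rw [← hL f hf h0 (ae_of_all _ fun x => hδ.trans_le (hδf x)) (integrable_log hf hδ hδf hB)]
  refine lintegral_congr fun ξ => ?_
  rw [lintegral_ofReal_cone hf h0 hB, exp_neg_coe_ofReal (integral_nonneg h0)]

/-- The probability measure `exp (-ξ(X)) dL(ξ)`. -/
noncomputable def normalized (L : Measure (Cone X)) : Measure (Cone X) :=
  L.withDensity fun ξ => ENNReal.ofReal (Real.exp (-ξ.1.real Set.univ))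

lemma measurable_exp_neg_mass :
    Measurable fun ξ : Cone X => ENNReal.ofReal (Real.exp (-ξ.1.real Set.univ)) :=
  (measurable_real_cone MeasurableSet.univ).neg.exp.ennreal_ofReal

lemma measurable_exp_mass :
    Measurable fun ξ : Cone X => ENNReal.ofReal (Real.exp (ξ.1.real Set.univ)) :=
  (measurable_real_cone MeasurableSet.univ).exp.ennreal_ofReal

lemma withDensity_normalized (L : Measure (Cone X)) :
    (normalized L).withDensity (fun ξ => ENNReal.ofReal (Real.exp (ξ.1.real Set.univ))) = L := by
  have := withDensity_inv_same (μ := L) measurable_exp_neg_mass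
    (ae_of_all _ fun ξ => by simp [Real.exp_pos]) (ae_of_all _ fun ξ => ENNReal.ofReal_ne_top)
  have e : (fun ξ : Cone X => (ENNReal.ofReal (Real.exp (-ξ.1.real Set.univ)))⁻¹) =
      fun ξ => ENNReal.ofReal (Real.exp (ξ.1.real Set.univ)) := by
    funext ξ
    rw [← ENNReal.ofReal_inv_of_pos (Real.exp_pos _), ← Real.exp_neg, neg_neg]
  rwa [e] at this

lemma integral_eq_normalized {E : Type*} [NormedAddCommGroup E] [NormedSpace ℝ E]
    (L : Measure (Cone X)) (h : Cone X → E) :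
    ∫ ξ, h ξ ∂L = ∫ ξ, Real.exp (ξ.1.real Set.univ) • h ξ ∂(normalized L) := by
  conv_lhs => rw [← withDensity_normalized L]
  rw [integral_withDensity_eq_integral_toReal_smul measurable_exp_mass
    (ae_of_all _ fun _ => ENNReal.ofReal_lt_top)]
  simp only [ENNReal.toReal_ofReal (Real.exp_pos _).le]

lemma integrable_iff_normalized {E : Type*} [NormedAddCommGroup E] [NormedSpace ℝ E]
    (L : Measure (Cone X)) (h : Cone X → E) :
    Integrable h L ↔
      Integrable (fun ξ => Real.exp (ξ.1.real Set.univ) • h ξ) (normalized L) := by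
  conv_lhs => rw [← withDensity_normalized L]
  rw [integrable_withDensity_iff_integrable_smul' measurable_exp_mass
    (ae_of_all _ fun _ => ENNReal.ofReal_lt_top)]
  simp only [ENNReal.toReal_ofReal (Real.exp_pos _).le]

lemma IsLebesgueMeasure.isProbabilityMeasure_normalized (hL : IsLebesgueMeasure m L) :
    IsProbabilityMeasure (normalized L) := by
  refine ⟨?_⟩
  have := hL.lintegral_exp (f := fun _ => 1) measurable_const one_pos (fun _ => le_rfl)
    (fun _ => le_rfl)
  rw [normalized, withDensity_apply _ MeasurableSet.univ, Measure.restrict_univ]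
  simpa using this

/-- The density adds 1 to the test function, and `1 + g` is bounded away from zero, so the Laplace
transform applies to every bounded `g ≥ 0`. -/
lemma IsLebesgueMeasure.integral_exp_normalized (hL : IsLebesgueMeasure m L) {g : X → ℝ}
    (hg : Measurable g) {B : ℝ} (h0 : ∀ x, 0 ≤ g x) (hB : ∀ x, g x ≤ B) :
    ∫ ξ : Cone X, Real.exp (-∫ x, g x ∂ξ.1) ∂(normalized L) =
      Real.exp (-∫ x, Real.log (1 + g x) ∂m) := by
  have h := hL.lintegral_exp (f := fun x => 1 + g x) (hg.const_add 1) (B := 1 + B) one_pos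
    (fun x => by linarith [h0 x]) (fun x => by linarith [hB x])
  rw [normalized, integral_withDensity_eq_integral_toReal_smul measurable_exp_neg_mass
    (ae_of_all _ fun _ => ENNReal.ofReal_lt_top)]
  have e : ∀ ξ : Cone X, (ENNReal.ofReal (Real.exp (-ξ.1.real Set.univ))).toReal •
      Real.exp (-∫ x, g x ∂ξ.1) = Real.exp (-∫ x, (1 + g x) ∂ξ.1) := by
    intro ξ
    have hi : Integrable g ξ.1 := integrable_of_bounded hg fun x => by
      rw [Real.norm_of_nonneg (h0 x)]; exact hB x
    rw [ENNReal.toReal_ofReal (Real.exp_pos _).le, smul_eq_mul, ← Real.exp_add,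
      integral_add (integrable_const _) hi]
    simp only [integral_const, smul_eq_mul, mul_one]
    rw [neg_add]
  simp only [e]
  rw [integral_eq_lintegral_of_nonneg_ae (ae_of_all _ fun _ => (Real.exp_pos _).le), h,
    ENNReal.toReal_ofReal (Real.exp_pos _).le]
  exact (measurable_integral_cone (hg.const_add 1)
    fun x => by linarith [h0 x]).neg.exp.aestronglyMeasurable

/-- The multiplicative system of exponentials of linear functionals. -/
noncomputable def laplaceSystem (X : Type*) [MeasurableSpace X] : Submonoid (Cone X → ℝ) where
  carrier := {φ | ∃ g : X → ℝ, Measurable g ∧ (∀ x, 0 ≤ g x) ∧ (∃ B, ∀ x, g x ≤ B) ∧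
    φ = fun ξ : Cone X => Real.exp (-∫ x, g x ∂ξ.1)}
  one_mem' := ⟨0, measurable_const, fun _ => le_rfl, ⟨0, fun _ => le_rfl⟩, by ext; simp⟩
  mul_mem' := by
    rintro _ _ ⟨g, hg, hg0, ⟨B, hB⟩, rfl⟩ ⟨k, hk, hk0, ⟨C, hC⟩, rfl⟩
    refine ⟨g + k, hg.add hk, fun x => add_nonneg (hg0 x) (hk0 x),
      ⟨B + C, fun x => add_le_add (hB x) (hC x)⟩, ?_⟩
    ext ξ
    have h1 : Integrable g ξ.1 := integrable_of_bounded hg fun x => by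
      rw [Real.norm_of_nonneg (hg0 x)]; exact hB x
    have h2 : Integrable k ξ.1 := integrable_of_bounded hk fun x => by
      rw [Real.norm_of_nonneg (hk0 x)]; exact hC x
    simp only [Pi.mul_apply, Pi.add_apply]
    rw [← Real.exp_add, integral_add h1 h2, neg_add]

/-- The Laplace transform determines the measure. -/
theorem IsLebesgueMeasure.unique (hL : IsLebesgueMeasure m L) {L' : Measure (Cone X)}
    (hL' : IsLebesgueMeasure m L') : L = L' := by
  have := hL.isProbabilityMeasure_normalized
  have := hL'.isProbabilityMeasure_normalized
  have key : normalized L = normalized L' := by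
    refine measure_ext_of_submonoid (laplaceSystem X) ?_ ?_ ?_ ?_
    · rintro _ ⟨g, hg, hg0, -, rfl⟩
      exact (measurable_integral_cone hg hg0).neg.exp
    · rintro _ ⟨g, hg, hg0, -, rfl⟩ ξ
      rw [abs_of_pos (Real.exp_pos _), Real.exp_le_one_iff, neg_nonpos]
      exact integral_nonneg hg0
    · refine cone_measurableSpace_le _ fun A hA => ?_
      let φ : laplaceSystem X := ⟨fun ξ : Cone X => Real.exp (-∫ x, A.indicator 1 x ∂ξ.1),
        A.indicator 1, measurable_one.indicator hA,
        Set.indicator_nonneg fun _ _ => zero_le_one, ⟨1, fun x => Set.indicator_le_self'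
          (f := fun _ => (1 : ℝ)) (fun _ _ => zero_le_one) x⟩, rfl⟩
      have hφ : Measurable[⨆ φ : laplaceSystem X, MeasurableSpace.comap φ.1 inferInstance] φ.1 :=
        measurable_iff_comap_le.2 (le_iSup (fun φ : laplaceSystem X =>
          MeasurableSpace.comap φ.1 inferInstance) φ)
      have e : (fun ξ : Cone X => ξ.1 A) = fun ξ => ENNReal.ofReal (-Real.log (φ.1 ξ)) := by
        funext ξ
        simp only [φ, Real.log_exp, neg_neg]
        rw [integral_indicator_one hA, ofReal_measureReal]
      rw [e]
      exact (ENNReal.measurable_ofReal.comp (Real.measurable_log.comp hφ).neg)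
    · rintro _ ⟨g, hg, hg0, ⟨B, hB⟩, rfl⟩
      rw [hL.integral_exp_normalized hg hg0 hB, hL'.integral_exp_normalized hg hg0 hB]
  rw [← withDensity_normalized L, key, withDensity_normalized]

/-- The multiplicative system of exponentials of linear functions on an orthant. -/
noncomputable def orthantSystem (ι : Type*) [Fintype ι] : Submonoid ((ι → ℝ≥0) → ℝ) where
  carrier := {φ | ∃ b : ι → ℝ≥0, φ = fun r => Real.exp (-∑ j, (b j * r j : ℝ))}
  one_mem' := ⟨0, by ext; simp⟩
  mul_mem' := by
    rintro _ _ ⟨a, rfl⟩ ⟨b, rfl⟩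
    refine ⟨a + b, ?_⟩
    ext r
    simp only [Pi.mul_apply, Pi.add_apply, ← Real.exp_add, NNReal.coe_add, add_mul,
      Finset.sum_add_distrib, neg_add]

/-- The joint law of the masses of the cells of a finite partition. -/
theorem IsLebesgueMeasure.map_cells (hL : IsLebesgueMeasure m L) {ι : Type*} [Fintype ι]
    [MeasurableSpace ι] [MeasurableSingletonClass ι] {p : X → ι} (hp : Measurable p) :
    (normalized L).map (fun ξ j => (ξ.1 (p ⁻¹' {j})).toNNReal) =
      Measure.pi fun j => gammaLaw (m.real (p ⁻¹' {j})) := by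
  have := hL.isProbabilityMeasure_normalized
  have hG : ∀ j, IsProbabilityMeasure (gammaLaw (m.real (p ⁻¹' {j}))) :=
    fun j => isProbabilityMeasure_gammaLaw measureReal_nonneg
  have hmeas : Measurable fun (ξ : Cone X) j => (ξ.1 (p ⁻¹' {j})).toNNReal :=
    measurable_pi_lambda _ fun j =>
      (measurable_cone_apply (hp (measurableSet_singleton j))).ennreal_toNNReal
  have : IsProbabilityMeasure ((normalized L).map
      (fun (ξ : Cone X) j => (ξ.1 (p ⁻¹' {j})).toNNReal)) :=
    Measure.isProbabilityMeasure_map hmeas.aemeasurable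
  refine measure_ext_of_submonoid (orthantSystem ι) ?_ ?_ ?_ ?_
  · rintro _ ⟨b, rfl⟩
    fun_prop
  · rintro _ ⟨b, rfl⟩ r
    rw [abs_of_pos (Real.exp_pos _), Real.exp_le_one_iff, neg_nonpos]
    exact Finset.sum_nonneg fun j _ => by positivity
  · classical
    refine iSup_le fun j => ?_
    let φ : orthantSystem ι := ⟨_, Pi.single j 1, rfl⟩
    refine le_trans ?_ (le_iSup (fun φ : orthantSystem ι =>
          MeasurableSpace.comap φ.1 inferInstance) φ)
    have e : (fun r : ι → ℝ≥0 => r j) = (fun y : ℝ => (-Real.log y).toNNReal) ∘ φ.1 := by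
      funext r
      simp only [φ, Function.comp, Real.log_exp, neg_neg]
      rw [Finset.sum_eq_single j]
      · simp
      · intro i _ hi; simp [Pi.single_eq_of_ne hi]
      · simp
    rw [e, ← MeasurableSpace.comap_comp]
    exact MeasurableSpace.comap_mono
      (measurable_iff_comap_le.1 (Real.measurable_log.neg.real_toNNReal))
  · rintro _ ⟨b, rfl⟩
    rw [integral_map hmeas.aemeasurable (Measurable.aestronglyMeasurable (by fun_prop))]
    -- A linear form in the cell masses is the integral of a step function, so its Laplace transform
    -- is `∏ (1 + bⱼ) ^ (-m(Aⱼ))`, the transform of independent Gamma variables.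
    have h1 : ∀ ξ : Cone X, ∑ j, ((b j : ℝ) * ((ξ.1 (p ⁻¹' {j})).toNNReal : ℝ)) =
        ∫ x, (b (p x) : ℝ) ∂ξ.1 := by
      intro ξ
      rw [integral_comp_finite hp ξ.1 fun j => (b j : ℝ)]
      refine Finset.sum_congr rfl fun j _ => ?_
      rw [smul_eq_mul, mul_comm]
      rfl
    simp only [h1]
    have hb : Measurable fun x => (b (p x) : ℝ) :=
      (measurable_of_finite fun j => (b j : ℝ)).comp hp
    rw [hL.integral_exp_normalized hb (fun x => NNReal.coe_nonneg _)
      (B := ∑ j, (b j : ℝ)) (fun x => Finset.single_le_sum (f := fun j => (b j : ℝ))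
        (fun j _ => NNReal.coe_nonneg _) (Finset.mem_univ (p x))),
      integral_comp_finite hp m fun j => Real.log (1 + b j)]
    simp only [← Finset.sum_neg_distrib, Real.exp_sum]
    rw [integral_fintype_prod_eq_prod (fun j (r : ℝ≥0) => Real.exp (-(b j * r : ℝ)))]
    refine Finset.prod_congr rfl fun j _ => ?_
    rw [integral_exp_neg_gammaLaw measureReal_nonneg, smul_eq_mul]

end Laplace

/-! ### The Laplace transform of the sum of squares -/

section Gram

variable {X : Type*} [MeasurableSpace X] [MeasurableSpace.CountablySeparated X]

lemma sumSq_const (ξ : Cone X) (a : ℂ) :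
    sumSq ξ (fun _ => a) = ((sqMeasure ξ).real Set.univ : ℂ) * a := by
  rw [sumSq_eq_integral ξ measurable_const (C := ‖a‖) fun _ => le_rfl, integral_const,
    Complex.real_smul]

section Labelled

variable {κ : Type*} [Fintype κ] [MeasurableSpace κ] [MeasurableSingletonClass κ]

lemma measurable_cellSum {l : X → κ} (hl : Measurable l) (a : κ → ℂ) (n : ℕ) :
    Measurable (cellSum l a n) := by
  refine Finset.measurable_sum _ fun j _ => Measurable.mul_const ?_ _
  exact Complex.measurable_ofReal.comp ((measurable_real_cone
    (measurable_cellMap hl n (measurableSet_singleton j))).pow_const 2)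

lemma norm_exp_neg_cellSum_le {l : X → κ} (hl : Measurable l) {a : κ → ℂ} {δ : ℝ} (hδ : 0 ≤ δ)
    (ha : ∀ k, δ ≤ (a k).re) (n : ℕ) (ξ : Cone X) :
    ‖Complex.exp (-cellSum l a n ξ)‖ ≤ Real.exp (-(δ * (sqMeasure ξ).real Set.univ)) := by
  rw [Complex.norm_exp, Real.exp_le_exp, Complex.neg_re, neg_le_neg_iff]
  have h1 : (sqMeasure ξ).real Set.univ ≤ (cellSum l (fun _ => 1) n ξ).re := by
    have h := (Complex.continuous_re.tendsto _).comp (tendsto_cellSum hl (fun _ => 1) ξ)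
    rw [sumSq_const, mul_one, Complex.ofReal_re] at h
    exact (cellSum_one_antitone hl ξ).le_of_tendsto h n
  refine (mul_le_mul_of_nonneg_left h1 hδ).trans ?_
  simp only [cellSum, Complex.re_sum, Finset.mul_sum, Complex.re_ofReal_mul, mul_one]
  refine Finset.sum_le_sum fun j _ => ?_
  rw [mul_comm]
  exact mul_le_mul_of_nonneg_left (ha _) (sq_nonneg _)

variable {m : Measure X} [IsProbabilityMeasure m] {L : Measure (Cone X)}

/-- The prefactor in the Laplace transform of the sum of squares over cells. -/
noncomputable def cellConst (m : Measure X) (l : X → κ) (n : ℕ) : ℝ :=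
  ∏ j, gammaSqOne (m.real (cellMap l n ⁻¹' {j}))



lemma cellConst_le {l : X → κ} (hl : Measurable l) (n : ℕ) : cellConst m l n ≤ Real.exp 2 := by
  calc cellConst m l n ≤ ∏ j, Real.exp (2 * m.real (cellMap l n ⁻¹' {j})) :=
        Finset.prod_le_prod (fun _ _ => gammaSqOne_nonneg _)
          fun _ _ => gammaSqOne_le measureReal_nonneg
    _ = Real.exp 2 := by
      rw [← Real.exp_sum, ← Finset.mul_sum]
      have := integral_comp_finite (measurable_cellMap hl n) m fun _ => (1 : ℝ)
      simp only [integral_const, probReal_univ, smul_eq_mul, mul_one] at this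
      rw [← this, mul_one]

/-- After the change to `normalized L` the integrand carries the extra factor `exp (ξ(X))`, which is
a product over the cells. By `map_cells` the integral becomes a product of the integrals `gammaSq`.
-/
lemma IsLebesgueMeasure.integral_exp_cellSum (hL : IsLebesgueMeasure m L) {l : X → κ}
    (hl : Measurable l) {a : κ → ℂ} (ha : ∀ k, 0 < (a k).re) (n : ℕ) :
    Integrable (fun ξ => Complex.exp (-cellSum l a n ξ)) L ∧
    ∫ ξ, Complex.exp (-cellSum l a n ξ) ∂L =
      cellConst m l n * Complex.exp (-(1 / 2 * ∫ x, Complex.log (a (l x)) ∂m)) := by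
  have hp := measurable_cellMap hl n
  have := hL.isProbabilityMeasure_normalized
  have hG : ∀ j, IsProbabilityMeasure (gammaLaw (m.real (cellMap l n ⁻¹' {j}))) :=
    fun j => isProbabilityMeasure_gammaLaw measureReal_nonneg
  let T : Cone X → (κ × (Fin n → Bool)) → ℝ≥0 := fun ξ j => (ξ.1 (cellMap l n ⁻¹' {j})).toNNReal
  let g : (κ × (Fin n → Bool)) → ℝ≥0 → ℂ := fun j r =>
    Complex.exp ((r : ℝ) - a j.1 * ((r : ℝ) ^ 2 : ℝ))
  have hT : Measurable T := measurable_pi_lambda _ fun j =>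
    (measurable_cone_apply (hp (measurableSet_singleton j))).ennreal_toNNReal
  have hg : Measurable fun r : (κ × (Fin n → Bool)) → ℝ≥0 => ∏ j, g j (r j) := by
    refine Continuous.measurable ?_
    fun_prop
  have e : ∀ ξ : Cone X, Real.exp (ξ.1.real Set.univ) • Complex.exp (-cellSum l a n ξ) =
      ∏ j, g j (T ξ j) := by
    intro ξ
    have h1 := integral_comp_finite hp ξ.1 fun _ => (1 : ℝ)
    simp only [integral_const, smul_eq_mul, mul_one] at h1
    simp only [g]
    rw [← Complex.exp_sum, Complex.real_smul, Complex.ofReal_exp, ← Complex.exp_add, h1, cellSum,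
      Finset.sum_sub_distrib, Complex.ofReal_sum, sub_eq_add_neg]
    congr 3
    refine Finset.sum_congr rfl fun j _ => ?_
    rw [mul_comm]
    rfl
  have hi : ∀ j, Integrable (g j) (gammaLaw (m.real (cellMap l n ⁻¹' {j}))) :=
    fun j => integrable_exp_sub_sq (ha j.1) _
  have hlaw := hL.map_cells hp
  rw [integrable_iff_normalized, integral_eq_normalized]
  simp only [e]
  constructor
  · refine Integrable.comp_measurable (f := T) (g := fun r => ∏ j, g j (r j)) ?_ hT
    rw [hlaw]
    exact Integrable.fintype_prod hi
  · rw [← integral_map (f := fun r => ∏ j, g j (r j)) hT.aemeasurable hg.aestronglyMeasurable,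
      hlaw, integral_fintype_prod_eq_prod]
    have h2 : ∀ j, ∫ r, g j r ∂(gammaLaw (m.real (cellMap l n ⁻¹' {j}))) =
        gammaSqOne (m.real (cellMap l n ⁻¹' {j})) *
          Complex.exp (-(m.real (cellMap l n ⁻¹' {j}) / 2 * Complex.log (a j.1))) :=
      fun j => gammaSq_eq measureReal_nonneg (ha j.1)
    simp only [h2]
    rw [Finset.prod_mul_distrib, ← Complex.exp_sum, cellConst, Complex.ofReal_prod]
    congr 2
    have h3 : ∫ x, Complex.log (a (l x)) ∂m =
        ∑ j, m.real (cellMap l n ⁻¹' {j}) • Complex.log (a j.1) :=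
      integral_comp_finite hp m fun j => Complex.log (a j.1)
    rw [h3, Finset.mul_sum, ← Finset.sum_neg_distrib]
    refine Finset.sum_congr rfl fun j _ => ?_
    rw [Complex.real_smul]
    ring

end Labelled

variable {m : Measure X} [IsProbabilityMeasure m] {L : Measure (Cone X)}

lemma measurable_sqMass : Measurable fun ξ : Cone X => (sqMeasure ξ).real Set.univ :=
  ((Measure.measurable_coe MeasurableSet.univ).comp measurable_sqMeasure).ennreal_toReal

/-- Fatou's lemma along the partitions: the integrals at the finite stages are explicit, and
`cellConst_le` bounds them uniformly. This function then serves as the majorant in the later limits.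
-/
lemma IsLebesgueMeasure.integrable_exp_sqMass (hL : IsLebesgueMeasure m L) {δ : ℝ} (hδ : 0 < δ) :
    Integrable (fun ξ : Cone X => Real.exp (-(δ * (sqMeasure ξ).real Set.univ))) L := by
  have hl : Measurable fun _ : X => () := measurable_const
  have hmeas : Measurable fun ξ : Cone X => Real.exp (-(δ * (sqMeasure ξ).real Set.univ)) :=
    (measurable_sqMass.const_mul δ).neg.exp
  let h : ℕ → Cone X → ℂ := fun n ξ => Complex.exp (-cellSum (fun _ : X => ()) (fun _ => δ) n ξ)
  have hm : ∀ n, Measurable (h n) := fun n => (measurable_cellSum hl _ n).neg.cexp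
  have hreal : ∀ n ξ, ((‖h n ξ‖ : ℝ) : ℂ) = h n ξ := by
    intro n ξ
    have : cellSum (fun _ : X => ()) (fun _ => (δ : ℂ)) n ξ =
        ((∑ j, ξ.1.real (cellMap (fun _ : X => ()) n ⁻¹' {j}) ^ 2 * δ : ℝ) : ℂ) := by
      rw [cellSum]
      push_cast
      rfl
    simp only [h]
    rw [Complex.norm_exp, this, ← Complex.ofReal_neg, Complex.ofReal_re, Complex.ofReal_exp]
  have hn : ∀ n, ∫⁻ ξ, ‖h n ξ‖ₑ ∂L ≤
      ENNReal.ofReal (Real.exp 2 * Real.exp (-(1 / 2 * Real.log δ))) := by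
    intro n
    obtain ⟨hi, heq⟩ := hL.integral_exp_cellSum hl (a := fun _ => (δ : ℂ)) (fun _ => by simpa) n
    rw [← ofReal_integral_norm_eq_lintegral_enorm hi]
    refine ENNReal.ofReal_le_ofReal ?_
    have h1 : ((∫ ξ, ‖h n ξ‖ ∂L : ℝ) : ℂ) = ∫ ξ, h n ξ ∂L := by
      rw [← integral_complex_ofReal]
      simp only [hreal]
    have h2 : ∫ ξ, ‖h n ξ‖ ∂L =
        cellConst m (fun _ : X => ()) n * Real.exp (-(1 / 2 * Real.log δ)) := by
      rw [← Complex.ofReal_inj, h1]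
      refine heq.trans ?_
      simp only [integral_const, probReal_univ, one_smul]
      rw [← Complex.ofReal_log hδ.le]
      push_cast
      rfl
    rw [h2]
    exact mul_le_mul_of_nonneg_right (cellConst_le hl n) (Real.exp_pos _).le
  have hlim : ∀ ξ : Cone X, Tendsto (fun n => ‖h n ξ‖ₑ) atTop
      (𝓝 ‖Real.exp (-(δ * (sqMeasure ξ).real Set.univ))‖ₑ) := by
    intro ξ
    have h1 := ((tendsto_cellSum hl (fun _ => (δ : ℂ)) ξ).neg.cexp).enorm
    rw [sumSq_const] at h1
    convert h1 using 2
    rw [← ofReal_norm, ← ofReal_norm, Complex.norm_exp, Real.norm_of_nonneg (Real.exp_pos _).le]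
    congr 2
    rw [← Complex.ofReal_mul, ← Complex.ofReal_neg, Complex.ofReal_re, mul_comm]
  refine ⟨hmeas.aestronglyMeasurable, ?_⟩
  calc ∫⁻ ξ, ‖Real.exp (-(δ * (sqMeasure ξ).real Set.univ))‖ₑ ∂L
      = ∫⁻ ξ, liminf (fun n => ‖h n ξ‖ₑ) atTop ∂L :=
        lintegral_congr fun ξ => (hlim ξ).liminf_eq.symm
    _ ≤ liminf (fun n => ∫⁻ ξ, ‖h n ξ‖ₑ ∂L) atTop := lintegral_liminf_le fun n => (hm n).enorm
    _ ≤ liminf (fun _ : ℕ => ENNReal.ofReal (Real.exp 2 * Real.exp (-(1 / 2 * Real.log δ)))) atTop :=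
        liminf_le_liminf (Eventually.of_forall hn)
    _ < ⊤ := by rw [liminf_const]; exact ENNReal.ofReal_lt_top

/-- The normalizing constant of the functionals. -/
noncomputable def sqConst (L : Measure (Cone X)) : ℂ :=
  ∫ ξ, Complex.exp (-sumSq ξ fun _ => 1) ∂L

/-- The prefactor `cellConst m l n` is the same for every `a`. Taking `a = 1` shows that it
converges to `sqConst L`, so its limit never has to be computed. -/
lemma IsLebesgueMeasure.integral_exp_sumSq_label (hL : IsLebesgueMeasure m L) {κ : Type*}
    [Fintype κ] [MeasurableSpace κ] [MeasurableSingletonClass κ] {l : X → κ} (hl : Measurable l)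
    {a : κ → ℂ} {δ : ℝ} (hδ : 0 < δ) (ha : ∀ k, δ ≤ (a k).re) :
    ∫ ξ, Complex.exp (-sumSq ξ fun x => a (l x)) ∂L =
      sqConst L * Complex.exp (-(1 / 2 * ∫ x, Complex.log (a (l x)) ∂m)) := by
  have key : ∀ (b : κ → ℂ) (ε : ℝ), 0 < ε → (∀ k, ε ≤ (b k).re) →
      Tendsto (fun n => (cellConst m l n : ℂ) *
        Complex.exp (-(1 / 2 * ∫ x, Complex.log (b (l x)) ∂m))) atTop
        (𝓝 (∫ ξ, Complex.exp (-sumSq ξ fun x => b (l x)) ∂L)) := by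
    intro b ε hε hb
    have := tendsto_integral_of_dominated_convergence (μ := L)
      (F := fun n ξ => Complex.exp (-cellSum l b n ξ))
      (f := fun ξ => Complex.exp (-sumSq ξ fun x => b (l x)))
      (fun ξ : Cone X => Real.exp (-(ε * (sqMeasure ξ).real Set.univ)))
      (fun n => (measurable_cellSum hl b n).neg.cexp.aestronglyMeasurable)
      (hL.integrable_exp_sqMass hε)
      (fun n => ae_of_all _ fun ξ => norm_exp_neg_cellSum_le hl hε.le hb n ξ)
      (ae_of_all _ fun ξ => (tendsto_cellSum hl b ξ).neg.cexp)
    exact this.congr fun n =>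
      (hL.integral_exp_cellSum hl (fun k => hε.trans_le (hb k)) n).2
  have h1 := key (fun _ => 1) 1 one_pos fun _ => by simp
  simp only [Complex.log_one, integral_zero, mul_zero, neg_zero, Complex.exp_zero, mul_one] at h1
  exact tendsto_nhds_unique (key a δ hδ ha) (h1.mul_const _)

lemma norm_exp_neg_sumSq_le {w : X → ℂ} (hw : Measurable w) {δ B : ℝ} (hδ : ∀ x, δ ≤ (w x).re)
    (hB : ∀ x, ‖w x‖ ≤ B) (ξ : Cone X) :
    ‖Complex.exp (-sumSq ξ w)‖ ≤ Real.exp (-(δ * (sqMeasure ξ).real Set.univ)) := by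
  rw [Complex.norm_exp, Real.exp_le_exp, Complex.neg_re, neg_le_neg_iff, sumSq_re ξ hw hB]
  have h := integral_mono (μ := sqMeasure ξ) (integrable_const δ)
    (integrable_of_bounded (Complex.measurable_re.comp hw)
      fun x => (Complex.abs_re_le_norm _).trans (hB x)) hδ
  rw [integral_const, smul_eq_mul, mul_comm] at h
  exact h

lemma norm_log_le {z : ℂ} {δ B : ℝ} (hδ : 0 < δ) (h1 : δ ≤ ‖z‖) (h2 : ‖z‖ ≤ B) :
    ‖Complex.log z‖ ≤ max |Real.log δ| |Real.log B| + Real.pi := by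
  refine (Complex.norm_le_abs_re_add_abs_im _).trans (add_le_add ?_ ?_)
  · rw [Complex.log_re]
    exact abs_le_max_abs_abs (Real.log_le_log hδ h1) (Real.log_le_log (hδ.trans_le h1) h2)
  · rw [Complex.log_im]
    exact Complex.abs_arg_le_pi z

/-- The Laplace transform of the weighted sum of squares. -/
theorem IsLebesgueMeasure.integral_exp_sumSq (hL : IsLebesgueMeasure m L) {w : X → ℂ}
    (hw : Measurable w) {δ B : ℝ} (hδ : 0 < δ) (hδw : ∀ x, δ ≤ (w x).re) (hB : ∀ x, ‖w x‖ ≤ B) :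
    ∫ ξ, Complex.exp (-sumSq ξ w) ∂L =
      sqConst L * Complex.exp (-(1 / 2 * ∫ x, Complex.log (w x) ∂m)) := by
  obtain ⟨x₀⟩ : Nonempty X := nonempty_of_isProbabilityMeasure m
  let s : Set ℂ := {z | δ ≤ z.re ∧ ‖z‖ ≤ B}
  have hws : ∀ x, w x ∈ s := fun x => ⟨hδw x, hB x⟩
  -- Approximating within `s` keeps the lower bound on the real part and the bound on the norm
  -- uniform in `n`; the finite range of `W n` is its set of labels.
  let W : ℕ → SimpleFunc X ℂ := fun n => SimpleFunc.approxOn w hw s (w x₀) (hws x₀) n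
  have hWs : ∀ n x, W n x ∈ s := fun n x => SimpleFunc.approxOn_mem hw (hws x₀) n x
  have hWlim : ∀ x, Tendsto (fun n => W n x) atTop (𝓝 (w x)) := fun x =>
    SimpleFunc.tendsto_approxOn hw (hws x₀) (subset_closure (hws x))
  have hW : ∀ n, ∫ ξ, Complex.exp (-sumSq ξ (W n)) ∂L =
      sqConst L * Complex.exp (-(1 / 2 * ∫ x, Complex.log (W n x) ∂m)) := by
    intro n
    have hl : Measurable fun x => (⟨W n x, (W n).mem_range_self x⟩ : (W n).range) :=
      (W n).measurable.subtype_mk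
    refine hL.integral_exp_sumSq_label hl (a := Subtype.val) hδ fun k => ?_
    obtain ⟨x, hx⟩ := SimpleFunc.mem_range.1 k.2
    rw [← hx]
    exact (hWs n x).1
  have hsum : ∀ ξ : Cone X, Tendsto (fun n => sumSq ξ (W n)) atTop (𝓝 (sumSq ξ w)) := by
    intro ξ
    rw [sumSq_eq_integral ξ hw hB]
    have e : ∀ n, sumSq ξ (W n) = ∫ x, W n x ∂(sqMeasure ξ) := fun n =>
      sumSq_eq_integral ξ (W n).measurable fun x => (hWs n x).2
    simp only [e]
    exact tendsto_integral_of_dominated_convergence (fun _ => B)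
      (fun n => (W n).measurable.aestronglyMeasurable) (integrable_const _)
      (fun n => ae_of_all _ fun x => (hWs n x).2) (ae_of_all _ hWlim)
  have h1 : Tendsto (fun n => ∫ ξ, Complex.exp (-sumSq ξ (W n)) ∂L) atTop
      (𝓝 (∫ ξ, Complex.exp (-sumSq ξ w) ∂L)) :=
    tendsto_integral_of_dominated_convergence
      (fun ξ : Cone X => Real.exp (-(δ * (sqMeasure ξ).real Set.univ)))
      (fun n => (measurable_sumSq (W n).measurable
        fun x => (hWs n x).2).neg.cexp.aestronglyMeasurable)
      (hL.integrable_exp_sqMass hδ)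
      (fun n => ae_of_all _ fun ξ => norm_exp_neg_sumSq_le (W n).measurable
        (fun x => (hWs n x).1) (fun x => (hWs n x).2) ξ)
      (ae_of_all _ fun ξ => (hsum ξ).neg.cexp)
  have h2 : Tendsto (fun n => ∫ x, Complex.log (W n x) ∂m) atTop
      (𝓝 (∫ x, Complex.log (w x) ∂m)) :=
    tendsto_integral_of_dominated_convergence
      (fun _ => max |Real.log δ| |Real.log B| + Real.pi)
      (fun n => (Complex.measurable_log.comp (W n).measurable).aestronglyMeasurable)
      (integrable_const _)
      (fun n => ae_of_all _ fun x => norm_log_le hδ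
        ((hWs n x).1.trans (Complex.re_le_norm _)) (hWs n x).2)
      (ae_of_all _ fun x => (hWlim x).clog (Or.inl (hδ.trans_le (hδw x))))
  simp only [hW] at h1
  exact tendsto_nhds_unique h1 (((h2.const_mul (1 / 2)).neg.cexp).const_mul _)

end Gram

/-! ### Stick breaking and existence of the Lebesgue measure -/

section StickBreaking

variable {X : Type*}

/-- Clip a number to the open unit interval. -/
noncomputable def clip (v : ℝ) : ℝ := if v ∈ Set.Ioo (0 : ℝ) 1 then v else 1 / 2

lemma clip_mem (v : ℝ) : clip v ∈ Set.Ioo (0 : ℝ) 1 := by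
  unfold clip
  split_ifs with h
  · exact h
  · norm_num

lemma clip_of_mem {v : ℝ} (h : v ∈ Set.Ioo (0 : ℝ) 1) : clip v = v := if_pos h

lemma measurable_clip : Measurable clip :=
  Measurable.ite measurableSet_Ioo measurable_id measurable_const

/-- The stick-breaking weights. -/
noncomputable def stick (ω : ℕ → ℝ × X) (k : ℕ) : ℝ :=
  clip (ω k).1 * ∏ i ∈ Finset.range k, (1 - clip (ω i).1)

lemma stick_pos (ω : ℕ → ℝ × X) (k : ℕ) : 0 < stick ω k :=
  mul_pos (clip_mem _).1 (Finset.prod_pos fun i _ => by linarith [(clip_mem (ω i).1).2])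

lemma measurable_stick [MeasurableSpace X] (k : ℕ) : Measurable fun ω : ℕ → ℝ × X => stick ω k := by
  have h : ∀ i, Measurable fun ω : ℕ → ℝ × X => clip (ω i).1 := fun i =>
    measurable_clip.comp (measurable_fst.comp (measurable_pi_apply i))
  exact (h k).mul (Finset.measurable_prod _ fun i _ => measurable_const.sub (h i))

lemma sum_stick (ω : ℕ → ℝ × X) (n : ℕ) :
    ∑ k ∈ Finset.range n, stick ω k = 1 - ∏ i ∈ Finset.range n, (1 - clip (ω i).1) := by
  induction n with
  | zero => simp
  | succ n ih =>
    rw [Finset.sum_range_succ, ih, Finset.prod_range_succ, stick]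
    ring

/-- The inequality suffices: that the weights sum to 1 almost surely is not needed, because the
shift `t` below is added to the mean and not to `f`. Clipping the breaks makes this hold for every
`ω`. -/
lemma sum_stick_le (ω : ℕ → ℝ × X) (n : ℕ) : ∑ k ∈ Finset.range n, stick ω k ≤ 1 := by
  rw [sum_stick]
  have : 0 ≤ ∏ i ∈ Finset.range n, (1 - clip (ω i).1) :=
    Finset.prod_nonneg fun i _ => by linarith [(clip_mem (ω i).1).2]
  linarith

lemma summable_stick (ω : ℕ → ℝ × X) : Summable (stick ω) :=
  summable_of_sum_range_le (fun k => (stick_pos ω k).le) (sum_stick_le ω)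

/-- The mean of `f` with respect to the stick-breaking random measure. -/
noncomputable def stickMean (f : X → ℝ) (ω : ℕ → ℝ × X) : ℝ := ∑' k, stick ω k * f (ω k).2

section Bounded

variable {f : X → ℝ} {B : ℝ}

lemma summable_stickMean (h0 : ∀ x, 0 ≤ f x) (hB : ∀ x, f x ≤ B) (ω : ℕ → ℝ × X) :
    Summable fun k => stick ω k * f (ω k).2 :=
  Summable.of_nonneg_of_le (fun k => mul_nonneg (stick_pos ω k).le (h0 _))
    (fun k => mul_le_mul_of_nonneg_left (hB _) (stick_pos ω k).le) ((summable_stick ω).mul_right B)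

lemma stickMean_nonneg (h0 : ∀ x, 0 ≤ f x) (ω : ℕ → ℝ × X) : 0 ≤ stickMean f ω :=
  tsum_nonneg fun k => mul_nonneg (stick_pos ω k).le (h0 _)

lemma stickMean_le (h0 : ∀ x, 0 ≤ f x) (hB : ∀ x, f x ≤ B) (ω : ℕ → ℝ × X) :
    stickMean f ω ≤ B := by
  have hB0 : 0 ≤ B := (h0 (ω 0).2).trans (hB _)
  refine Real.tsum_le_of_sum_range_le (fun k => mul_nonneg (stick_pos ω k).le (h0 _)) fun n => ?_
  calc ∑ k ∈ Finset.range n, stick ω k * f (ω k).2 ≤ ∑ k ∈ Finset.range n, stick ω k * B :=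
        Finset.sum_le_sum fun k _ => mul_le_mul_of_nonneg_left (hB _) (stick_pos ω k).le
    _ ≤ 1 * B := by
        rw [← Finset.sum_mul]
        exact mul_le_mul_of_nonneg_right (sum_stick_le ω n) hB0
    _ = B := one_mul B

lemma measurable_stickMean [MeasurableSpace X] (hf : Measurable f) (h0 : ∀ x, 0 ≤ f x) (hB : ∀ x, f x ≤ B) :
    Measurable (stickMean f) := by
  refine measurable_of_tendsto_metrizable
    (f := fun n ω => ∑ k ∈ Finset.range n, stick ω k * f (ω k).2) (fun n => ?_)
    (tendsto_pi_nhds.2 fun ω => (summable_stickMean h0 hB ω).hasSum.tendsto_sum_nat)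
  exact Finset.measurable_sum _ fun k _ => (measurable_stick k).mul
    (hf.comp (measurable_snd.comp (measurable_pi_apply k)))

/-- Prepend an element to a sequence. -/
def consSeq {E : Type*} (p : E × (ℕ → E)) : ℕ → E
  | 0 => p.1
  | n + 1 => p.2 n

lemma measurable_consSeq {E : Type*} [MeasurableSpace E] :
    Measurable (consSeq : E × (ℕ → E) → ℕ → E) := by
  refine measurable_pi_lambda _ fun n => ?_
  cases n with
  | zero => exact measurable_fst
  | succ n => exact (measurable_pi_apply n).comp measurable_snd

/-- Self-similarity: after the first break, the rest of the stick is broken in the same way. -/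
lemma stickMean_consSeq (h0 : ∀ x, 0 ≤ f x) (hB : ∀ x, f x ≤ B) (p : (ℝ × X) × (ℕ → ℝ × X)) :
    stickMean f (consSeq p) = clip p.1.1 * f p.1.2 + (1 - clip p.1.1) * stickMean f p.2 := by
  rw [stickMean, (summable_stickMean h0 hB _).tsum_eq_zero_add, stickMean, ← tsum_mul_left]
  congr 1
  · simp [stick, consSeq]
  · refine tsum_congr fun k => ?_
    have h : stick (consSeq p) (k + 1) = (1 - clip p.1.1) * stick p.2 k := by
      simp only [stick, Finset.prod_range_succ']
      simp only [consSeq]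
      ring
    rw [h]
    simp only [consSeq]
    ring

end Bounded

/-- Putting an independent copy in front of an i.i.d. sequence does not change its law. With
`stickMean_consSeq` this gives the distributional fixed-point equation `D = V f(x) + (1 - V) D'`. -/
lemma map_consSeq {E : Type*} [MeasurableSpace E] (μ : Measure E) [IsProbabilityMeasure μ] :
    (μ.prod (Measure.infinitePi fun _ : ℕ => μ)).map consSeq =
      Measure.infinitePi fun _ : ℕ => μ := by
  classical
  refine Measure.eq_infinitePi _ fun s t ht => ?_
  obtain ⟨n, hn⟩ : ∃ n, ∀ i ∈ s, i < n + 1 :=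
    ⟨s.sup id, fun i hi => Nat.lt_succ_of_le (Finset.le_sup (f := id) hi)⟩
  let t' : ℕ → Set E := fun i => if i ∈ s then t i else Set.univ
  have ht' : ∀ i, MeasurableSet (t' i) := fun i => by
    simp only [t']; split_ifs
    · exact ht i
    · exact MeasurableSet.univ
  have h1 : ∏ i ∈ s, μ (t i) = ∏ i ∈ Finset.range (n + 1), μ (t' i) := by
    rw [← Finset.prod_subset (s₁ := s) (fun i hi => Finset.mem_range.2 (hn i hi))]
    · exact Finset.prod_congr rfl fun i hi => by simp [t', hi]
    · intro i _ hi; simp [t', hi]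
  have h2 : consSeq ⁻¹' (Set.pi s t) =
      t' 0 ×ˢ Set.pi (Finset.range n) fun i => t' (i + 1) := by
    ext p
    simp only [Set.mem_preimage, Set.mem_pi, Set.mem_prod, Finset.mem_coe, Finset.mem_range]
    constructor
    · intro h
      refine ⟨?_, fun i _ => ?_⟩
      · simp only [t']; split_ifs with h0
        · exact h 0 h0
        · trivial
      · simp only [t']; split_ifs with h0
        · exact h (i + 1) h0
        · trivial
    · rintro ⟨ha, hb⟩ i hi
      cases i with
      | zero => simpa [t', hi, consSeq] using ha
      | succ i =>
        have := hb i (by have := hn _ hi; omega)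
        simpa [t', hi, consSeq] using this
  have hms : MeasurableSet (Set.pi (s : Set ℕ) t) :=
    MeasurableSet.pi s.countable_toSet fun i _ => ht i
  rw [Measure.map_apply measurable_consSeq hms, h2, Measure.prod_prod,
    Measure.infinitePi_pi _ (fun i _ => ht' (i + 1)), h1, Finset.prod_range_succ', mul_comm]

/-- The uniform distribution on the unit interval. -/
noncomputable def uniform : Measure ℝ := volume.restrict (Set.Ioo 0 1)

instance : IsProbabilityMeasure uniform := ⟨by simp [uniform]⟩

/-- The antiderivative is `v / (b (v a + (1 - v) b))`. The exponent 2 with the uniform law makes the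
answer split into a function of `a` and one of `b`. -/
lemma integral_uniform {a b : ℝ} (ha : 0 < a) (hb : 0 < b) :
    ∫ v, ((clip v * a + (1 - clip v) * b) ^ 2)⁻¹ ∂uniform = a⁻¹ * b⁻¹ := by
  have hpos : ∀ v ∈ Set.Icc (0 : ℝ) 1, 0 < v * a + (1 - v) * b := by
    intro v hv
    rcases hv.1.eq_or_lt with rfl | h
    · simpa using hb
    · have := mul_pos h ha
      have := mul_nonneg (sub_nonneg.2 hv.2) hb.le
      linarith
  have h1 : ∫ v, ((clip v * a + (1 - clip v) * b) ^ 2)⁻¹ ∂uniform =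
      ∫ v in (0 : ℝ)..1, ((v * a + (1 - v) * b) ^ 2)⁻¹ := by
    rw [intervalIntegral.integral_of_le zero_le_one, ← integral_Ioc_eq_integral_Ioo.symm, uniform]
    exact setIntegral_congr_fun measurableSet_Ioo fun v hv => by
      simp only [clip_of_mem hv]
  have hd : ∀ v ∈ Set.uIcc (0 : ℝ) 1, HasDerivAt
      (fun v : ℝ => v / (b * (v * a + (1 - v) * b))) (((v * a + (1 - v) * b) ^ 2)⁻¹) v := by
    intro v hv
    rw [Set.uIcc_of_le zero_le_one] at hv
    have hp := hpos v hv
    have hlin : HasDerivAt (fun v : ℝ => b * (v * a + (1 - v) * b)) (b * (1 * a + (-1) * b)) v :=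
      (((hasDerivAt_id v).mul_const a).add
        (((hasDerivAt_id v).const_sub 1).mul_const b)).const_mul b
    refine ((hasDerivAt_id' v).div hlin (mul_pos hb hp).ne').congr_deriv ?_
    field_simp
    ring
  have hc : ContinuousOn (fun v : ℝ => ((v * a + (1 - v) * b) ^ 2)⁻¹) (Set.uIcc 0 1) := by
    refine ContinuousOn.inv₀ (by fun_prop) fun v hv => ?_
    rw [Set.uIcc_of_le zero_le_one] at hv
    exact (pow_pos (hpos v hv) 2).ne'
  rw [h1, intervalIntegral.integral_eq_sub_of_hasDerivAt hd hc.intervalIntegrable]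
  field_simp
  simp

section Derivatives

variable {α : Type*} [MeasurableSpace α] {μ : Measure α} [IsFiniteMeasure μ] {Y : α → ℝ} {B : ℝ}

lemma integrable_inv_add (hY : Measurable Y) (h0 : ∀ x, 0 ≤ Y x) {t : ℝ} (ht : 0 < t) :
    Integrable (fun x => (Y x + t)⁻¹) μ := by
  refine integrable_of_bounded (hY.add_const t).inv (C := t⁻¹) fun x => ?_
  have : 0 < Y x + t := by linarith [h0 x]
  rw [Real.norm_of_nonneg (inv_nonneg.2 this.le)]
  exact inv_anti₀ ht (by linarith [h0 x])

lemma hasDerivAt_integral_inv (hY : Measurable Y) (h0 : ∀ x, 0 ≤ Y x) {t : ℝ} (ht : 0 < t) :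
    HasDerivAt (fun t => ∫ x, (Y x + t)⁻¹ ∂μ) (∫ x, -((Y x + t) ^ 2)⁻¹ ∂μ) t := by
  refine (hasDerivAt_integral_of_dominated_loc_of_deriv_le (s := Set.Ioi (t / 2))
    (bound := fun _ => ((t / 2) ^ 2)⁻¹) (F := fun t x => (Y x + t)⁻¹)
    (F' := fun t x => -((Y x + t) ^ 2)⁻¹) (Ioi_mem_nhds (by linarith))
    (Eventually.of_forall fun s => (hY.add_const s).inv.aestronglyMeasurable)
    (integrable_inv_add hY h0 ht) ((hY.add_const t).pow_const 2).inv.neg.aestronglyMeasurable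
    (ae_of_all _ fun x s hs => ?_) (integrable_const _) (ae_of_all _ fun x s hs => ?_)).2
  · have hs' : t / 2 < s := hs
    have h1 : t / 2 ≤ Y x + s := by linarith [h0 x]
    rw [norm_neg, Real.norm_of_nonneg (by positivity)]
    exact inv_anti₀ (by positivity) (pow_le_pow_left₀ (by positivity) h1 2)
  · have hs' : t / 2 < s := hs
    have h1 : 0 < Y x + s := by linarith [h0 x]
    refine (((hasDerivAt_id' s).const_add (Y x)).inv h1.ne').congr_deriv ?_
    rw [neg_div, one_div]

lemma hasDerivAt_integral_log (hY : Measurable Y) (h0 : ∀ x, 0 ≤ Y x) (hB : ∀ x, Y x ≤ B) {t : ℝ}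
    (ht : 0 < t) :
    HasDerivAt (fun t => ∫ x, Real.log (Y x + t) ∂μ) (∫ x, (Y x + t)⁻¹ ∂μ) t := by
  refine (hasDerivAt_integral_of_dominated_loc_of_deriv_le (s := Set.Ioi (t / 2))
    (bound := fun _ => (t / 2)⁻¹) (F := fun t x => Real.log (Y x + t))
    (F' := fun t x => (Y x + t)⁻¹) (Ioi_mem_nhds (by linarith))
    (Eventually.of_forall fun s => (hY.add_const s).log.aestronglyMeasurable)
    (integrable_log (hY.add_const t) ht (fun x => by linarith [h0 x]) (B := B + t)
      (fun x => by linarith [hB x])) (hY.add_const t).inv.aestronglyMeasurable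
    (ae_of_all _ fun x s hs => ?_) (integrable_const _) (ae_of_all _ fun x s hs => ?_)).2
  · have hs' : t / 2 < s := hs
    have h1 : t / 2 ≤ Y x + s := by linarith [h0 x]
    rw [Real.norm_of_nonneg (inv_nonneg.2 (by linarith))]
    exact inv_anti₀ (by positivity) h1
  · have hs' : t / 2 < s := hs
    have h1 : 0 < Y x + s := by linarith [h0 x]
    refine (((hasDerivAt_id' s).const_add (Y x)).log h1.ne').congr_deriv ?_
    rw [one_div]

end Derivatives

variable [MeasurableSpace X] (m : Measure X) [IsProbabilityMeasure m]

/-- The law of the sequence of breaks and locations. -/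
noncomputable def stickLaw : Measure (ℕ → ℝ × X) := Measure.infinitePi fun _ => uniform.prod m

instance : IsProbabilityMeasure (stickLaw m) := by unfold stickLaw; infer_instance

variable {m} {f : X → ℝ} {B : ℝ}

/-- By the fixed-point equation the shifted mean is `V (f(x) + t) + (1 - V)(D' + t)`. Integrating
over the uniform `V` separates `x` from `D'`. The result is the differential equation of the
Markov–Krein identity. -/
lemma integral_stick_sq (hf : Measurable f) (h0 : ∀ x, 0 ≤ f x) (hB : ∀ x, f x ≤ B) {t : ℝ}
    (ht : 0 < t) :
    ∫ ω, ((stickMean f ω + t) ^ 2)⁻¹ ∂(stickLaw m) =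
      (∫ x, (f x + t)⁻¹ ∂m) * ∫ ω, (stickMean f ω + t)⁻¹ ∂(stickLaw m) := by
  have hD := measurable_stickMean hf h0 hB
  let H : (ℝ × X) × (ℕ → ℝ × X) → ℝ := fun p =>
    ((clip p.1.1 * (f p.1.2 + t) + (1 - clip p.1.1) * (stickMean f p.2 + t)) ^ 2)⁻¹
  have hc1 : Measurable fun p : (ℝ × X) × (ℕ → ℝ × X) => clip p.1.1 :=
    measurable_clip.comp (measurable_fst.comp measurable_fst)
  have hc2 : Measurable fun p : (ℝ × X) × (ℕ → ℝ × X) => f p.1.2 + t :=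
    (hf.comp (measurable_snd.comp measurable_fst)).add_const t
  have hc3 : Measurable fun p : (ℝ × X) × (ℕ → ℝ × X) => stickMean f p.2 + t :=
    (hD.comp measurable_snd).add_const t
  have hH : Measurable H :=
    (((hc1.mul hc2).add ((measurable_const.sub hc1).mul hc3)).pow_const 2).inv
  have hHb : ∀ p, ‖H p‖ ≤ (t ^ 2)⁻¹ := by
    intro p
    have h1 := clip_mem p.1.1
    have h2 := h0 p.1.2
    have h3 := stickMean_nonneg h0 p.2
    have h4 : t ≤ clip p.1.1 * (f p.1.2 + t) + (1 - clip p.1.1) * (stickMean f p.2 + t) := by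
      have := mul_nonneg h1.1.le h2
      have := mul_nonneg (sub_nonneg.2 h1.2.le) h3
      nlinarith
    rw [Real.norm_of_nonneg (by positivity)]
    exact inv_anti₀ (by positivity) (pow_le_pow_left₀ ht.le h4 2)
  have hHi : Integrable H ((uniform.prod m).prod (stickLaw m)) := integrable_of_bounded hH hHb
  calc ∫ ω, ((stickMean f ω + t) ^ 2)⁻¹ ∂(stickLaw m)
      = ∫ p, H p ∂((uniform.prod m).prod (stickLaw m)) := by
        have hmap := map_consSeq (uniform.prod m)
        rw [← stickLaw] at hmap
        conv_lhs => rw [← hmap]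
        rw [integral_map (f := fun ω => ((stickMean f ω + t) ^ 2)⁻¹)
          measurable_consSeq.aemeasurable
          ((hD.add_const t).pow_const 2).inv.aestronglyMeasurable]
        congr 1
        funext p
        rw [stickMean_consSeq h0 hB]
        simp only [H]
        congr 2
        ring
    _ = ∫ ω, ∫ q, H (q, ω) ∂(uniform.prod m) ∂(stickLaw m) := integral_prod_symm _ hHi
    _ = ∫ ω, (∫ x, (f x + t)⁻¹ ∂m) * (stickMean f ω + t)⁻¹ ∂(stickLaw m) := by
        congr 1
        funext ω
        have hi : Integrable (fun q => H (q, ω)) (uniform.prod m) :=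
          integrable_of_bounded (hH.comp measurable_prodMk_right) fun q => hHb (q, ω)
        rw [integral_prod_symm _ hi, ← integral_mul_const]
        congr 1
        funext x
        have h1 : 0 < f x + t := by linarith [h0 x]
        have h2 : 0 < stickMean f ω + t := by linarith [stickMean_nonneg h0 ω]
        exact integral_uniform h1 h2
    _ = _ := integral_const_mul _ _

/-- The Markov–Krein identity for the stick-breaking random measure. -/
theorem integral_inv_stickMean (hf : Measurable f) (h0 : ∀ x, 0 ≤ f x) (hB : ∀ x, f x ≤ B) {t : ℝ}
    (ht : 0 < t) :
    ∫ ω, (stickMean f ω + t)⁻¹ ∂(stickLaw m) = Real.exp (-∫ x, Real.log (f x + t) ∂m) := by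
  have hD := measurable_stickMean hf h0 hB
  have hD0 := stickMean_nonneg h0
  obtain ⟨x₀⟩ : Nonempty X := nonempty_of_isProbabilityMeasure m
  have hB0 : 0 ≤ B := (h0 x₀).trans (hB x₀)
  let K : ℝ → ℝ := fun t => ∫ ω, (stickMean f ω + t)⁻¹ ∂(stickLaw m)
  let M : ℝ → ℝ := fun t => ∫ x, Real.log (f x + t) ∂m
  -- `K' = -M' K` by `integral_stick_sq`, so `K exp M` is constant; the constant is found from the
  -- limit at infinity.
  have hderiv : ∀ s ∈ Set.Ioi (0 : ℝ), HasDerivAt (fun s => K s * Real.exp (M s)) 0 s := by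
    intro s hs
    have h1 := hasDerivAt_integral_inv (μ := stickLaw m) hD hD0 hs
    have h2 := (hasDerivAt_integral_log (μ := m) hf h0 hB hs).exp
    rw [integral_neg, integral_stick_sq hf h0 hB hs] at h1
    refine (h1.mul h2).congr_deriv ?_
    ring
  obtain ⟨a, ha⟩ := isOpen_Ioi.exists_is_const_of_deriv_eq_zero isPreconnected_Ioi
    (fun s hs => (hderiv s hs).differentiableAt.differentiableWithinAt)
    (fun s hs => (hderiv s hs).deriv)
  have hlogi : ∀ s, 0 < s → Integrable (fun x => Real.log (f x + s)) m := fun s hs =>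
    integrable_log (hf.add_const s) hs (fun x => by linarith [h0 x]) (B := B + s)
      (fun x => by linarith [hB x])
  -- Since `f` and its stick-breaking mean both lie in `[0, B]`, the constant is squeezed between `s
  -- / (B + s)` and `(B + s) / s`.
  have hupper : ∀ s, 0 < s → a ≤ (B + s) / s := by
    intro s hs
    rw [← ha s hs, div_eq_inv_mul]
    have hk : K s ≤ s⁻¹ := by
      have := integral_mono (μ := stickLaw m) (integrable_inv_add hD hD0 hs)
        (integrable_const s⁻¹) fun ω => inv_anti₀ hs (by linarith [hD0 ω])
      simpa using this
    have hm : Real.exp (M s) ≤ B + s := by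
      rw [← Real.exp_log (show 0 < B + s by linarith), Real.exp_le_exp]
      have := integral_mono (μ := m) (hlogi s hs) (integrable_const (Real.log (B + s)))
        fun x => Real.log_le_log (by linarith [h0 x]) (by linarith [hB x])
      simpa using this
    exact mul_le_mul hk hm (Real.exp_pos _).le (inv_nonneg.2 hs.le)
  have hlower : ∀ s, 0 < s → s / (B + s) ≤ a := by
    intro s hs
    have hBs : 0 < B + s := by linarith
    rw [← ha s hs, div_eq_inv_mul]
    have hk : (B + s)⁻¹ ≤ K s := by
      have := integral_mono (μ := stickLaw m) (integrable_const (B + s)⁻¹)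
        (integrable_inv_add hD hD0 hs) fun ω => inv_anti₀ (by linarith [hD0 ω])
        (by linarith [stickMean_le h0 hB ω])
      simpa using this
    have hm : s ≤ Real.exp (M s) := by
      conv_lhs => rw [← Real.exp_log hs]
      rw [Real.exp_le_exp]
      have := integral_mono (μ := m) (integrable_const (Real.log s)) (hlogi s hs)
        fun x => Real.log_le_log hs (by linarith [h0 x])
      simpa using this
    exact mul_le_mul hk hm hs.le ((inv_nonneg.2 hBs.le).trans hk)
  have hlim : Tendsto (fun s : ℝ => (B + s) / s) atTop (𝓝 1) := by
    have h1 : Tendsto (fun s : ℝ => B / s + 1) atTop (𝓝 (0 + 1)) :=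
      (tendsto_const_nhds.div_atTop tendsto_id).add_const 1
    rw [zero_add] at h1
    refine h1.congr' ?_
    filter_upwards [eventually_gt_atTop 0] with s hs
    rw [add_div, div_self hs.ne']
  have hlim2 : Tendsto (fun s : ℝ => s / (B + s)) atTop (𝓝 1) := by
    have := hlim.inv₀ one_ne_zero
    simpa using this
  have ha1 : a = 1 := le_antisymm
    (ge_of_tendsto hlim (by filter_upwards [eventually_gt_atTop 0] with s hs using hupper s hs))
    (le_of_tendsto hlim2 (by filter_upwards [eventually_gt_atTop 0] with s hs using hlower s hs))
  have := ha t ht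
  rw [ha1] at this
  rw [Real.exp_neg]
  exact eq_inv_of_mul_eq_one_left this

end StickBreaking

/-! ### The Lebesgue measure as a mixture over the total mass parameter -/

section Existence

variable {X : Type*} [MeasurableSpace X]

/-- The element of the cone with total mass parameter `s` and given breaks and locations. -/
noncomputable def stickCone (p : ℝ × (ℕ → ℝ × X)) : Cone X :=
  -- The value 1 for a nonpositive parameter only keeps the weights positive; `lebesgueCone` gives
  -- no mass to such parameters.
  ⟨Measure.sum fun k => ENNReal.ofReal ((if 0 < p.1 then p.1 else 1) * stick p.2 k) •
      Measure.dirac (p.2 k).2,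
    fun k => (if 0 < p.1 then p.1 else 1) * stick p.2 k, fun k => (p.2 k).2,
    fun k => mul_pos (by split_ifs with h; exacts [h, one_pos]) (stick_pos _ k),
    (summable_stick p.2).mul_left _, rfl⟩

lemma measurable_stickCone : Measurable (stickCone : ℝ × (ℕ → ℝ × X) → Cone X) := by
  refine Measurable.subtype_mk (Measure.measurable_of_measurable_coe _ fun A hA => ?_)
  simp only [Measure.sum_apply _ hA, Measure.smul_apply, Measure.dirac_apply' _ hA, smul_eq_mul]
  refine Measurable.tsum fun k => ?_
  have h1 : Measurable fun p : ℝ × (ℕ → ℝ × X) => if 0 < p.1 then p.1 else 1 :=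
    Measurable.ite (measurableSet_lt measurable_const measurable_fst) measurable_fst
      measurable_const
  have h2 : Measurable fun p : ℝ × (ℕ → ℝ × X) => (p.2 k).2 :=
    measurable_snd.comp ((measurable_pi_apply k).comp measurable_snd)
  exact (h1.mul ((measurable_stick k).comp measurable_snd)).ennreal_ofReal.mul
    ((measurable_one.indicator hA).comp h2)

lemma lintegral_stickCone {f : X → ℝ} {B : ℝ} (hf : Measurable f) (h0 : ∀ x, 0 ≤ f x)
    (hB : ∀ x, f x ≤ B) {s : ℝ} (hs : 0 < s) (ω : ℕ → ℝ × X) :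
    ∫⁻ x, ENNReal.ofReal (f x) ∂(stickCone (s, ω)).1 = ENNReal.ofReal (s * stickMean f ω) := by
  simp only [stickCone, if_pos hs]
  rw [lintegral_sum_measure, stickMean, ← tsum_mul_left, ENNReal.ofReal_tsum_of_nonneg
    (fun k => mul_nonneg hs.le (mul_nonneg (stick_pos ω k).le (h0 _)))
    ((summable_stickMean h0 hB ω).mul_left s)]
  refine tsum_congr fun k => ?_
  rw [lintegral_smul_measure, lintegral_dirac' _ hf.ennreal_ofReal, smul_eq_mul,
    ← ENNReal.ofReal_mul (mul_nonneg hs.le (stick_pos ω k).le), mul_assoc]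

lemma lintegral_exp_neg_mul {d : ℝ} (hd : 0 ≤ d) :
    ∫⁻ s in Set.Ioi (0 : ℝ), ENNReal.ofReal (Real.exp (-(s * d))) = (ENNReal.ofReal d)⁻¹ := by
  rcases hd.eq_or_lt with rfl | hd
  · simp
  · have e : ∀ s : ℝ, -(s * d) = (-d) * s := fun s => by ring
    simp only [e]
    rw [← ofReal_integral_eq_lintegral_ofReal (integrableOn_exp_mul_Ioi (neg_lt_zero.2 hd) 0)
      (ae_of_all _ fun _ => (Real.exp_pos _).le), integral_exp_mul_Ioi (neg_lt_zero.2 hd),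
      ← ENNReal.ofReal_inv_of_pos hd]
    congr 1
    simp

/-- The infinite-dimensional Lebesgue measure, built by stick breaking. -/
noncomputable def lebesgueCone (m : Measure X) : Measure (Cone X) :=
  ((volume.restrict (Set.Ioi (0 : ℝ))).prod (stickLaw m)).map stickCone

lemma measurable_exp_neg_lintegral {f : X → ℝ} (hf : Measurable f) :
    Measurable fun ξ : Cone X =>
      EReal.exp (-((∫⁻ x, ENNReal.ofReal (f x) ∂ξ.1 : ℝ≥0∞) : EReal)) :=
  (((Measure.measurable_lintegral hf.ennreal_ofReal).comp
    measurable_subtype_coe).coe_ereal_ennreal.neg).ereal_exp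

lemma tendsto_exp_neg_coe {a : ℕ → ℝ≥0∞} {b : ℝ≥0∞} (h : Tendsto a atTop (𝓝 b)) :
    Tendsto (fun n => EReal.exp (-((a n : ℝ≥0∞) : EReal))) atTop (𝓝 (EReal.exp (-(b : EReal)))) :=
  (ENNReal.continuous_exp.tendsto _).comp
    ((continuous_neg.tendsto _).comp ((continuous_coe_ennreal_ereal.tendsto b).comp h))

variable {m : Measure X} [IsProbabilityMeasure m]

/-- Integrating out the mass parameter turns the exponential into `1 / D(f)`. The Markov–Krein
identity is then taken to the limit `t → 0`, monotonically on the left and by domination with `|log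
f| + |log (B + 1)|` on the right. -/
lemma lintegral_lebesgueCone_of_bounded {f : X → ℝ} {B : ℝ} (hf : Measurable f)
    (h0 : ∀ x, 0 ≤ f x) (hB : ∀ x, f x ≤ B) (hpos : ∀ᵐ x ∂m, 0 < f x)
    (hlog : Integrable (fun x => Real.log (f x)) m) :
    ∫⁻ ξ : Cone X, EReal.exp (-((∫⁻ x, ENNReal.ofReal (f x) ∂ξ.1 : ℝ≥0∞) : EReal))
      ∂(lebesgueCone m) = ENNReal.ofReal (Real.exp (-∫ x, Real.log (f x) ∂m)) := by
  have hD := measurable_stickMean hf h0 hB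
  have hD0 := stickMean_nonneg h0
  have hmeas := measurable_exp_neg_lintegral hf
  have h1 : ∫⁻ ξ : Cone X, EReal.exp (-((∫⁻ x, ENNReal.ofReal (f x) ∂ξ.1 : ℝ≥0∞) : EReal))
      ∂(lebesgueCone m) = ∫⁻ ω, (ENNReal.ofReal (stickMean f ω))⁻¹ ∂(stickLaw m) := by
    rw [lebesgueCone, lintegral_map hmeas measurable_stickCone]
    refine (lintegral_prod_symm' _ (hmeas.comp measurable_stickCone)).trans ?_
    refine lintegral_congr fun ω => ?_
    rw [← lintegral_exp_neg_mul (hD0 ω)]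
    refine setLIntegral_congr_fun measurableSet_Ioi fun s (hs : 0 < s) => ?_
    simp only [Function.comp]
    rw [lintegral_stickCone hf h0 hB hs, exp_neg_coe_ofReal (mul_nonneg hs.le (hD0 ω))]
  let t : ℕ → ℝ := fun n => 1 / ((n : ℝ) + 1)
  have ht : ∀ n, 0 < t n := fun n => by positivity
  have ht1 : ∀ n, t n ≤ 1 := fun n => by
    simp only [t]
    rw [div_le_one (by positivity)]
    linarith [Nat.cast_nonneg (α := ℝ) n]
  have htlim : Tendsto t atTop (𝓝 0) := tendsto_one_div_add_atTop_nhds_zero_nat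
  have htanti : Antitone t := fun a b hab => by
    have : (a : ℝ) ≤ b := by exact_mod_cast hab
    exact one_div_le_one_div_of_le (by positivity) (by linarith)
  have h2 : ∀ n, ∫⁻ ω, (ENNReal.ofReal (stickMean f ω + t n))⁻¹ ∂(stickLaw m) =
      ENNReal.ofReal (Real.exp (-∫ x, Real.log (f x + t n) ∂m)) := by
    intro n
    rw [← integral_inv_stickMean hf h0 hB (ht n),
      ofReal_integral_eq_lintegral_ofReal (integrable_inv_add hD hD0 (ht n))
        (ae_of_all _ fun ω => inv_nonneg.2 (add_nonneg (hD0 ω) (ht n).le))]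
    exact lintegral_congr fun ω =>
      (ENNReal.ofReal_inv_of_pos (add_pos_of_nonneg_of_pos (hD0 ω) (ht n))).symm
  have h3 : Tendsto (fun n => ∫⁻ ω, (ENNReal.ofReal (stickMean f ω + t n))⁻¹ ∂(stickLaw m)) atTop
      (𝓝 (∫⁻ ω, (ENNReal.ofReal (stickMean f ω))⁻¹ ∂(stickLaw m))) := by
    refine lintegral_tendsto_of_tendsto_of_monotone
      (fun n => (hD.add_const _).ennreal_ofReal.inv.aemeasurable)
      (ae_of_all _ fun ω a b hab => ?_) (ae_of_all _ fun ω => ?_)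
    · exact ENNReal.inv_le_inv.2 (ENNReal.ofReal_le_ofReal (by linarith [htanti hab]))
    · have := (tendsto_const_nhds (x := stickMean f ω)).add htlim
      rw [add_zero] at this
      exact ((ENNReal.continuous_ofReal.tendsto _).comp this).inv
  have h4 : Tendsto (fun n => ∫ x, Real.log (f x + t n) ∂m) atTop
      (𝓝 (∫ x, Real.log (f x) ∂m)) := by
    refine tendsto_integral_of_dominated_convergence
      (fun x => |Real.log (f x)| + |Real.log (B + 1)|)
      (fun n => (hf.add_const _).log.aestronglyMeasurable)
      (hlog.abs.add (integrable_const _)) (fun n => ?_) ?_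
    · filter_upwards [hpos] with x hx
      refine (abs_le_max_abs_abs (Real.log_le_log hx (by linarith [ht n]))
        (Real.log_le_log (by linarith [ht n])
          (by linarith [hB x, ht1 n] : f x + t n ≤ B + 1))).trans ?_
      exact max_le_add_of_nonneg (abs_nonneg _) (abs_nonneg _)
    · filter_upwards [hpos] with x hx
      have := (tendsto_const_nhds (x := f x)).add htlim
      rw [add_zero] at this
      exact this.log hx.ne'
  rw [h1]
  refine tendsto_nhds_unique h3 ?_
  simp only [h2]
  exact (ENNReal.continuous_ofReal.tendsto _).comp h4.neg.rexp

/-- Existence of the infinite-dimensional Lebesgue measure. -/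
theorem isLebesgueMeasure_lebesgueCone : IsLebesgueMeasure m (lebesgueCone m) := by
  intro f hf h0 hpos hlog
  -- Truncating at `n + 1 ≥ 1` ensures `|log (g n)| ≤ |log f|` almost everywhere, which is the
  -- domination needed for the limit.
  let g : ℕ → X → ℝ := fun n x => min (f x) (n + 1)
  have hg : ∀ n, Measurable (g n) := fun n => hf.min measurable_const
  have hg0 : ∀ n x, 0 ≤ g n x := fun n x => le_min (h0 x) (by positivity)
  have hgmono : ∀ x, Monotone fun n => g n x := fun x a b hab =>
    min_le_min_left _ (by have : (a : ℝ) ≤ b := by exact_mod_cast hab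
                          linarith)
  have hgpos : ∀ n, ∀ᵐ x ∂m, 0 < g n x := fun n => by
    filter_upwards [hpos] with x hx using lt_min hx (by positivity)
  have hgev : ∀ x, ∀ᶠ n : ℕ in atTop, g n x = f x := fun x => by
    obtain ⟨N, hN⟩ := exists_nat_ge (f x)
    filter_upwards [eventually_ge_atTop N] with n hn
    have : (N : ℝ) ≤ n := by exact_mod_cast hn
    exact min_eq_left (by linarith)
  have hgbd : ∀ n, ∀ᵐ x ∂m, ‖Real.log (g n x)‖ ≤ |Real.log (f x)| := fun n => by
    filter_upwards [hpos] with x hx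
    rw [Real.norm_eq_abs]
    rcases le_total (f x) (n + 1) with h | h
    · simp only [g, min_eq_left h, le_refl]
    · have h1 : (1 : ℝ) ≤ n + 1 := by linarith [Nat.cast_nonneg (α := ℝ) n]
      simp only [g, min_eq_right h]
      rw [abs_of_nonneg (Real.log_nonneg h1)]
      exact (Real.log_le_log (by positivity) h).trans (le_abs_self _)
  have hglog : ∀ n, Integrable (fun x => Real.log (g n x)) m := fun n =>
    hlog.abs.mono' (hg n).log.aestronglyMeasurable (hgbd n)
  have h1 := fun n => lintegral_lebesgueCone_of_bounded (hg n) (hg0 n)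
    (fun x => min_le_right _ _) (hgpos n) (hglog n)
  have h2 : Tendsto (fun n => ∫ x, Real.log (g n x) ∂m) atTop (𝓝 (∫ x, Real.log (f x) ∂m)) :=
    tendsto_integral_of_dominated_convergence _ (fun n => (hg n).log.aestronglyMeasurable)
      hlog.abs hgbd (ae_of_all _ fun x =>
        tendsto_const_nhds.congr' ((hgev x).mono fun n hn => by simp only [hn]))
  have h3 : Tendsto (fun n => ∫⁻ ξ : Cone X,
      EReal.exp (-((∫⁻ x, ENNReal.ofReal (g n x) ∂ξ.1 : ℝ≥0∞) : EReal)) ∂(lebesgueCone m)) atTop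
      (𝓝 (∫⁻ ξ : Cone X, EReal.exp (-((∫⁻ x, ENNReal.ofReal (f x) ∂ξ.1 : ℝ≥0∞) : EReal))
        ∂(lebesgueCone m))) := by
    refine lintegral_tendsto_of_tendsto_of_antitone
      (fun n => (measurable_exp_neg_lintegral (hg n)).aemeasurable)
      (ae_of_all _ fun ξ a b hab => ?_) (by rw [h1]; exact ENNReal.ofReal_ne_top)
      (ae_of_all _ fun ξ => ?_)
    · refine EReal.exp_monotone (EReal.neg_le_neg_iff.2 (EReal.coe_ennreal_le_coe_ennreal_iff.2 ?_))
      exact lintegral_mono fun x => ENNReal.ofReal_le_ofReal (hgmono x hab)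
    · refine tendsto_exp_neg_coe (lintegral_tendsto_of_tendsto_of_monotone
        (fun n => (hg n).ennreal_ofReal.aemeasurable)
        (ae_of_all _ fun x a b hab => ENNReal.ofReal_le_ofReal (hgmono x hab))
        (ae_of_all _ fun x => ?_))
      exact tendsto_const_nhds.congr' ((hgev x).mono fun n hn => by simp only [hn])
  refine tendsto_nhds_unique h3 ?_
  simp only [h1]
  exact (ENNReal.continuous_ofReal.tendsto _).comp h2.neg.rexp

end Existence

/-! ### The cocycle -/

section Cocycle

/-- The denominator `β z + α` of the action. -/
noncomputable def den (g : SL2) (z : UpperHalfPlane) : ℂ := (g 0 1 : ℝ) * (z : ℂ) + (g 0 0 : ℝ)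

lemma det_eq (g : SL2) : g 0 0 * g 1 1 - g 0 1 * g 1 0 = 1 := by
  have h := g.det_coe
  rwa [Matrix.det_fin_two] at h

lemma den_im (g : SL2) (z : UpperHalfPlane) : (den g z).im = g 0 1 * z.im := by
  simp [den]

lemma den_re (g : SL2) (z : UpperHalfPlane) : (den g z).re = g 0 1 * z.re + g 0 0 := by
  simp [den]

lemma den_ne_zero (g : SL2) (z : UpperHalfPlane) : den g z ≠ 0 := by
  intro h
  have h1 := den_im g z
  have h2 := den_re g z
  rw [h] at h1 h2
  have h3 : g 0 1 = 0 := by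
    rcases mul_eq_zero.1 h1.symm with h3 | h3
    · exact h3
    · exact absurd h3 z.im_pos.ne'
  have h4 : g 0 0 = 0 := by simpa [h3] using h2.symm
  have := det_eq g
  simp [h3, h4] at this

lemma act_coe (g : SL2) (z : UpperHalfPlane) :
    ((act g z : UpperHalfPlane) : ℂ) = ((g 1 1 : ℝ) * (z : ℂ) + (g 1 0 : ℝ)) / den g z := rfl

lemma act_sub_star (g : SL2) (z₁ z₂ : UpperHalfPlane) :
    ((act g z₁ : ℂ) - star (act g z₂ : ℂ)) * (den g z₁ * star (den g z₂)) =
      (z₁ : ℂ) - star (z₂ : ℂ) := by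
  have h1 := den_ne_zero g z₁
  have h2 : star (den g z₂) ≠ 0 := star_ne_zero.2 (den_ne_zero g z₂)
  have hd : ((g 0 0 : ℝ) : ℂ) * (g 1 1 : ℝ) - (g 0 1 : ℝ) * (g 1 0 : ℝ) = 1 := by
    exact_mod_cast det_eq g
  have hs : star (den g z₂) = (g 0 1 : ℝ) * star (z₂ : ℂ) + (g 0 0 : ℝ) := by
    simp [den]
  have hn : star (act g z₂ : ℂ) = ((g 1 1 : ℝ) * star (z₂ : ℂ) + (g 1 0 : ℝ)) / star (den g z₂) := by
    rw [act_coe, star_div₀]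
    simp
  rw [hn, act_coe, div_sub_div _ _ h1 h2, div_mul_cancel₀ _ (mul_ne_zero h1 h2), hs, den]
  linear_combination ((z₁ : ℂ) - star (z₂ : ℂ)) * hd

lemma re_pos_of_sub (z₁ z₂ : UpperHalfPlane) :
    0 < (-Complex.I * ((z₁ : ℂ) - star (z₂ : ℂ))).re := by
  have h1 := z₁.im_pos
  have h2 := z₂.im_pos
  simp
  linarith

/-- Exponentiated, this is `act_sub_star`. The two sides could differ by a multiple `2πn` of the
imaginary unit, and size bounds on the imaginary parts force `n = 0`. -/
lemma c_act (g : SL2) (z₁ z₂ : UpperHalfPlane) :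
    c (act g z₁) (act g z₂) =
      c z₁ z₂ - (Complex.log (den g z₁) + star (Complex.log (den g z₂))) := by
  have hA := re_pos_of_sub z₁ z₂
  have hA' := re_pos_of_sub (act g z₁) (act g z₂)
  have hA0 : -Complex.I * ((z₁ : ℂ) - star (z₂ : ℂ)) ≠ 0 := fun h => by
    rw [h] at hA
    exact lt_irrefl _ hA
  have hA0' : -Complex.I * ((act g z₁ : ℂ) - star (act g z₂ : ℂ)) ≠ 0 := fun h => by
    rw [h] at hA'
    exact lt_irrefl _ hA'
  have hstar : Complex.exp (star (Complex.log (den g z₂))) = star (den g z₂) := by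
    have := Complex.exp_conj (Complex.log (den g z₂))
    rw [Complex.exp_log (den_ne_zero g z₂)] at this
    exact this
  have hexp : Complex.exp (c (act g z₁) (act g z₂) +
      (Complex.log (den g z₁) + star (Complex.log (den g z₂)))) = Complex.exp (c z₁ z₂) := by
    rw [Complex.exp_add, Complex.exp_add, c, c, Complex.exp_log hA0, Complex.exp_log hA0',
      Complex.exp_log (den_ne_zero g z₁), hstar, mul_assoc, act_sub_star]
  obtain ⟨n, hn⟩ := Complex.exp_eq_exp_iff_exists_int.1 hexp
  have him := congrArg Complex.im hn
  have hb1 : |(c z₁ z₂).im| < Real.pi / 2 := by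
    rw [c, Complex.log_im]
    exact Complex.abs_arg_lt_pi_div_two_iff.2 (Or.inl hA)
  have hb2 : |(c (act g z₁) (act g z₂)).im| < Real.pi / 2 := by
    rw [c, Complex.log_im]
    exact Complex.abs_arg_lt_pi_div_two_iff.2 (Or.inl hA')
  -- Both denominators lie in the same open half-plane according to the sign of `β`, or coincide if
  -- `β = 0`. The total discrepancy is thus below `π/2 + π/2 + π`.
  have hb3 : |(den g z₁).arg - (den g z₂).arg| < Real.pi := by
    have hz1 := z₁.im_pos
    have hz2 := z₂.im_pos
    rcases lt_trichotomy (g 0 1) 0 with h | h | h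
    · have i1 : (den g z₁).im < 0 := by rw [den_im]; exact mul_neg_of_neg_of_pos h hz1
      have i2 : (den g z₂).im < 0 := by rw [den_im]; exact mul_neg_of_neg_of_pos h hz2
      have a1 := Complex.arg_neg_iff.2 i1
      have a2 := Complex.arg_neg_iff.2 i2
      have a3 := Complex.neg_pi_lt_arg (den g z₁)
      have a4 := Complex.neg_pi_lt_arg (den g z₂)
      rw [abs_lt]; constructor <;> linarith
    · have : den g z₁ = den g z₂ := by simp [den, h]
      rw [this, sub_self, abs_zero]
      exact Real.pi_pos
    · have i1 : 0 < (den g z₁).im := by rw [den_im]; exact mul_pos h hz1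
      have i2 : 0 < (den g z₂).im := by rw [den_im]; exact mul_pos h hz2
      have a1 := Complex.arg_nonneg_iff.2 i1.le
      have a2 := Complex.arg_nonneg_iff.2 i2.le
      have a3 := Complex.arg_lt_pi_iff.2 (Or.inr i1.ne')
      have a4 := Complex.arg_lt_pi_iff.2 (Or.inr i2.ne')
      rw [abs_lt]; constructor <;> linarith
  have him' : (c (act g z₁) (act g z₂)).im + ((den g z₁).arg - (den g z₂).arg) =
      (c z₁ z₂).im + n * (2 * Real.pi) := by
    simpa [Complex.log_im, sub_eq_add_neg] using him
  have hn0 : n = 0 := by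
    rw [abs_lt] at hb1 hb2 hb3
    have hpi := Real.pi_pos
    have u1 : (n : ℝ) < 1 := by
      by_contra hcon
      push Not at hcon
      nlinarith
    have u2 : (-1 : ℝ) < n := by
      by_contra hcon
      push Not at hcon
      nlinarith
    have u1' : n < 1 := by exact_mod_cast u1
    have u2' : -1 < n := by exact_mod_cast u2
    omega
  rw [hn0] at hn
  simp only [Int.cast_zero, zero_mul, add_zero] at hn
  rw [← hn]
  ring

lemma u_plus_eq (g : SL2) (z : UpperHalfPlane) :
    u .plus g z = -Complex.log (den g z) + (1 / 2) * (Complex.log (den g UpperHalfPlane.I) -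
      star (Complex.log (den g UpperHalfPlane.I))) := by
  simp only [u, Sgn.conj, c_act]
  ring

/-- In `u_plus_eq` the term coming from the base point is purely imaginary and independent of `z`,
so it cancels against its conjugate; the logarithms of the denominators are those of `c_act`. -/
lemma u_add_star (g : SL2) (z₁ z₂ : UpperHalfPlane) :
    u .plus g z₁ + star (u .plus g z₂) = c (act g z₁) (act g z₂) - c z₁ z₂ := by
  rw [u_plus_eq, u_plus_eq, c_act]
  simp only [star_add, star_neg, star_mul', star_sub, star_star, star_div₀, star_one, star_ofNat]
  ring

lemma flip_mul (g h : SL2) : flip (g * h) = flip g * flip h := by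
  refine Subtype.ext ?_
  rw [Matrix.SpecialLinearGroup.coe_mul]
  ext i j
  fin_cases i <;> fin_cases j <;> simp [flip, Matrix.mul_apply, Fin.sum_univ_two, add_comm]

lemma flip_one : flip 1 = 1 := by
  ext i j
  fin_cases i <;> fin_cases j <;> simp [flip]

lemma act_mul (g h : SL2) (z : UpperHalfPlane) : act (g * h) z = act g (act h z) := by
  rw [act_eq, act_eq, act_eq, flip_mul, mul_smul]

lemma act_one (z : UpperHalfPlane) : act 1 z = z := by
  rw [act_eq, flip_one, one_smul]

lemma u_one (s : Sgn) (z : UpperHalfPlane) : u s 1 z = 0 := by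
  have : u .plus 1 z = 0 := by rw [u_plus_eq]; simp [den]
  have h : u s 1 z = s.conj (u .plus 1 z) := rfl
  rw [h, this]
  cases s <;> simp [Sgn.conj]

lemma im_act (g : SL2) (z : UpperHalfPlane) : (act g z).im * ‖den g z‖ ^ 2 = z.im := by
  have h := congrArg Complex.im (act_sub_star g z z)
  have h2 : den g z * star (den g z) = ((‖den g z‖ ^ 2 : ℝ) : ℂ) := by
    have := Complex.mul_conj' (den g z)
    rw [Complex.ofReal_pow]
    exact this
  rw [h2] at h
  simp only [Complex.mul_im, Complex.ofReal_re, Complex.ofReal_im, mul_zero,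
    Complex.sub_im, Complex.star_def, Complex.conj_im, UpperHalfPlane.coe_im, zero_add] at h
  linarith

/-- The denominator is the constant `ε⁻¹`, possibly negative; the base-point term removes exactly
its argument. The real logarithm on the right is `log |ε|`. -/
lemma u_parabolic (g : SL2) (hg : g 0 1 = 0) (z : UpperHalfPlane) :
    u .plus g z = (Real.log (g 1 1) : ℝ) := by
  have hd := det_eq g
  rw [hg] at hd
  have h1 : g 0 0 = (g 1 1)⁻¹ := eq_inv_of_mul_eq_one_left (by linarith)
  have h2 : ∀ z, den g z = ((g 1 1)⁻¹ : ℝ) := fun z => by simp [den, hg, h1]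
  rw [u_plus_eq, h2, h2]
  apply Complex.ext
  · simp [Complex.log_re]
  · simp
    ring

lemma act_parabolic (g : SL2) (hg : g 0 1 = 0) (z : UpperHalfPlane) :
    (act g z : ℂ) = (g 1 1 : ℝ) ^ 2 * (z : ℂ) + (g 1 1 : ℝ) * (g 1 0 : ℝ) := by
  have hd := det_eq g
  rw [hg] at hd
  have h0 : g 1 1 ≠ 0 := fun h => by simp [h] at hd
  have h0' : ((g 1 1 : ℝ) : ℂ) ≠ 0 := by exact_mod_cast h0
  have h1 : g 0 0 = (g 1 1)⁻¹ := eq_inv_of_mul_eq_one_left (by linarith)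
  rw [act_coe, den, hg, h1]
  push_cast
  field_simp
  ring

end Cocycle

/-! ### Compatibility of the sign with complex operations -/

section Sign

lemma Sgn.conj_mul (s : Sgn) (a b : ℂ) : s.conj (a * b) = s.conj a * s.conj b := by
  cases s <;> simp [Sgn.conj]

lemma Sgn.conj_ofReal (s : Sgn) (a : ℝ) : s.conj a = a := by
  cases s <;> simp [Sgn.conj]

lemma Sgn.conj_exp (s : Sgn) (a : ℂ) : s.conj (Complex.exp a) = Complex.exp (s.conj a) := by
  cases s
  · rfl
  · exact (Complex.exp_conj a).symm

lemma Sgn.conj_star (s : Sgn) (a : ℂ) : s.conj (star a) = star (s.conj a) := by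
  cases s <;> rfl

lemma Sgn.norm_conj (s : Sgn) (a : ℂ) : ‖s.conj a‖ = ‖a‖ := by
  cases s <;> simp [Sgn.conj]

lemma Sgn.conj_integral (s : Sgn) {α : Type*} [MeasurableSpace α] (μ : Measure α) (f : α → ℂ) :
    ∫ x, s.conj (f x) ∂μ = s.conj (∫ x, f x ∂μ) := by
  cases s
  · rfl
  · exact integral_conj

lemma Sgn.continuous_conj (s : Sgn) : Continuous s.conj := by
  cases s
  · exact continuous_id
  · exact continuous_star

lemma Sgn.integrable_conj (s : Sgn) {α : Type*} [MeasurableSpace α] {μ : Measure α} {f : α → ℂ}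
    (hf : Integrable f μ) : Integrable (fun x => s.conj (f x)) μ :=
  hf.mono (s.continuous_conj.comp_aestronglyMeasurable hf.1)
    (ae_of_all _ fun _ => (s.norm_conj _).le)

lemma u_eq_conj (s : Sgn) (g : SL2) (z : UpperHalfPlane) : u s g z = s.conj (u .plus g z) := rfl

end Sign

/-! ### Bounds and integrability on `L^X` -/

section Bounds

variable {X : Type*} [MeasurableSpace X]

/-- The hyperbolic plane is proper, so a bounded range has compact closure, on which the height and
the modulus attain their bounds. The empty closure occurs only for empty `X`. -/
lemma PlaneMaps.exists_bounds (z : PlaneMaps X) :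
    ∃ a B : ℝ, 0 < a ∧ ∀ x, a ≤ (z.toFun x).im ∧ ‖(z.toFun x : ℂ)‖ ≤ B := by
  have hK : IsCompact (closure (Set.range z.toFun)) := z.bounded.isCompact_closure
  rcases (closure (Set.range z.toFun)).eq_empty_or_nonempty with he | hne
  · refine ⟨1, 1, one_pos, fun x => ?_⟩
    have : z.toFun x ∈ closure (Set.range z.toFun) := subset_closure ⟨x, rfl⟩
    rw [he] at this
    exact this.elim
  · obtain ⟨p, -, hp⟩ := hK.exists_isMinOn hne UpperHalfPlane.continuous_im.continuousOn
    obtain ⟨B, hB⟩ := hK.exists_bound_of_continuousOn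
      UpperHalfPlane.continuous_coe.continuousOn
    exact ⟨p.im, B, p.im_pos, fun x =>
      ⟨hp (subset_closure ⟨x, rfl⟩), hB _ (subset_closure ⟨x, rfl⟩)⟩⟩

lemma PlaneMaps.measurable_coe (z : PlaneMaps X) : Measurable fun x => (z.toFun x : ℂ) :=
  UpperHalfPlane.continuous_coe.measurable.comp z.measurable

lemma PlaneMaps.ext' {z w : PlaneMaps X} (h : ∀ x, z.toFun x = w.toFun x) : z = w := by
  cases z; cases w
  congr
  exact funext h

/-- A bounded measurable function with imaginary part bounded below defines an element of `L^X`. -/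
noncomputable def PlaneMaps.mk' (w : X → ℂ) (hw : Measurable w) {a B : ℝ} (ha : 0 < a)
    (him : ∀ x, a ≤ (w x).im) (hB : ∀ x, ‖w x‖ ≤ B) : PlaneMaps X where
  toFun x := ⟨w x, ha.trans_le (him x)⟩
  measurable := by
    rw [measurable_comap_iff]
    exact hw
  bounded := by
    have hK : IsCompact (Metric.closedBall (0 : ℂ) B ∩ {w | a ≤ w.im}) :=
      (isCompact_closedBall 0 B).inter_right (isClosed_le continuous_const Complex.continuous_im)
    have hK' : IsCompact ((fun z : UpperHalfPlane => (z : ℂ)) ⁻¹'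
        (Metric.closedBall (0 : ℂ) B ∩ {w | a ≤ w.im})) := by
      refine UpperHalfPlane.isOpenEmbedding_coe.isInducing.isCompact_preimage' hK ?_
      rintro w ⟨-, hw⟩
      exact ⟨⟨w, ha.trans_le hw⟩, rfl⟩
    refine hK'.isBounded.subset ?_
    rintro _ ⟨x, rfl⟩
    exact ⟨by simpa using hB x, him x⟩

lemma measurable_den (g : Currents X) (z : PlaneMaps X) :
    Measurable fun x => den (g.1 x) (z.toFun x) := by
  have hg : ∀ i j, Measurable fun x => ((g.1 x i j : ℝ) : ℂ) := fun i j =>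
    Complex.measurable_ofReal.comp (g.2.1 i j)
  exact ((hg 0 1).mul z.measurable_coe).add (hg 0 0)

variable {m : Measure X} [IsProbabilityMeasure m]

/-- By `im_act`, `|den|² = Im z / Im gz`, and both heights are bounded above and below because `z`
and `gz` lie in `L^X`. -/
lemma integrable_log_den (g : Currents X) (z : PlaneMaps X) :
    Integrable (fun x => Complex.log (den (g.1 x) (z.toFun x))) m := by
  obtain ⟨a, B, ha, hz⟩ := z.exists_bounds
  obtain ⟨a', B', ha', hz'⟩ := (actX g z).exists_bounds
  have him : ∀ w : UpperHalfPlane, w.im ≤ ‖(w : ℂ)‖ := fun w =>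
    (le_abs_self _).trans (Complex.abs_im_le_norm _)
  have key : ∀ x, √(a / B') ≤ ‖den (g.1 x) (z.toFun x)‖ ∧
      ‖den (g.1 x) (z.toFun x)‖ ≤ √(B / a') := by
    intro x
    have h := im_act (g.1 x) (z.toFun x)
    have h1 : a' ≤ (act (g.1 x) (z.toFun x)).im := (hz' x).1
    have h2 : (act (g.1 x) (z.toFun x)).im ≤ B' := (him _).trans (hz' x).2
    have h3 := (hz x).1
    have h4 := (him _).trans (hz x).2
    have hn := sq_nonneg ‖den (g.1 x) (z.toFun x)‖
    constructor
    · rw [Real.sqrt_le_left (norm_nonneg _), div_le_iff₀ (by linarith)]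
      nlinarith
    · refine Real.le_sqrt_of_sq_le ?_
      rw [le_div_iff₀ ha']
      nlinarith
  obtain ⟨x₀⟩ : Nonempty X := nonempty_of_isProbabilityMeasure m
  have hB' : 0 < B' := ha'.trans_le ((hz' x₀).1.trans ((him _).trans (hz' x₀).2))
  refine integrable_of_bounded (Complex.measurable_log.comp (measurable_den g z)) fun x =>
    norm_log_le (Real.sqrt_pos.2 (div_pos ha hB')) (key x).1 (key x).2

/-- The constant map with value `i`. -/
noncomputable def basePoint (X : Type*) [MeasurableSpace X] : PlaneMaps X where
  toFun _ := UpperHalfPlane.I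
  measurable := measurable_const
  bounded := Bornology.IsBounded.subset Bornology.isBounded_singleton Set.range_const_subset

lemma integrable_u (s : Sgn) (g : Currents X) (z : PlaneMaps X) :
    Integrable (fun x => u s (g.1 x) (z.toFun x)) m := by
  simp only [u_eq_conj s]
  refine s.integrable_conj ?_
  simp only [u_plus_eq]
  have h1 := integrable_log_den (m := m) g z
  have h2 := integrable_log_den (m := m) g (basePoint X)
  exact h1.neg.add ((h2.sub (Sgn.minus.integrable_conj h2)).const_mul _)

lemma integrable_c (z w : PlaneMaps X) :
    Integrable (fun x => c (z.toFun x) (w.toFun x)) m := by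
  obtain ⟨a, B, ha, hz⟩ := z.exists_bounds
  obtain ⟨a', B', ha', hw⟩ := w.exists_bounds
  refine integrable_of_bounded (C := max |Real.log (a + a')| |Real.log (B + B')| + Real.pi)
    (Complex.measurable_log.comp (measurable_const.mul (z.measurable_coe.sub
      (Complex.continuous_conj.measurable.comp w.measurable_coe)))) fun x => ?_
  refine norm_log_le (by linarith) ?_ ?_
  · refine le_trans ?_ (Complex.re_le_norm _)
    have h1 := (hz x).1
    have h2 := (hw x).1
    simp
    linarith
  · rw [norm_mul, norm_neg, Complex.norm_I, one_mul]
    refine (norm_sub_le _ _).trans (add_le_add (hz x).2 ?_)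
    rw [norm_star]
    exact (hw x).2

lemma actX_mul (g h : Currents X) (z : PlaneMaps X) : actX (g * h) z = actX g (actX h z) :=
  PlaneMaps.ext' fun _ => act_mul _ _ _

lemma actX_one (z : PlaneMaps X) : actX 1 z = z :=
  PlaneMaps.ext' fun _ => act_one _

end Bounds

/-! ### The functionals -/

section Functionals

variable {X : Type*} [MeasurableSpace X]

lemma sumSq_mul_left (ξ : Cone X) (a : ℂ) (w : X → ℂ) :
    sumSq ξ (fun x => a * w x) = a * sumSq ξ w := by
  rw [sumSq, sumSq, ← tsum_mul_left]
  exact tsum_congr fun x => by ring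

lemma star_sumSq (ξ : Cone X) (w : X → ℂ) : star (sumSq ξ w) = sumSq ξ fun x => star (w x) := by
  rw [sumSq, sumSq, ← starRingEnd_apply, Complex.conj_tsum]
  exact tsum_congr fun x => by simp

lemma F_plus_eq (z : PlaneMaps X) (ξ : Cone X) :
    F .plus z ξ = Complex.exp (-sumSq ξ fun x => -Complex.I * (z.toFun x : ℂ)) := by
  rw [sumSq_mul_left]
  simp [F, Sgn.conj]

lemma F_eq_conj (s : Sgn) (z : PlaneMaps X) (ξ : Cone X) : F s z ξ = s.conj (F .plus z ξ) := rfl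

lemma PlaneMaps.measurable_rot (z : PlaneMaps X) :
    Measurable fun x => -Complex.I * (z.toFun x : ℂ) :=
  z.measurable_coe.const_mul _

lemma norm_rot (z : ℂ) : ‖-Complex.I * z‖ = ‖z‖ := by simp

lemma re_rot (z : ℂ) : (-Complex.I * z).re = z.im := by simp

variable [MeasurableSpace.CountablySeparated X]

lemma sumSq_add (ξ : Cone X) {w v : X → ℂ} (hw : Measurable w) (hv : Measurable v) {B C : ℝ}
    (hB : ∀ x, ‖w x‖ ≤ B) (hC : ∀ x, ‖v x‖ ≤ C) :
    sumSq ξ (fun x => w x + v x) = sumSq ξ w + sumSq ξ v := by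
  rw [sumSq_eq_integral ξ hw hB, sumSq_eq_integral ξ hv hC,
    sumSq_eq_integral ξ (w := fun x => w x + v x) (hw.add hv) (C := B + C) fun x =>
      (norm_add_le _ _).trans (add_le_add (hB x) (hC x)),
    integral_add (integrable_of_bounded hw hB) (integrable_of_bounded hv hC)]

lemma measurable_F (s : Sgn) (z : PlaneMaps X) : Measurable (F s z) := by
  obtain ⟨a, B, -, hz⟩ := z.exists_bounds
  have : Measurable (F .plus z) := by
    rw [show F .plus z = _ from funext (F_plus_eq z)]
    exact (measurable_sumSq z.measurable_rot (C := B) fun x => by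
      rw [norm_rot]; exact (hz x).2).neg.cexp
  exact s.continuous_conj.measurable.comp this

variable {m : Measure X} [IsProbabilityMeasure m] {L : Measure (Cone X)}

lemma IsLebesgueMeasure.memLp_exp_sqMass (hL : IsLebesgueMeasure m L) {δ : ℝ} (hδ : 0 < δ) :
    MemLp (fun ξ : Cone X => Real.exp (-(δ * (sqMeasure ξ).real Set.univ))) 2 L := by
  have hmeas : Measurable fun ξ : Cone X => Real.exp (-(δ * (sqMeasure ξ).real Set.univ)) :=
    (measurable_sqMass.const_mul δ).neg.exp
  rw [memLp_two_iff_integrable_sq hmeas.aestronglyMeasurable]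
  refine (hL.integrable_exp_sqMass (mul_pos two_pos hδ)).congr (ae_of_all _ fun ξ => ?_)
  simp only [← Real.exp_nat_mul]
  congr 1
  push_cast
  ring

lemma IsLebesgueMeasure.memLp_F (hL : IsLebesgueMeasure m L) (s : Sgn) (z : PlaneMaps X) :
    MemLp (F s z) 2 L := by
  obtain ⟨a, B, ha, hz⟩ := z.exists_bounds
  refine (hL.memLp_exp_sqMass ha).mono (measurable_F s z).aestronglyMeasurable
    (ae_of_all _ fun ξ => ?_)
  rw [F_eq_conj, s.norm_conj, F_plus_eq, Real.norm_of_nonneg (Real.exp_pos _).le]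
  exact norm_exp_neg_sumSq_le z.measurable_rot (B := B) (fun x => by
    rw [re_rot]; exact (hz x).1) (fun x => by rw [norm_rot]; exact (hz x).2) ξ

/-- The Gram matrix of the functionals. -/
lemma IsLebesgueMeasure.inner_F (hL : IsLebesgueMeasure m L) (s : Sgn) (z₁ z₂ : PlaneMaps X) :
    ⟪(hL.memLp_F s z₁).toLp, (hL.memLp_F s z₂).toLp⟫_ℂ =
      s.conj (sqConst L *
        Complex.exp (-(1 / 2 * ∫ x, c (z₂.toFun x) (z₁.toFun x) ∂m))) := by
  obtain ⟨a₁, B₁, ha₁, hz₁⟩ := z₁.exists_bounds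
  obtain ⟨a₂, B₂, ha₂, hz₂⟩ := z₂.exists_bounds
  let w : X → ℂ := fun x => -Complex.I * ((z₂.toFun x : ℂ) - star (z₁.toFun x : ℂ))
  have hms : Measurable fun x => star (z₁.toFun x : ℂ) :=
    Complex.continuous_conj.measurable.comp z₁.measurable_coe
  have hw : Measurable w := measurable_const.mul (z₂.measurable_coe.sub hms)
  have h1 := hL.integral_exp_sumSq hw (δ := a₁ + a₂) (B := B₂ + B₁) (by linarith)
    (fun x => by
      rw [re_rot]
      have := (hz₁ x).1
      have := (hz₂ x).1
      simp
      linarith)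
    (fun x => by
      rw [norm_rot]
      refine (norm_sub_le _ _).trans (add_le_add (hz₂ x).2 ?_)
      rw [norm_star]
      exact (hz₁ x).2)
  -- The product of two functionals is again an exponential of a weighted sum of squares, whose
  -- weight has real part `Im z₁ + Im z₂`.
  have h2 : ∀ ξ : Cone X, star (F .plus z₁ ξ) * F .plus z₂ ξ = Complex.exp (-sumSq ξ w) := by
    intro ξ
    have e1 : star (F .plus z₁ ξ) =
        Complex.exp (-sumSq ξ fun x => Complex.I * star (z₁.toFun x : ℂ)) := by
      rw [F_plus_eq, Complex.star_def, ← Complex.exp_conj, map_neg, ← Complex.star_def, star_sumSq]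
      congr 2
      simp
    rw [e1, F_plus_eq, ← Complex.exp_add, ← neg_add, ← sumSq_add ξ (hms.const_mul _)
      z₂.measurable_rot (B := B₁) (C := B₂)]
    · congr 3
      funext x
      simp only [w]
      ring
    · intro x
      rw [norm_mul, Complex.norm_I, one_mul, norm_star]
      exact (hz₁ x).2
    · intro x
      rw [norm_rot]
      exact (hz₂ x).2
  calc ⟪(hL.memLp_F s z₁).toLp, (hL.memLp_F s z₂).toLp⟫_ℂ
      = ∫ ξ, s.conj (star (F .plus z₁ ξ) * F .plus z₂ ξ) ∂L := by
        rw [L2.inner_def]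
        refine integral_congr_ae ?_
        filter_upwards [(hL.memLp_F s z₁).coeFn_toLp, (hL.memLp_F s z₂).coeFn_toLp] with ξ hξ₁ hξ₂
        rw [hξ₁, hξ₂, RCLike.inner_apply, s.conj_mul, s.conj_star, mul_comm]
        rfl
    _ = s.conj (∫ ξ, star (F .plus z₁ ξ) * F .plus z₂ ξ ∂L) := s.conj_integral L _
    _ = _ := by
        simp only [h2]
        rw [h1]
        rfl

/-- The multiplicative system of exponentials of linear functionals of the squares. -/
noncomputable def sqSystem (X : Type*) [MeasurableSpace X] [MeasurableSpace.CountablySeparated X] :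
    Submonoid (Cone X → ℝ) where
  carrier := {φ | ∃ g : X → ℝ, Measurable g ∧ (∀ x, 0 ≤ g x) ∧ (∃ B, ∀ x, g x ≤ B) ∧
    φ = fun ξ : Cone X => Real.exp (-∫ x, g x ∂(sqMeasure ξ))}
  one_mem' := ⟨0, measurable_const, fun _ => le_rfl, ⟨0, fun _ => le_rfl⟩, by ext; simp⟩
  mul_mem' := by
    rintro _ _ ⟨g, hg, hg0, ⟨B, hB⟩, rfl⟩ ⟨k, hk, hk0, ⟨C, hC⟩, rfl⟩
    refine ⟨g + k, hg.add hk, fun x => add_nonneg (hg0 x) (hk0 x),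
      ⟨B + C, fun x => add_le_add (hB x) (hC x)⟩, ?_⟩
    ext ξ
    have h1 : Integrable g (sqMeasure ξ) := integrable_of_bounded hg fun x => by
      rw [Real.norm_of_nonneg (hg0 x)]; exact hB x
    have h2 : Integrable k (sqMeasure ξ) := integrable_of_bounded hk fun x => by
      rw [Real.norm_of_nonneg (hk0 x)]; exact hC x
    simp only [Pi.mul_apply, Pi.add_apply]
    rw [← Real.exp_add, integral_add h1 h2, neg_add]

lemma sqSystem_measurable {φ : Cone X → ℝ} (hφ : φ ∈ sqSystem X) : Measurable φ := by
  obtain ⟨g, hg, hg0, ⟨B, hB⟩, rfl⟩ := hφ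
  exact (measurable_integral_sq_real hg (C := B) fun x => by
    rw [Real.norm_of_nonneg (hg0 x)]; exact hB x).neg.exp

lemma sqSystem_bound {φ : Cone X → ℝ} (hφ : φ ∈ sqSystem X) (ξ : Cone X) : |φ ξ| ≤ 1 := by
  obtain ⟨g, hg, hg0, -, rfl⟩ := hφ
  rw [abs_of_pos (Real.exp_pos _), Real.exp_le_one_iff, neg_nonpos]
  exact integral_nonneg hg0

lemma sqSystem_generates :
    instMeasurableSpaceCone ≤ ⨆ φ : sqSystem X, MeasurableSpace.comap φ.1 inferInstance := by
  refine cone_measurableSpace_le_of_sq _ fun A hA => ?_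
  let φ : sqSystem X := ⟨fun ξ : Cone X => Real.exp (-∫ x, A.indicator 1 x ∂(sqMeasure ξ)),
    A.indicator 1, measurable_one.indicator hA,
    Set.indicator_nonneg fun _ _ => zero_le_one, ⟨1, fun x => Set.indicator_le_self'
      (f := fun _ => (1 : ℝ)) (fun _ _ => zero_le_one) x⟩, rfl⟩
  have hφ : Measurable[⨆ φ : sqSystem X, MeasurableSpace.comap φ.1 inferInstance] φ.1 :=
    measurable_iff_comap_le.2 (le_iSup (fun φ : sqSystem X =>
      MeasurableSpace.comap φ.1 inferInstance) φ)
  have e : (fun ξ : Cone X => sqMeasure ξ A) = fun ξ => ENNReal.ofReal (-Real.log (φ.1 ξ)) := by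
    funext ξ
    simp only [φ, Real.log_exp, neg_neg]
    rw [integral_indicator_one hA, ofReal_measureReal]
  rw [e]
  exact (ENNReal.measurable_ofReal.comp (Real.measurable_log.comp hφ).neg)

/-- An integrable function orthogonal to the multiplicative system vanishes. -/
lemma ae_eq_zero_of_sqSystem {L : Measure (Cone X)} {h : Cone X → ℝ} (hh : Integrable h L)
    (h0 : ∀ φ ∈ sqSystem X, ∫ ξ, φ ξ * h ξ ∂L = 0) : h =ᵐ[L] 0 := by
  have hfin : ∀ k : Cone X → ℝ, Integrable k L → ∫⁻ ξ, ENNReal.ofReal (k ξ) ∂L ≠ ⊤ :=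
    fun k hk => (lt_of_le_of_lt (lintegral_mono fun ξ => Real.ofReal_le_enorm _) hk.2).ne
  have hf1 : IsFiniteMeasure (L.withDensity fun ξ => ENNReal.ofReal (h ξ)) :=
    isFiniteMeasure_withDensity (hfin h hh)
  have hf2 : IsFiniteMeasure (L.withDensity fun ξ => ENNReal.ofReal (-h ξ)) :=
    isFiniteMeasure_withDensity (hfin _ hh.neg)
  have ham := hh.1.aemeasurable
  have hamn : AEMeasurable (fun ξ => -h ξ) L := ham.neg
  have hbd : ∀ φ ∈ sqSystem X, ∀ k : Cone X → ℝ, Integrable k L →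
      Integrable (fun ξ => (ENNReal.ofReal (k ξ)).toReal • φ ξ) L := by
    intro φ hφ k hk
    have hkm := hk.1.aemeasurable
    refine hk.mono ((hkm.ennreal_ofReal.ennreal_toReal.aestronglyMeasurable).smul
      (sqSystem_measurable hφ).aestronglyMeasurable) (ae_of_all _ fun ξ => ?_)
    rw [norm_smul, Real.norm_of_nonneg ENNReal.toReal_nonneg, ENNReal.toReal_ofReal',
      Real.norm_eq_abs, Real.norm_eq_abs]
    calc max (k ξ) 0 * |φ ξ| ≤ |k ξ| * 1 :=
          mul_le_mul (max_le (le_abs_self _) (abs_nonneg _)) (sqSystem_bound hφ ξ) (abs_nonneg _)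
            (abs_nonneg _)
      _ = |k ξ| := mul_one _
  -- Positive and negative parts of `h` are densities of two finite measures with equal integrals
  -- over the system, so these measures coincide.
  have key : (L.withDensity fun ξ => ENNReal.ofReal (h ξ)) =
      L.withDensity fun ξ => ENNReal.ofReal (-h ξ) := by
    refine measure_ext_of_submonoid (sqSystem X) (fun φ hφ => sqSystem_measurable hφ)
      (fun φ hφ => sqSystem_bound hφ) sqSystem_generates fun φ hφ => ?_
    rw [integral_withDensity_eq_integral_toReal_smul₀ ham.ennreal_ofReal
      (ae_of_all _ fun _ => ENNReal.ofReal_lt_top),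
      integral_withDensity_eq_integral_toReal_smul₀ hamn.ennreal_ofReal
      (ae_of_all _ fun _ => ENNReal.ofReal_lt_top), ← sub_eq_zero,
      ← integral_sub (hbd φ hφ h hh) (hbd φ hφ (fun ξ => -h ξ) hh.neg), ← h0 φ hφ]
    congr 1
    funext ξ
    rw [ENNReal.toReal_ofReal', ENNReal.toReal_ofReal', ← sub_smul, smul_eq_mul, mul_comm]
    congr 1
    rcases le_total (h ξ) 0 with h' | h'
    · rw [max_eq_right h', max_eq_left (neg_nonneg.2 h')]; ring
    · rw [max_eq_left h', max_eq_right (neg_nonpos.2 h')]; ring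
  have hae := (withDensity_eq_iff ham.ennreal_ofReal hamn.ennreal_ofReal (hfin h hh)).1 key
  filter_upwards [hae] with ξ hξ
  change h ξ = 0
  rcases le_total (h ξ) 0 with h' | h'
  · rw [ENNReal.ofReal_of_nonpos h'] at hξ
    have := ENNReal.ofReal_eq_zero.1 hξ.symm
    exact le_antisymm h' (by linarith)
  · rw [ENNReal.ofReal_of_nonpos (neg_nonpos.2 h')] at hξ
    exact le_antisymm (ENNReal.ofReal_eq_zero.1 hξ) h'

/-- The functionals are total. -/
theorem IsLebesgueMeasure.total_F (hL : IsLebesgueMeasure m L) (s : Sgn) :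
    (Submodule.span ℂ (Set.range fun z : PlaneMaps X =>
      (hL.memLp_F s z).toLp)).topologicalClosure = ⊤ := by
  rw [Submodule.topologicalClosure_eq_top_iff, Submodule.eq_bot_iff]
  intro Φ hΦ
  have horth : ∀ z, ⟪(hL.memLp_F s z).toLp, Φ⟫_ℂ = 0 := fun z =>
    (Submodule.mem_orthogonal _ _).1 hΦ _ (Submodule.subset_span ⟨z, rfl⟩)
  have hE := hL.memLp_exp_sqMass one_pos
  -- `L` need not be finite; the square-integrable factor turns `Φ` into an integrable function
  -- without changing its zeros.
  let h : Cone X → ℂ := fun ξ => (Real.exp (-(1 * (sqMeasure ξ).real Set.univ)) : ℝ) * Φ ξ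
  have hh : Integrable h L := MemLp.integrable_mul hE.ofReal (Lp.memLp Φ)
  have hzero : ∀ φ ∈ sqSystem X, ∫ ξ, (φ ξ : ℂ) * h ξ ∂L = 0 := by
    rintro φ ⟨g, hg, hg0, ⟨B, hB⟩, rfl⟩
    have hw : Measurable fun x => Complex.I * ((1 + g x : ℝ) : ℂ) :=
      (Complex.measurable_ofReal.comp (hg.const_add 1)).const_mul _
    -- The summand 1 keeps the imaginary part away from zero and produces the factor `exp (-∑ rₖ²)`
    -- contained in `h`. These functionals are real, so both signs are treated at once.
    let z : PlaneMaps X := PlaneMaps.mk' (fun x => Complex.I * ((1 + g x : ℝ) : ℂ)) hw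
      (a := 1) (B := 1 + B) one_pos (fun x => by simp [hg0 x]) (fun x => by
        rw [norm_mul, Complex.norm_I, one_mul, Complex.norm_real,
          Real.norm_of_nonneg (by linarith [hg0 x])]
        linarith [hB x])
    have hF : ∀ ξ : Cone X, F s z ξ = ((Real.exp (-∫ x, g x ∂(sqMeasure ξ)) *
        Real.exp (-(1 * (sqMeasure ξ).real Set.univ)) : ℝ) : ℂ) := by
      intro ξ
      have hi : Integrable g (sqMeasure ξ) := integrable_of_bounded hg fun x => by
        rw [Real.norm_of_nonneg (hg0 x)]; exact hB x
      have e : (fun x => -Complex.I * (z.toFun x : ℂ)) = fun x => ((1 + g x : ℝ) : ℂ) := by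
        funext x
        change -Complex.I * (Complex.I * ((1 + g x : ℝ) : ℂ)) = _
        rw [← mul_assoc, neg_mul, Complex.I_mul_I, neg_neg, one_mul]
      rw [F_eq_conj, F_plus_eq, e, sumSq_eq_integral ξ
        (w := fun x => ((1 + g x : ℝ) : ℂ))
        (Complex.measurable_ofReal.comp (hg.const_add 1)) (C := 1 + B) (fun x => by
          rw [Complex.norm_real, Real.norm_of_nonneg (by linarith [hg0 x])]
          linarith [hB x])]
      rw [integral_complex_ofReal, ← Complex.ofReal_neg, ← Complex.ofReal_exp,
        s.conj_ofReal, integral_add (integrable_const _) hi, ← Real.exp_add]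
      congr 2
      simp only [integral_const, smul_eq_mul, mul_one, one_mul]
      ring
    rw [← horth z, L2.inner_def]
    refine integral_congr_ae ?_
    filter_upwards [(hL.memLp_F s z).coeFn_toLp] with ξ hξ
    rw [hξ, RCLike.inner_apply, hF, Complex.conj_ofReal]
    simp only [h]
    push_cast
    ring
  have hre : (fun ξ => (h ξ).re) =ᵐ[L] 0 := by
    refine ae_eq_zero_of_sqSystem hh.re fun φ hφ => ?_
    have hi : Integrable (fun ξ => (φ ξ : ℂ) * h ξ) L :=
      hh.bdd_mul (c := 1) (Complex.measurable_ofReal.comp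
        (sqSystem_measurable hφ)).aestronglyMeasurable (ae_of_all _ fun ξ => by
          simpa using sqSystem_bound hφ ξ)
    have := congrArg Complex.re (hzero φ hφ)
    rw [← RCLike.re_eq_complex_re, ← integral_re hi] at this
    simpa using this
  have him : (fun ξ => (h ξ).im) =ᵐ[L] 0 := by
    refine ae_eq_zero_of_sqSystem hh.im fun φ hφ => ?_
    have hi : Integrable (fun ξ => (φ ξ : ℂ) * h ξ) L :=
      hh.bdd_mul (c := 1) (Complex.measurable_ofReal.comp
        (sqSystem_measurable hφ)).aestronglyMeasurable (ae_of_all _ fun ξ => by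
          simpa using sqSystem_bound hφ ξ)
    have := congrArg Complex.im (hzero φ hφ)
    rw [← RCLike.im_eq_complex_im, ← integral_im hi] at this
    simpa using this
  rw [Lp.eq_zero_iff_ae_eq_zero]
  filter_upwards [hre, him] with ξ h1 h2
  have h3 : h ξ = 0 := Complex.ext h1 h2
  have h4 : ((Real.exp (-(1 * (sqMeasure ξ).real Set.univ)) : ℝ) : ℂ) ≠ 0 := by
    exact_mod_cast (Real.exp_pos _).ne'
  exact (mul_eq_zero.1 h3).resolve_left h4

end Functionals

/-! ### Operators determined by a total family -/

section Operators

variable {H : Type*} [NormedAddCommGroup H] [InnerProductSpace ℂ H]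

lemma denseRange_linearCombination {ι : Type*} {e : ι → H}
    (he : (Submodule.span ℂ (Set.range e)).topologicalClosure = ⊤) :
    DenseRange (Finsupp.linearCombination ℂ e) := by
  rw [DenseRange, ← LinearMap.coe_range, Finsupp.range_linearCombination]
  exact Submodule.dense_iff_topologicalClosure_eq_top.2 he

/-- Total families with the same Gram matrix are related by a unitary operator. -/
lemma exists_unitary_of_gram [CompleteSpace H] {ι : Type*} {e e' : ι → H}
    (he : (Submodule.span ℂ (Set.range e)).topologicalClosure = ⊤)
    (he' : (Submodule.span ℂ (Set.range e')).topologicalClosure = ⊤)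
    (h : ∀ i j, ⟪e' i, e' j⟫_ℂ = ⟪e i, e j⟫_ℂ) :
    ∃ U : H ≃ₗᵢ[ℂ] H, ∀ i, U (e i) = e' i := by
  have hn : ∀ x : ι →₀ ℂ, ‖Finsupp.linearCombination ℂ e' x‖ =
      ‖Finsupp.linearCombination ℂ e x‖ := by
    intro x
    rw [@norm_eq_sqrt_re_inner ℂ, @norm_eq_sqrt_re_inner ℂ]
    simp only [Finsupp.linearCombination_apply, Finsupp.sum_inner, Finsupp.inner_sum,
      inner_smul_left,
      inner_smul_right, h]
  refine ⟨(LinearEquiv.refl ℂ (ι →₀ ℂ)).extendOfIsometry _ _ (denseRange_linearCombination he)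
    (denseRange_linearCombination he') hn, fun i => ?_⟩
  have := (LinearEquiv.refl ℂ (ι →₀ ℂ)).extendOfIsometry_eq _ _ (denseRange_linearCombination he)
    (denseRange_linearCombination he') hn (Finsupp.single i 1)
  simpa using this

lemma unitary_ext_of_total {ι : Type*} {e : ι → H}
    (he : (Submodule.span ℂ (Set.range e)).topologicalClosure = ⊤) {A B : H →L[ℂ] H}
    (h : ∀ i, A (e i) = B (e i)) : A = B :=
  ContinuousLinearMap.ext_on (Submodule.dense_iff_topologicalClosure_eq_top.2 he)
    (by rintro _ ⟨i, rfl⟩; exact h i)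

/-- Weighted composition operators on `L²`. -/
lemma exists_weightedComp {α : Type*} [MeasurableSpace α] {L : Measure α} {θ : α → ℂ}
    (hθ : Measurable θ) {B : ℝ} (hB : ∀ x, ‖θ x‖ ≤ B) {τ : α → α} (hτ : Measurable τ)
    {k : ℝ≥0∞} (hk : k ≠ ⊤) (hmap : L.map τ = k • L) :
    ∃ W : Lp ℂ 2 L →L[ℂ] Lp ℂ 2 L, ∀ Φ, W Φ =ᵐ[L] fun x => θ x * Φ (τ x) := by
  have hac : ∀ {p : α → Prop}, (∀ᵐ x ∂L, p x) → ∀ᵐ x ∂L, p (τ x) := fun {p} hp =>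
    ae_of_ae_map hτ.aemeasurable (hmap ▸ Measure.ae_smul_measure hp k)
  have hcomp : ∀ Φ : Lp ℂ 2 L, AEStronglyMeasurable (fun x => Φ (τ x)) L := fun Φ => by
    refine AEStronglyMeasurable.comp_measurable (g := Φ) ?_ hτ
    rw [hmap]
    exact (Lp.aestronglyMeasurable Φ).smul_measure k
  have hnorm : ∀ Φ : Lp ℂ 2 L, eLpNorm (fun x => θ x * Φ (τ x)) 2 L ≤
      ENNReal.ofReal B * (k ^ (1 / (2 : ℝ≥0∞)).toReal * eLpNorm Φ 2 L) := by
    intro Φ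
    calc eLpNorm (fun x => θ x * Φ (τ x)) 2 L
        ≤ ENNReal.ofReal B * eLpNorm (fun x => Φ (τ x)) 2 L :=
          eLpNorm_le_mul_eLpNorm_of_ae_le_mul (ae_of_all _ fun x => by
            rw [norm_mul]
            exact mul_le_mul_of_nonneg_right (hB x) (norm_nonneg _)) 2
      _ = ENNReal.ofReal B * eLpNorm Φ 2 (L.map τ) := by
          rw [eLpNorm_map_measure _ hτ.aemeasurable]
          · rfl
          · rw [hmap]
            exact (Lp.aestronglyMeasurable Φ).smul_measure k
      _ = _ := by
          rw [hmap, eLpNorm_smul_measure_of_ne_top (by simp), smul_eq_mul]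
  have hkt : k ^ (1 / (2 : ℝ≥0∞)).toReal ≠ ⊤ :=
    ENNReal.rpow_ne_top_of_nonneg ENNReal.toReal_nonneg hk
  have hmem : ∀ Φ : Lp ℂ 2 L, MemLp (fun x => θ x * Φ (τ x)) 2 L := fun Φ =>
    ⟨hθ.aestronglyMeasurable.mul (hcomp Φ), (hnorm Φ).trans_lt
      (ENNReal.mul_lt_top ENNReal.ofReal_lt_top
        (ENNReal.mul_lt_top hkt.lt_top (Lp.memLp Φ).2))⟩
  let W : Lp ℂ 2 L →ₗ[ℂ] Lp ℂ 2 L :=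
    { toFun := fun Φ => (hmem Φ).toLp
      map_add' := fun Φ Ψ => by
        refine Lp.ext ?_
        filter_upwards [(hmem (Φ + Ψ)).coeFn_toLp, (hmem Φ).coeFn_toLp, (hmem Ψ).coeFn_toLp,
          Lp.coeFn_add (hmem Φ).toLp (hmem Ψ).toLp, hac (Lp.coeFn_add Φ Ψ)] with x h1 h2 h3 h4 h5
        rw [h1, h4, Pi.add_apply, h2, h3, h5, Pi.add_apply, mul_add]
      map_smul' := fun a Φ => by
        refine Lp.ext ?_
        filter_upwards [(hmem (a • Φ)).coeFn_toLp, (hmem Φ).coeFn_toLp,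
          Lp.coeFn_smul a (hmem Φ).toLp, hac (Lp.coeFn_smul a Φ)] with x h1 h2 h4 h5
        rw [h1, RingHom.id_apply, h4, Pi.smul_apply, h2, h5, Pi.smul_apply, smul_eq_mul,
          smul_eq_mul, mul_left_comm] }
  refine ⟨W.mkContinuous ((ENNReal.ofReal B).toReal * (k ^ (1 / (2 : ℝ≥0∞)).toReal).toReal)
    fun Φ => ?_, fun Φ => (hmem Φ).coeFn_toLp⟩
  change ‖(hmem Φ).toLp‖ ≤ _
  rw [Lp.norm_toLp, Lp.norm_def, mul_assoc, ← ENNReal.toReal_mul, ← ENNReal.toReal_mul]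
  exact ENNReal.toReal_mono (ENNReal.mul_ne_top ENNReal.ofReal_ne_top
    (ENNReal.mul_ne_top hkt (Lp.memLp Φ).2.ne)) (hnorm Φ)

end Operators

/-! ### The operators of the current group -/

section Currents

variable {X : Type*} [MeasurableSpace X]

/-- The scalar factor of the operator `U(g)` on the functional of `z`. -/
noncomputable def factor (m : Measure X) (s : Sgn) (g : Currents X) (z : PlaneMaps X) : ℂ :=
  Complex.exp (1 / 2 * ∫ x, u s (g.1 x) (z.toFun x) ∂m)

/-- The Gram kernel of the functionals, up to a constant. -/
noncomputable def gram (m : Measure X) (s : Sgn) (z₁ z₂ : PlaneMaps X) : ℂ :=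
  s.conj (Complex.exp (-(1 / 2 * ∫ x, c (z₂.toFun x) (z₁.toFun x) ∂m)))

lemma gram_ne_zero (m : Measure X) (s : Sgn) (z₁ z₂ : PlaneMaps X) : gram m s z₁ z₂ ≠ 0 := by
  rw [gram, s.conj_exp]
  exact Complex.exp_ne_zero _

lemma factor_ne_zero (m : Measure X) (s : Sgn) (g : Currents X) (z : PlaneMaps X) :
    factor m s g z ≠ 0 :=
  Complex.exp_ne_zero _

lemma factor_eq_conj (m : Measure X) (s : Sgn) (g : Currents X) (z : PlaneMaps X) :
    factor m s g z = s.conj (factor m .plus g z) := by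
  rw [factor, factor, s.conj_exp, s.conj_mul, ← s.conj_integral]
  congr 2
  simpa using (s.conj_ofReal (1 / 2)).symm

variable {m : Measure X} [IsProbabilityMeasure m]

/-- This is the exponential of `u_add_star` integrated over `X`: the scalar factors compensate the
change of the Gram kernel under `g`. -/
lemma star_factor_mul_factor (s : Sgn) (g : Currents X) (z₁ z₂ : PlaneMaps X) :
    star (factor m s g z₁) * factor m s g z₂ * gram m s (actX g z₁) (actX g z₂) =
      gram m s z₁ z₂ := by
  rw [factor_eq_conj m s g z₁, factor_eq_conj m s g z₂, ← s.conj_star, gram, gram, ← s.conj_mul,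
    ← s.conj_mul]
  congr 1
  rw [factor, factor, Complex.star_def, ← Complex.exp_conj, ← Complex.exp_add, ← Complex.exp_add]
  congr 1
  rw [map_mul, ← integral_conj, map_div₀, map_one, Complex.conj_ofNat]
  have h := integral_add (integrable_u (m := m) .plus g z₂)
    (Sgn.minus.integrable_conj (integrable_u (m := m) .plus g z₁))
  have h' := integral_sub (integrable_c (m := m) (actX g z₂) (actX g z₁)) (integrable_c z₂ z₁)
  have e : ∀ x, u .plus (g.1 x) (z₂.toFun x) + Sgn.minus.conj (u .plus (g.1 x) (z₁.toFun x)) =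
      c ((actX g z₂).toFun x) ((actX g z₁).toFun x) - c (z₂.toFun x) (z₁.toFun x) :=
    fun x => u_add_star _ _ _
  simp only [e] at h
  rw [h'] at h
  simp only [Sgn.conj, Complex.star_def] at h
  linear_combination (-(1 / 2 : ℂ)) * h

/-- The multiplier of the projective representation. -/
noncomputable def multiplier (m : Measure X) (s : Sgn) (g h : Currents X) (z : PlaneMaps X) : ℂ :=
  factor m s (g * h) z / (factor m s h z * factor m s g (actX h z))

/-- Apply the invariance of the Gram kernel to `gh`, to `h`, and to `g` at the points moved by `h`.
The nonzero kernels cancel. -/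
lemma star_multiplier_mul (s : Sgn) (g h : Currents X) (z₁ z₂ : PlaneMaps X) :
    star (multiplier m s g h z₁) * multiplier m s g h z₂ = 1 := by
  have h1 := star_factor_mul_factor (m := m) s (g * h) z₁ z₂
  have h2 := star_factor_mul_factor (m := m) s h z₁ z₂
  have h3 := star_factor_mul_factor (m := m) s g (actX h z₁) (actX h z₂)
  rw [actX_mul, actX_mul] at h1
  have n1 := gram_ne_zero m s (actX g (actX h z₁)) (actX g (actX h z₂))
  have f := factor_ne_zero m s
  have f' : ∀ g z, star (factor m s g z) ≠ 0 := fun g z => star_ne_zero.2 (f g z)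
  rw [multiplier, multiplier, star_div₀, star_mul', div_mul_div_comm, div_eq_one_iff_eq
    (mul_ne_zero (mul_ne_zero (f' _ _) (f' _ _)) (mul_ne_zero (f _ _) (f _ _)))]
  refine mul_right_cancel₀ n1 ?_
  rw [h1, ← h2, ← h3]
  ring

lemma norm_multiplier (s : Sgn) (g h : Currents X) (z : PlaneMaps X) :
    ‖multiplier m s g h z‖ = 1 := by
  have := congrArg norm (star_multiplier_mul (m := m) s g h z z)
  rw [norm_mul, norm_star, norm_one] at this
  nlinarith [norm_nonneg (multiplier m s g h z)]

/-- Its values at `z` and `w` have the same product with the conjugate of the value at `z`, which is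
nonzero since it has modulus one. -/
lemma multiplier_eq (s : Sgn) (g h : Currents X) (z w : PlaneMaps X) :
    multiplier m s g h z = multiplier m s g h w := by
  have h1 := star_multiplier_mul (m := m) s g h z z
  rw [← star_multiplier_mul (m := m) s g h z w] at h1
  exact mul_left_cancel₀ (fun h0 => by
    have := norm_multiplier (m := m) s g h z
    rw [← norm_star, h0, norm_zero] at this
    exact zero_ne_one this) h1

variable [MeasurableSpace.CountablySeparated X] {L : Measure (Cone X)}

lemma IsLebesgueMeasure.inner_F_gram (hL : IsLebesgueMeasure m L) (s : Sgn) (z₁ z₂ : PlaneMaps X) :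
    ⟪(hL.memLp_F s z₁).toLp, (hL.memLp_F s z₂).toLp⟫_ℂ = s.conj (sqConst L) * gram m s z₁ z₂ := by
  rw [hL.inner_F, s.conj_mul, gram]

lemma IsLebesgueMeasure.exists_unitary (hL : IsLebesgueMeasure m L) (s : Sgn) (g : Currents X) :
    ∃ U : INT L ≃ₗᵢ[ℂ] INT L, ∀ z : PlaneMaps X,
      U (hL.memLp_F s z).toLp = factor m s g z • (hL.memLp_F s (actX g z)).toLp := by
  refine exists_unitary_of_gram (hL.total_F s) ?_ fun z₁ z₂ => ?_
  -- The images are again total because `g` permutes `L^X` and the factors are nonzero; this gives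
  -- surjectivity of the isometry.
  · rw [eq_top_iff, ← hL.total_F s]
    refine Submodule.topologicalClosure_mono (Submodule.span_le.2 ?_)
    rintro _ ⟨z, rfl⟩
    have h : (hL.memLp_F s z).toLp = (factor m s g (actX g⁻¹ z))⁻¹ •
        (factor m s g (actX g⁻¹ z) • (hL.memLp_F s (actX g (actX g⁻¹ z))).toLp) := by
      rw [inv_smul_smul₀ (factor_ne_zero _ _ _ _)]
      simp only [← actX_mul, mul_inv_cancel, actX_one]
    rw [SetLike.mem_coe]
    beta_reduce
    rw [h]
    exact Submodule.smul_mem _ _ (Submodule.subset_span ⟨_, rfl⟩)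
  · rw [inner_smul_left, inner_smul_right, hL.inner_F_gram, hL.inner_F_gram,
      ← star_factor_mul_factor s g z₁ z₂, starRingEnd_apply]
    ring

/-- The unitary operator `U(g)`. -/
noncomputable def IsLebesgueMeasure.currentOp (hL : IsLebesgueMeasure m L) (s : Sgn)
    (g : Currents X) : INT L ≃ₗᵢ[ℂ] INT L :=
  (hL.exists_unitary s g).choose

lemma IsLebesgueMeasure.currentOp_F (hL : IsLebesgueMeasure m L) (s : Sgn) (g : Currents X)
    (z : PlaneMaps X) : hL.currentOp s g (hL.memLp_F s z).toLp =
      factor m s g z • (hL.memLp_F s (actX g z)).toLp :=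
  (hL.exists_unitary s g).choose_spec z

lemma IsLebesgueMeasure.unitary_ext (hL : IsLebesgueMeasure m L) (s : Sgn)
    {A B : INT L →L[ℂ] INT L}
    (h : ∀ z, A (hL.memLp_F s z).toLp = B (hL.memLp_F s z).toLp) : A = B :=
  unitary_ext_of_total (hL.total_F s) h

theorem IsLebesgueMeasure.isProjectiveUnitaryRep (hL : IsLebesgueMeasure m L) (s : Sgn) :
    IsProjectiveUnitaryRep (hL.currentOp s) := by
  refine ⟨?_, fun g h => multiplier m s g h (basePoint X), fun g h => norm_multiplier _ _ _ _,
    fun g h v => ?_⟩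
  · have : ((hL.currentOp s 1).toContinuousLinearEquiv : INT L →L[ℂ] INT L) =
        ContinuousLinearMap.id ℂ _ := by
      refine hL.unitary_ext s fun z => ?_
      have h1 : factor m s 1 z = 1 := by
        have : ∀ x, u s ((1 : Currents X).1 x) (z.toFun x) = 0 := fun x => u_one s _
        simp only [factor, this, integral_zero, mul_zero, Complex.exp_zero]
      have := hL.currentOp_F s 1 z
      rw [h1, one_smul] at this
      simp only [actX_one] at this
      exact this
    ext1 v
    exact DFunLike.congr_fun this v
  · have : ((hL.currentOp s (g * h)).toContinuousLinearEquiv : INT L →L[ℂ] INT L) =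
        multiplier m s g h (basePoint X) •
          ((hL.currentOp s g).toContinuousLinearEquiv : INT L →L[ℂ] INT L) ∘L
          ((hL.currentOp s h).toContinuousLinearEquiv : INT L →L[ℂ] INT L) := by
      refine hL.unitary_ext s fun z => ?_
      change hL.currentOp s (g * h) _ = multiplier m s g h (basePoint X) •
        hL.currentOp s g (hL.currentOp s h _)
      rw [hL.currentOp_F, hL.currentOp_F, map_smul, hL.currentOp_F,
        multiplier_eq s g h (basePoint X) z, smul_smul, smul_smul, multiplier]
      simp only [actX_mul]
      rw [mul_assoc, div_mul_cancel₀ _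
        (mul_ne_zero (factor_ne_zero _ _ _ _) (factor_ne_zero _ _ _ _))]
    exact DFunLike.congr_fun this v

end Currents

/-! ### The parabolic subgroup -/

section Parabolic

variable {X : Type*} [MeasurableSpace X]

lemma parabolic_det (p : ParabolicCurrents X) (x : X) : p.1.1 x 0 0 * eps p x = 1 := by
  have h := det_eq (p.1.1 x)
  rw [p.2 x] at h
  simpa [eps] using h

lemma eps_ne_zero (p : ParabolicCurrents X) (x : X) : eps p x ≠ 0 :=
  right_ne_zero_of_mul_eq_one (parabolic_det p x)

lemma parabolic_zero_zero (p : ParabolicCurrents X) (x : X) : p.1.1 x 0 0 = (eps p x)⁻¹ :=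
  eq_inv_of_mul_eq_one_left (parabolic_det p x)

lemma eps_mul (p q : ParabolicCurrents X) (x : X) : eps (p * q) x = eps p x * eps q x := by
  have h : q.1.1 x 0 1 = 0 := q.2 x
  simp [eps, Matrix.SpecialLinearGroup.coe_mul, Matrix.mul_apply, Fin.sum_univ_two, h]

lemma gam_mul (p q : ParabolicCurrents X) (x : X) :
    gam (p * q) x = gam p x / eps q x + eps p x * gam q x := by
  rw [div_eq_mul_inv, ← parabolic_zero_zero]
  simp [eps, gam, Matrix.SpecialLinearGroup.coe_mul, Matrix.mul_apply, Fin.sum_univ_two]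

lemma parabolic_ext {p q : ParabolicCurrents X} (h1 : ∀ x, eps p x = eps q x)
    (h2 : ∀ x, gam p x = gam q x) : p = q := by
  refine Subtype.ext (Subtype.ext (funext fun x => Subtype.ext ?_))
  ext i j
  fin_cases i <;> fin_cases j
  · exact (parabolic_zero_zero p x).trans ((congrArg _ (h1 x)).trans (parabolic_zero_zero q x).symm)
  · exact (p.2 x).trans (q.2 x).symm
  · exact h2 x
  · exact h1 x

/-- The element `(e, γ)` of `P^X`. -/
noncomputable def parab (e γ : X → ℝ) (he : Measurable e) (hγ : Measurable γ) {C : ℝ}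
    (h0 : ∀ x, e x ≠ 0) (h1 : ∀ x, |e x| ≤ C) (h2 : ∀ x, |(e x)⁻¹| ≤ C) (h3 : ∀ x, |γ x| ≤ C) :
    ParabolicCurrents X :=
  ⟨⟨fun x => ⟨!![(e x)⁻¹, 0; γ x, e x], by
      rw [Matrix.det_fin_two_of, inv_mul_cancel₀ (h0 x)]
      ring⟩, by
    refine ⟨fun i j => ?_, C, fun x i j => ?_⟩
    · fin_cases i <;> fin_cases j
      · exact he.inv
      · exact measurable_const
      · exact hγ
      · exact he
    · fin_cases i <;> fin_cases j
      · exact h2 x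
      · simpa using (abs_nonneg _).trans (h3 x)
      · exact h3 x
      · exact h1 x⟩, fun _ => rfl⟩

lemma eps_measurable (p : ParabolicCurrents X) : Measurable (eps p) := p.1.2.1 1 1

lemma gam_measurable (p : ParabolicCurrents X) : Measurable (gam p) := p.1.2.1 1 0

/-- The element `(1, γ)` of `P^X`. -/
noncomputable def unipotent (γ : X → ℝ) (hγ : Measurable γ) {C : ℝ} (h3 : ∀ x, |γ x| ≤ C) :
    ParabolicCurrents X :=
  parab 1 γ measurable_one hγ (C := max 1 C) (fun _ => one_ne_zero)
    (fun _ => by simp) (fun _ => by simp) fun x => (h3 x).trans (le_max_right _ _)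

/-- The element `(e, 0)` of `P^X`. -/
noncomputable def diagonal (e : X → ℝ) (he : Measurable e) {C : ℝ} (h0 : ∀ x, e x ≠ 0)
    (h1 : ∀ x, |e x| ≤ C) (h2 : ∀ x, |(e x)⁻¹| ≤ C) : ParabolicCurrents X :=
  parab e 0 he measurable_zero h0 h1 h2 fun x => by
    simpa using (abs_nonneg _).trans (h1 x)

lemma eps_unipotent {γ : X → ℝ} (hγ : Measurable γ) {C : ℝ} (h3 : ∀ x, |γ x| ≤ C) (x : X) :
    eps (unipotent γ hγ h3) x = 1 := rfl

lemma gam_unipotent {γ : X → ℝ} (hγ : Measurable γ) {C : ℝ} (h3 : ∀ x, |γ x| ≤ C) (x : X) :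
    gam (unipotent γ hγ h3) x = γ x := rfl

lemma eps_diagonal {e : X → ℝ} (he : Measurable e) {C : ℝ} (h0 : ∀ x, e x ≠ 0)
    (h1 : ∀ x, |e x| ≤ C) (h2 : ∀ x, |(e x)⁻¹| ≤ C) (x : X) :
    eps (diagonal e he h0 h1 h2) x = e x := rfl

lemma gam_diagonal {e : X → ℝ} (he : Measurable e) {C : ℝ} (h0 : ∀ x, e x ≠ 0)
    (h1 : ∀ x, |e x| ≤ C) (h2 : ∀ x, |(e x)⁻¹| ≤ C) (x : X) :
    gam (diagonal e he h0 h1 h2) x = 0 := rfl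

/-- The centre of `P^X` consists of the maps with values `±1`. -/
lemma mem_center_parabolic {p : ParabolicCurrents X} :
    p ∈ Subgroup.center (ParabolicCurrents X) ↔ ∀ x, eps p x ^ 2 = 1 ∧ gam p x = 0 := by
  rw [Subgroup.mem_center_iff]
  constructor
  · intro h x
    -- Commuting with `(1, 1)` forces `ε⁻¹ = ε`, and commuting with `(2, 0)` forces `2γ = γ/2`.
    have h1 := congrArg (fun q => gam q x) (h (unipotent (fun _ => 1) measurable_const
      (C := 1) fun _ => by simp))
    have h2 := congrArg (fun q => gam q x) (h (diagonal (fun _ => 2) measurable_const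
      (C := 2) (fun _ => two_ne_zero) (fun _ => by simp) fun _ => by norm_num))
    simp only [gam_mul, eps_unipotent, gam_unipotent, eps_diagonal, gam_diagonal] at h1 h2
    have h0 := eps_ne_zero p x
    refine ⟨?_, by rw [zero_div, mul_zero] at h2; linarith⟩
    have h3 : 1 / eps p x = eps p x := by linarith
    rw [div_eq_iff h0] at h3
    rw [sq, ← h3]
  · intro h q
    refine parabolic_ext (fun x => ?_) fun x => ?_
    · rw [eps_mul, eps_mul, mul_comm]
    · have h0 := eps_ne_zero p x
      have h1 := eps_ne_zero q x
      obtain ⟨h2, h3⟩ := h x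
      rw [gam_mul, gam_mul, h3]
      have h4 : (eps p x)⁻¹ = eps p x := inv_eq_of_mul_eq_one_left (by rw [← sq, h2])
      rw [div_eq_mul_inv, h4]
      ring

lemma exists_eps_bounds (p : ParabolicCurrents X) :
    ∃ C, ∀ x, |eps p x| ≤ C ∧ |(eps p x)⁻¹| ≤ C ∧ |gam p x| ≤ C := by
  obtain ⟨C, hC⟩ := p.1.2.2
  exact ⟨C, fun x => ⟨hC x 1 1, (parabolic_zero_zero p x) ▸ hC x 0 0, hC x 1 0⟩⟩

/-- Every element of `P^X` is the product of a central, a unipotent and a positive diagonal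
element. -/
lemma exists_parabolic_factorization (p : ParabolicCurrents X) :
    ∃ a b d : ParabolicCurrents X, a ∈ Subgroup.center (ParabolicCurrents X) ∧
      (∀ x, eps b x = 1) ∧ (∀ x, gam d x = 0) ∧ (∀ x, 0 < eps d x) ∧
      (∃ C, ∀ x, eps d x ≤ C) ∧ p = a * (b * d) := by
  obtain ⟨C, hC⟩ := exists_eps_bounds p
  have hn := eps_ne_zero p
  have hm := eps_measurable p
  have hσ : ∀ x, |eps p x / abs (eps p x)| = 1 := fun x => by
    rw [abs_div, abs_abs, div_self (abs_ne_zero.2 (hn x))]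
  refine ⟨diagonal (fun x => eps p x / |eps p x|) (hm.div hm.abs) (C := 1)
      (fun x => div_ne_zero (hn x) (abs_ne_zero.2 (hn x))) (fun x => (hσ x).le)
      (fun x => by rw [abs_inv, hσ, inv_one]),
    -- The entry `ε γ` is the one for which `(sgn ε, 0)(1, ε γ)(|ε|, 0) = (ε, γ)`.
    unipotent (fun x => eps p x * gam p x) (hm.mul (gam_measurable p)) (C := C * C)
      (fun x => by
        rw [abs_mul]
        exact mul_le_mul (hC x).1 (hC x).2.2 (abs_nonneg _) ((abs_nonneg _).trans (hC x).1)),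
    diagonal (fun x => |eps p x|) hm.abs (C := C) (fun x => abs_ne_zero.2 (hn x))
      (fun x => by rw [abs_abs]; exact (hC x).1)
      (fun x => by rw [abs_inv, abs_abs, ← abs_inv]; exact (hC x).2.1),
    mem_center_parabolic.2 fun x => ⟨?_, rfl⟩, fun x => rfl, fun x => rfl,
    fun x => abs_pos.2 (hn x), ⟨C, fun x => (hC x).1⟩, parabolic_ext (fun x => ?_) fun x => ?_⟩
  · rw [eps_diagonal, ← sq_abs, hσ, one_pow]
  · rw [eps_mul, eps_mul, eps_diagonal, eps_diagonal, eps_unipotent, one_mul,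
      div_mul_cancel₀ _ (abs_ne_zero.2 (hn x))]
  · rw [gam_mul, gam_mul, gam_diagonal, gam_diagonal, eps_diagonal, eps_diagonal, gam_unipotent,
      mul_zero, add_zero, zero_div, zero_add]
    have h1 := abs_mul_abs_self (eps p x)
    have h2 := abs_ne_zero.2 (hn x)
    field_simp
    rw [sq_abs]

lemma actX_parabolic_coe (p : ParabolicCurrents X) (z : PlaneMaps X) (x : X) :
    ((actX p.1 z).toFun x : ℂ) =
      (eps p x : ℂ) ^ 2 * (z.toFun x : ℂ) + (eps p x : ℂ) * (gam p x : ℂ) :=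
  act_parabolic _ (p.2 x) _

lemma u_parabolic_current (s : Sgn) (p : ParabolicCurrents X) (z : PlaneMaps X) (x : X) :
    u s (p.1.1 x) (z.toFun x) = (Real.log (eps p x) : ℝ) := by
  rw [u_eq_conj, u_parabolic _ (p.2 x), s.conj_ofReal, eps]

variable {m : Measure X}

lemma factor_parabolic (s : Sgn) (p : ParabolicCurrents X) (z : PlaneMaps X) :
    factor m s p.1 z = (Real.exp (1 / 2 * ∫ x, Real.log (eps p x) ∂m) : ℝ) := by
  rw [factor]
  simp only [u_parabolic_current]
  rw [integral_complex_ofReal]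
  push_cast
  rfl

variable [IsProbabilityMeasure m]

lemma integrable_log_eps (p : ParabolicCurrents X) :
    Integrable (fun x => Real.log (eps p x)) m := by
  have := (integrable_u (m := m) .plus p.1 (basePoint X)).re
  simpa only [u_parabolic_current, RCLike.re_eq_complex_re, Complex.ofReal_re] using this

/-- On `P^X` the factor does not depend on the plane map and `log |ε|` is additive, so the
projective representation has trivial multiplier there. -/
lemma factor_parabolic_mul (s : Sgn) (p q : ParabolicCurrents X) (z w : PlaneMaps X) :
    factor m s (p * q).1 z = factor m s p.1 w * factor m s q.1 z := by
  rw [factor_parabolic, factor_parabolic, factor_parabolic, ← Complex.ofReal_mul, ← Real.exp_add,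
    ← mul_add, ← integral_add (integrable_log_eps p) (integrable_log_eps q)]
  congr 5
  funext x
  rw [eps_mul, Real.log_mul (eps_ne_zero p x) (eps_ne_zero q x)]

end Parabolic

/-! ### Multiplicators -/

section Scale

variable {X : Type*} [MeasurableSpace X] {a : X → ℝ} (ha : Measurable a) (hpos : ∀ x, 0 < a x)
  (hb : ∃ C, ∀ x, a x ≤ C)

lemma measurable_scale : Measurable (scale a ha hpos hb) := by
  have h := cone_measurableSpace_le
    (MeasurableSpace.map (scale a ha hpos hb) instMeasurableSpaceCone) fun A hA => by
      have : Measurable fun ξ : Cone X => (scale a ha hpos hb ξ).1 A := by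
        simp only [scale, withDensity_apply _ hA]
        simp only [← lintegral_indicator hA]
        exact (Measure.measurable_lintegral (ha.ennreal_ofReal.indicator hA)).comp
          measurable_subtype_coe
      exact fun _ hs => this hs
  exact measurable_iff_le_map.2 h

lemma lintegral_scale (ξ : Cone X) {f : X → ℝ} (hf : Measurable f) :
    ∫⁻ x, ENNReal.ofReal (f x) ∂(scale a ha hpos hb ξ).1 =
      ∫⁻ x, ENNReal.ofReal (a x * f x) ∂ξ.1 := by
  rw [scale, lintegral_withDensity_eq_lintegral_mul _ ha.ennreal_ofReal hf.ennreal_ofReal]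
  refine lintegral_congr fun x => ?_
  rw [Pi.mul_apply, ENNReal.ofReal_mul (hpos x).le]

/-- The image of the Lebesgue measure under a multiplicator. -/
theorem IsLebesgueMeasure.map_scale [MeasurableSpace.CountablySeparated X] {m : Measure X}
    [IsProbabilityMeasure m] {L : Measure (Cone X)} (hL : IsLebesgueMeasure m L)
    (hlog : Integrable (fun x => Real.log (a x)) m) :
    L.map (scale a ha hpos hb) = ENNReal.ofReal (Real.exp (-∫ x, Real.log (a x) ∂m)) • L := by
  -- Testing the image with `f` amounts to testing `L` with `a f`, and `log (a f)` splits; the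
  -- rescaled image has the same Laplace transform as `L`, so uniqueness applies.
  have hL' : IsLebesgueMeasure m
      (ENNReal.ofReal (Real.exp (∫ x, Real.log (a x) ∂m)) • L.map (scale a ha hpos hb)) := by
    intro f hf hf0 hfpos hflog
    rw [lintegral_smul_measure, lintegral_map (measurable_exp_neg_lintegral hf)
      (measurable_scale ha hpos hb)]
    simp only [lintegral_scale ha hpos hb _ hf]
    have hae : (fun x => Real.log (a x * f x)) =ᵐ[m] fun x => Real.log (a x) + Real.log (f x) := by
      filter_upwards [hfpos] with x hx
      exact Real.log_mul (hpos x).ne' hx.ne'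
    rw [hL (fun x => a x * f x) (ha.mul hf) (fun x => mul_nonneg (hpos x).le (hf0 x))
      (hfpos.mono fun x hx => mul_pos (hpos x) hx) ((hlog.add hflog).congr hae.symm),
      integral_congr_ae hae, integral_add hlog hflog, smul_eq_mul,
      ← ENNReal.ofReal_mul (Real.exp_pos _).le, ← Real.exp_add]
    congr 2
    ring
  nth_rw 2 [hL.unique hL']
  rw [smul_smul, ← ENNReal.ofReal_mul (Real.exp_pos _).le, ← Real.exp_add, neg_add_cancel,
    Real.exp_zero, ENNReal.ofReal_one, one_smul]

lemma sumSq_scale [MeasurableSpace.CountablySeparated X] (ξ : Cone X) (w : X → ℂ) :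
    sumSq (scale a ha hpos hb ξ) w = sumSq ξ fun x => (a x : ℂ) ^ 2 * w x := by
  rw [sumSq, sumSq]
  refine tsum_congr fun x => ?_
  have : (scale a ha hpos hb ξ).1.real {x} = a x * ξ.1.real {x} := by
    rw [scale, measureReal_def, withDensity_apply _ (measurableSet_singleton x),
      lintegral_singleton, ENNReal.toReal_mul, ENNReal.toReal_ofReal (hpos x).le, measureReal_def]
  rw [this]
  push_cast
  ring

end Scale

/-! ### The integral model -/

section Model

variable {X : Type*} [MeasurableSpace X]

lemma norm_conj_exp_sumSq_ofReal (s : Sgn) (ξ : Cone X) (γ : X → ℝ) :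
    ‖s.conj (Complex.exp (Complex.I * sumSq ξ fun x => (γ x : ℂ)))‖ = 1 := by
  have h := star_sumSq ξ fun x => (γ x : ℂ)
  simp only [Complex.star_def, Complex.conj_ofReal] at h
  rw [s.norm_conj, Complex.norm_exp, Complex.I_mul_re, Complex.conj_eq_iff_im.1 h, neg_zero,
    Real.exp_zero]

/-- The integral model is unique. -/
theorem IsIntegralModel.unique {m : Measure X} {L : Measure (Cone X)} {s : Sgn}
    {V V' : ParabolicCurrents X →* (INT L ≃ₗᵢ[ℂ] INT L)}
    (hV : IsIntegralModel m L s V) (hV' : IsIntegralModel m L s V') : V' = V := by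
  ext1 p
  obtain ⟨a, b, d, ha, hb, hd, hpos, hC, rfl⟩ := exists_parabolic_factorization p
  rw [map_mul, map_mul, map_mul, map_mul, hV.2.2 a ha, hV'.2.2 a ha]
  have h1 : V' b = V b := by
    ext1 Φ
    refine Lp.ext ?_
    filter_upwards [hV.1 b hb Φ, hV'.1 b hb Φ] with ξ h h'
    rw [h, h']
  have h2 : V' d = V d := by
    ext1 Φ
    refine Lp.ext ?_
    filter_upwards [hV.2.1 d hd (eps_measurable d) hpos hC Φ,
      hV'.2.1 d hd (eps_measurable d) hpos hC Φ] with ξ h h'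
    rw [h, h']
  rw [h1, h2]

variable [MeasurableSpace.CountablySeparated X] {m : Measure X} [IsProbabilityMeasure m]
  {L : Measure (Cone X)}

/-- An operator which is a weighted composition on the functionals is one everywhere. -/
lemma IsLebesgueMeasure.ae_eq_weightedComp (hL : IsLebesgueMeasure m L) (s : Sgn)
    {θ : Cone X → ℂ} (hθ : Measurable θ) {B : ℝ} (hB : ∀ ξ, ‖θ ξ‖ ≤ B) {τ : Cone X → Cone X}
    (hτ : Measurable τ) {k : ℝ≥0∞} (hk : k ≠ ⊤) (hmap : L.map τ = k • L) (V : INT L ≃ₗᵢ[ℂ] INT L)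
    (hV : ∀ z, V (hL.memLp_F s z).toLp =ᵐ[L] fun ξ => θ ξ * F s z (τ ξ)) (Φ : INT L) :
    V Φ =ᵐ[L] fun ξ => θ ξ * Φ (τ ξ) := by
  obtain ⟨W, hW⟩ := exists_weightedComp hθ hB hτ hk hmap
  -- Two bounded operators that agree on the total family of functionals are equal.
  have : (V.toContinuousLinearEquiv : INT L →L[ℂ] INT L) = W := by
    refine hL.unitary_ext s fun z => Lp.ext ?_
    have h1 : ∀ᵐ ξ ∂L, ((hL.memLp_F s z).toLp : INT L) (τ ξ) = F s z (τ ξ) :=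
      ae_of_ae_map hτ.aemeasurable (hmap ▸ Measure.ae_smul_measure (hL.memLp_F s z).coeFn_toLp k)
    filter_upwards [hV z, hW (hL.memLp_F s z).toLp, h1] with ξ h2 h3 h4
    rw [h3, h4]
    exact h2
  have h2 : V Φ = W Φ := DFunLike.congr_fun this Φ
  rw [h2]
  exact hW Φ

/-- The restriction of the operators of the current group to `P^X`. -/
noncomputable def IsLebesgueMeasure.model (hL : IsLebesgueMeasure m L) (s : Sgn) :
    ParabolicCurrents X →* (INT L ≃ₗᵢ[ℂ] INT L) :=
  MonoidHom.mk' (fun p => hL.currentOp s p.1) fun p q => by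
    have : ((hL.currentOp s (p * q).1).toContinuousLinearEquiv : INT L →L[ℂ] INT L) =
        ((hL.currentOp s p.1).toContinuousLinearEquiv : INT L →L[ℂ] INT L) ∘L
          ((hL.currentOp s q.1).toContinuousLinearEquiv : INT L →L[ℂ] INT L) := by
      refine hL.unitary_ext s fun z => ?_
      change hL.currentOp s (p * q).1 _ = hL.currentOp s p.1 (hL.currentOp s q.1 _)
      rw [hL.currentOp_F, hL.currentOp_F, map_smul, hL.currentOp_F,
        factor_parabolic_mul s p q z (actX q.1 z), smul_smul, mul_comm]
      simp only [Subgroup.coe_mul, actX_mul]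
    ext1 v
    exact DFunLike.congr_fun this v

lemma IsLebesgueMeasure.model_F (hL : IsLebesgueMeasure m L) (s : Sgn) (p : ParabolicCurrents X)
    (z : PlaneMaps X) : hL.model s p (hL.memLp_F s z).toLp =ᵐ[L] fun ξ =>
      (Real.exp (1 / 2 * ∫ x, Real.log (eps p x) ∂m) : ℝ) * F s (actX p.1 z) ξ := by
  have h : hL.model s p (hL.memLp_F s z).toLp =
      factor m s p.1 z • (hL.memLp_F s (actX p.1 z)).toLp := hL.currentOp_F s p.1 z
  rw [h, factor_parabolic]
  filter_upwards [Lp.coeFn_smul ((Real.exp (1 / 2 * ∫ x, Real.log (eps p x) ∂m) : ℝ) : ℂ)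
    (hL.memLp_F s (actX p.1 z)).toLp, (hL.memLp_F s (actX p.1 z)).coeFn_toLp] with ξ h1 h2
  rw [h1, Pi.smul_apply, h2, smul_eq_mul]

/-- Each formula is checked on the functionals. A unipotent element shifts `z` by `γ`, which
multiplies by an exponential. A positive diagonal element replaces `z` by `ε² z`, which amounts to
dilating `ξ` by `ε`. A central element fixes every `z` and has factor 1. -/
theorem IsLebesgueMeasure.isIntegralModel (hL : IsLebesgueMeasure m L) (s : Sgn) :
    IsIntegralModel m L s (hL.model s) := by
  refine ⟨fun p hp Φ => ?_, fun p hp hm hpos hb Φ => ?_, fun p hp => ?_⟩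
  · obtain ⟨C, hC⟩ := exists_eps_bounds p
    have hγ : Measurable fun x => ((gam p x : ℝ) : ℂ) :=
      Complex.measurable_ofReal.comp (gam_measurable p)
    have hγC : ∀ x, ‖((gam p x : ℝ) : ℂ)‖ ≤ C := fun x => by
      rw [Complex.norm_real]; exact (hC x).2.2
    refine hL.ae_eq_weightedComp s (τ := id) (k := 1) ?_
      (fun ξ => (norm_conj_exp_sumSq_ofReal s ξ _).le) measurable_id ENNReal.one_ne_top
      (by rw [Measure.map_id, one_smul]) _ (fun z => ?_) Φ
    · exact s.continuous_conj.measurable.comp ((measurable_sumSq hγ hγC).const_mul _).cexp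
    · filter_upwards [hL.model_F s p z] with ξ hξ
      obtain ⟨a, B, -, hB⟩ := z.exists_bounds
      have e : (fun x => ((actX p.1 z).toFun x : ℂ)) =
          fun x => ((gam p x : ℝ) : ℂ) + (z.toFun x : ℂ) := by
        funext x
        rw [actX_parabolic_coe, hp]
        push_cast
        ring
      rw [hξ, id, F, F, e, sumSq_add ξ hγ z.measurable_coe hγC fun x => (hB x).2, mul_add,
        Complex.exp_add, s.conj_mul]
      simp [hp]
  · refine hL.ae_eq_weightedComp s measurable_const (fun _ => le_rfl)
      (measurable_scale hm hpos hb) ENNReal.ofReal_ne_top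
      (hL.map_scale hm hpos hb (integrable_log_eps p)) _ (fun z => ?_) Φ
    filter_upwards [hL.model_F s p z] with ξ hξ
    rw [hξ, F, F, sumSq_scale]
    simp only [actX_parabolic_coe, hp, Complex.ofReal_zero, mul_zero, add_zero]
  · have hp' := mem_center_parabolic.1 hp
    have hact : ∀ z, actX p.1 z = z := fun z => PlaneMaps.ext' fun x => UpperHalfPlane.ext (by
      rw [actX_parabolic_coe, (hp' x).2, ← Complex.ofReal_pow, (hp' x).1]
      simp)
    -- From `ε² = 1`: `2 log ε = log ε² = 0`, valid for either sign of `ε`.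
    have hlog : ∀ x, Real.log (eps p x) = 0 := fun x => by
      have := Real.log_pow (eps p x) 2
      rw [(hp' x).1, Real.log_one] at this
      simpa using this.symm
    have : ((hL.model s p).toContinuousLinearEquiv : INT L →L[ℂ] INT L) =
        ContinuousLinearMap.id ℂ _ := by
      refine hL.unitary_ext s fun z => ?_
      have h := hL.currentOp_F s p.1 z
      simp only [hact, factor_parabolic, hlog, integral_zero, mul_zero, Real.exp_zero,
        Complex.ofReal_one, one_smul] at h
      exact h
    ext1 v
    exact DFunLike.congr_fun this v

end Model

end CurrentRep

theorem mainTheorem7 {X : Type*} [MeasurableSpace X] [MeasurableSpace.CountablySeparated X]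
    (m : MeasureTheory.Measure X) [MeasureTheory.IsProbabilityMeasure m] :
    (∃! L : MeasureTheory.Measure (CurrentRep.Cone X), CurrentRep.IsLebesgueMeasure m L) ∧
    ∀ L : MeasureTheory.Measure (CurrentRep.Cone X), CurrentRep.IsLebesgueMeasure m L →
    ∀ s : CurrentRep.Sgn,
    ∃ hF : ∀ z : CurrentRep.PlaneMaps X, MeasureTheory.MemLp (CurrentRep.F s z) 2 L,
      (Submodule.span ℂ (Set.range fun z : CurrentRep.PlaneMaps X =>
        (hF z).toLp)).topologicalClosure = ⊤ ∧
      (∀ (g : CurrentRep.Currents X) (z : CurrentRep.PlaneMaps X),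
        MeasureTheory.Integrable (fun x => CurrentRep.u s (g.1 x) (z.toFun x)) m) ∧
      ∃ U : CurrentRep.Currents X → (CurrentRep.INT L ≃ₗᵢ[ℂ] CurrentRep.INT L),
        (∀ (g : CurrentRep.Currents X) (z : CurrentRep.PlaneMaps X),
          U g (hF z).toLp =
            Complex.exp (1 / 2 * ∫ x, CurrentRep.u s (g.1 x) (z.toFun x) ∂m) •
              (hF (CurrentRep.actX g z)).toLp) ∧
        CurrentRep.IsProjectiveUnitaryRep U ∧
        ∃ V : CurrentRep.ParabolicCurrents X →* (CurrentRep.INT L ≃ₗᵢ[ℂ] CurrentRep.INT L),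
          CurrentRep.IsIntegralModel m L s V ∧
          (∀ V' : CurrentRep.ParabolicCurrents X →* (CurrentRep.INT L ≃ₗᵢ[ℂ] CurrentRep.INT L),
            CurrentRep.IsIntegralModel m L s V' → V' = V) ∧
          ∀ p : CurrentRep.ParabolicCurrents X, U p.1 = V p :=
  ⟨⟨_, CurrentRep.isLebesgueMeasure_lebesgueCone, fun _ hL =>
      hL.unique CurrentRep.isLebesgueMeasure_lebesgueCone⟩,
    fun _ hL s => ⟨hL.memLp_F s, hL.total_F s, CurrentRep.integrable_u s, hL.currentOp s,
      hL.currentOp_F s, hL.isProjectiveUnitaryRep s, hL.model s, hL.isIntegralModel s,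
      fun _ hV' => (hL.isIntegralModel s).unique hV', fun _ => rfl⟩⟩
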